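/- Let $\mathfrak g^\sharp=(i:\mathfrak g\to\mathfrak h)$ be a differential graded Lie pair over $\mathbb C$, i.e. a homomorphism of $\mathbb Z$-graded differential graded Lie algebras over $\mathbb C$. Regard it as the total complex with $\mathfrak g^n\oplus\mathfrak h^{n-1}$ in degree $n$ and differential $(a,b)\mapsto(da,\,i(a)-db)$; let $\mathbb H^n(\mathfrak g^\sharp)$ be its cohomology and $h^n(\mathfrak g^\sharp)=\dim_{\mathbb C}\mathbb H^n(\mathfrak g^\sharp)$. The Jacobi-Bernoulli complex $J^\sharp(\mathfrak g^\sharp)$ is the reduced graded-symmetric coalgebra $$J^\sharp(\mathfrak g^\sharp)=\bigoplus_{k>0}\mathrm{Sym}^k(\mathfrak g[1]\oplus\mathfrak h)=\bigoplus_{n+m>0}\bigwedge\nolimits^n\mathfrak g\otimes\mathrm{Sym}^m\mathfrak h ,$$ whose comultiplication $\Delta$ is induced by $\Delta v=v\otimes1+1\otimes v$, with the differential which is the unique coderivation whose composite with the projection to $\mathfrak g[1]\oplus\mathfrak h$ is the sum of the internal differentials ($-d$ on $\mathfrak g[1]$, $d$ on $\mathfrak h$), of $a_1\wedge a_2\mapsto(-1)^{|a_1|+1}[a_1,a_2]\in\mathfrak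 g$ on $\bigwedge^2\mathfrak g$, and, for every $t\ge0$, of $$\mathfrak g\otimes\mathrm{Sym}^t\mathfrak h\to\mathfrak h,\qquad a\otimes b_1\cdots b_t\mapsto \frac{B_t}{t!}\sum_{\sigma\in S_t}\pm[\cdots[[i(a),b_{\sigma(1)}],b_{\sigma(2)}],\cdots,b_{\sigma(t)}]$$ (Koszul signs; $B_t$ the Bernoulli numbers, $\sum_t B_tx^t/t!=x/(e^x-1)$). Let $$R(\mathfrak g^\sharp)=\mathbb C\oplus\mathrm{Hom}_{\mathbb C}(\mathbb H^0(J^\sharp(\mathfrak g^\sharp)),\mathbb C)$$ be the deformation ring, a commutative $\mathbb C$-algebra with product dual to the comultiplication, let $\mathfrak m=\mathbb H^0(J^\sharp(\mathfrak g^\sharp))^*$ be its maximal ideal, and $\hat R(\mathfrak g^\sharp)=\varprojlim_e R(\mathfrak g^\sharp)/\mathfrak m^e$. If $\mathbb H^n(\mathfrak g^\sharp)=0$ for all $n\le0$ and $h^1(\mathfrak g^\sharp)$, $h^2(\mathfrak g^\sharp)$ are finite, then the Krull dimension of $\hat R(\mathfrak g^\sharp)$ satisfies $$\dim\hat R(\mathfrak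 g^\sharp)\ \ge\ h^1(\mathfrak g^\sharp)-h^2(\mathfrak g^\sharp).$$ -/

import Mathlib

open scoped TensorProduct

noncomputable section

namespace KoszulSym

section Basic

variable {V : Type*} [AddCommGroup V] [Module ℂ V] (gr : ℤ → Submodule ℂ V)

/-- The Koszul commutation relation `v w = (-1)^{|v||w|} w v` for homogeneous `v`, `w`. -/
inductive Rel : TensorAlgebra ℂ V → TensorAlgebra ℂ V → Prop
  | comm {p q : ℤ} {v w : V} (hv : v ∈ gr p) (hw : w ∈ gr q) :
      Rel (TensorAlgebra.ι ℂ v * TensorAlgebra.ι ℂ w)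
        ((-1 : ℂ) ^ (p * q) • (TensorAlgebra.ι ℂ w * TensorAlgebra.ι ℂ v))

/-- The graded symmetric algebra `Sym V` of a graded vector space. -/
def Sym := RingQuot (Rel gr)

instance : Ring (Sym gr) := inferInstanceAs (Ring (RingQuot (Rel gr)))

instance : Algebra ℂ (Sym gr) := inferInstanceAs (Algebra ℂ (RingQuot (Rel gr)))

/-- The quotient map from the tensor algebra. -/
def mk : TensorAlgebra ℂ V →ₐ[ℂ] Sym gr := RingQuot.mkAlgHom ℂ (Rel gr)

/-- The inclusion `V → Sym V`. -/
def ι : V →ₗ[ℂ] Sym gr := (mk gr).toLinearMap ∘ₗ TensorAlgebra.ι ℂ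

/-- Graded-commuting linear maps into an algebra extend to `Sym V`. -/
def lift {A : Type*} [Semiring A] [Algebra ℂ A] (f : V →ₗ[ℂ] A)
    (hf : ∀ (p q : ℤ) (v w : V), v ∈ gr p → w ∈ gr q →
      f v * f w = (-1 : ℂ) ^ (p * q) • (f w * f v)) : Sym gr →ₐ[ℂ] A :=
  (RingQuot.liftAlgHom ℂ ⟨TensorAlgebra.lift ℂ f, by
    rintro _ _ ⟨hv, hw⟩
    simpa using hf _ _ _ _ hv hw⟩ : RingQuot (Rel gr) →ₐ[ℂ] A)

@[simp] theorem lift_ι {A : Type*} [Semiring A] [Algebra ℂ A] (f : V →ₗ[ℂ] A)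
    (hf : ∀ (p q : ℤ) (v w : V), v ∈ gr p → w ∈ gr q →
      f v * f w = (-1 : ℂ) ^ (p * q) • (f w * f v)) (v : V) : lift gr f hf (ι gr v) = f v := by
  have := RingQuot.liftAlgHom_mkAlgHom_apply ℂ (TensorAlgebra.lift ℂ f) (s := Rel gr) (by
    rintro _ _ ⟨hv, hw⟩
    simpa using hf _ _ _ _ hv hw) (TensorAlgebra.ι ℂ v)
  rw [TensorAlgebra.lift_ι_apply] at this
  exact this

theorem mk_surjective : Function.Surjective (mk gr) := RingQuot.mkAlgHom_surjective ℂ (Rel gr)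

theorem ι_comm {p q : ℤ} {v w : V} (hv : v ∈ gr p) (hw : w ∈ gr q) :
    ι gr v * ι gr w = (-1 : ℂ) ^ (p * q) • (ι gr w * ι gr v) := by
  have h : mk gr _ = mk gr _ := RingQuot.mkAlgHom_rel ℂ (Rel.comm (gr := gr) hv hw)
  simpa [ι] using h

theorem adjoin_ι : Algebra.adjoin ℂ (Set.range (ι gr)) = ⊤ := by
  have h : (mk gr).range = ⊤ :=
    (AlgHom.range_eq_top _).2 (mk_surjective gr)
  rw [← h, ← Algebra.map_top, ← TensorAlgebra.adjoin_range_ι, AlgHom.map_adjoin]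
  congr 1
  ext x
  simp [ι]

/-- `IsMonomial gr k n x`: `x = v₁ ⋯ v_k` with homogeneous `v_i` of total degree `n`. -/
inductive IsMonomial : ℕ → ℤ → Sym gr → Prop
  | one : IsMonomial 0 0 1
  | cons {k : ℕ} {p n : ℤ} {v : V} {x : Sym gr} (hv : v ∈ gr p) (hx : IsMonomial k n x) :
      IsMonomial (k + 1) (p + n) (ι gr v * x)

/-- The degree `n` part of `Sym V`. -/
def deg (n : ℤ) : Submodule ℂ (Sym gr) := Submodule.span ℂ {x | ∃ k, IsMonomial gr k n x}

/-- The degree `n` part of the reduced symmetric coalgebra `⨁_{k > 0} Sym^k V`. -/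
def redDeg (n : ℤ) : Submodule ℂ (Sym gr) :=
  Submodule.span ℂ {x | ∃ k, 0 < k ∧ IsMonomial gr k n x}

/-- The action of `V` on `ℂ ⊕ V` by `v • (c, w) = (0, c v)`. -/
def shiftAction : V →ₗ[ℂ] Module.End ℂ (ℂ × V) :=
  LinearMap.mk₂ ℂ (fun v z => ((0 : ℂ), z.1 • v)) (fun v w z => by simp) (fun c v z => by simp [smul_comm z.1 c v])
    (fun v z w => by simp [add_smul]) (fun c v z => by simp [mul_smul])

/-- The action of `Sym V` on `ℂ ⊕ V = Sym V / Sym^{≥ 2} V`. -/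
def truncAction : Sym gr →ₐ[ℂ] Module.End ℂ (ℂ × V) :=
  lift gr (A := Module.End ℂ (ℂ × V)) shiftAction (by
    intro p q v w _ _
    ext <;> simp [shiftAction])

/-- The projection of `Sym V` onto `Sym^1 V = V`. -/
def proj : Sym gr →ₗ[ℂ] V :=
  LinearMap.snd ℂ ℂ V ∘ₗ LinearMap.applyₗ ((1, 0) : ℂ × V) ∘ₗ (truncAction gr).toLinearMap

/-- The algebra map `Sym V → (Sym V)[T]` which is multiplication by `T^k` on `Sym^k V`. -/
def weight : Sym gr →ₐ[ℂ] Polynomial (Sym gr) :=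
  lift gr (A := Polynomial (Sym gr))
    (((Polynomial.monomial 1 : Sym gr →ₗ[Sym gr] Polynomial (Sym gr)).restrictScalars ℂ) ∘ₗ ι gr) (by
    intro p q v w hv hw
    simp only [LinearMap.comp_apply, LinearMap.restrictScalars_apply,
      Polynomial.monomial_mul_monomial, ι_comm gr hv hw, Polynomial.smul_monomial])

/-- The augmentation `Sym V → ℂ`. -/
def counit : Sym gr →ₐ[ℂ] ℂ := lift gr 0 (by simp)

theorem counit_ι_mul (v : V) (x : Sym gr) : counit gr (ι gr v * x) = 0 := by simp [counit]

theorem proj_one : proj gr 1 = 0 := by simp [proj]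

theorem proj_ι_mul_one (v : V) : proj gr (ι gr v * 1) = v := by
  simp [proj, truncAction, shiftAction]

theorem proj_ι_mul_ι_mul (v w : V) (x : Sym gr) : proj gr (ι gr v * (ι gr w * x)) = 0 := by
  simp [proj, truncAction, shiftAction]

theorem weight_ι_mul (v : V) (x : Sym gr) :
    weight gr (ι gr v * x) = Polynomial.monomial 1 (ι gr v) * weight gr x := by
  simp [weight]

theorem redDeg_le_deg (n : ℤ) : redDeg gr n ≤ deg gr n :=
  Submodule.span_mono fun _ ⟨k, _, hx⟩ => ⟨k, hx⟩

theorem proj_monomial {k n x} (hx : IsMonomial gr k n x) : proj gr x ∈ gr n := by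
  rcases hx with _ | ⟨hv, hx⟩
  · rw [proj_one]; exact zero_mem _
  rcases hx with _ | ⟨hw, hx⟩
  · rw [proj_ι_mul_one, add_zero]; exact hv
  · rw [proj_ι_mul_ι_mul]; exact zero_mem _

theorem weight_monomial {k n x} (hx : IsMonomial gr k n x) :
    weight gr x = Polynomial.monomial k x := by
  induction hx with
  | one => simp
  | cons hv _ ih => rw [weight_ι_mul, ih, Polynomial.monomial_mul_monomial, add_comm]

theorem counit_of_mem_redDeg {n : ℤ} {x : Sym gr} (hx : x ∈ redDeg gr n) : counit gr x = 0 := by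
  induction hx using Submodule.span_induction with
  | mem x hx =>
    obtain ⟨k, hk, hx⟩ := hx
    cases hx with
    | one => omega
    | cons hv hx => exact counit_ι_mul gr _ _
  | zero => simp
  | add a b _ _ ha hb => rw [map_add, ha, hb, add_zero]
  | smul c a _ ha => rw [map_smul, ha, smul_zero]

theorem sub_counit_mem {n : ℤ} {x : Sym gr} (hx : x ∈ deg gr n) :
    x - counit gr x • 1 ∈ redDeg gr n := by
  induction hx using Submodule.span_induction with
  | mem x hx =>
    obtain ⟨k, hx⟩ := hx
    cases hx with
    | one => simp
    | cons hv hx =>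
      rw [counit_ι_mul, zero_smul, sub_zero]
      exact Submodule.subset_span ⟨_, Nat.succ_pos _, .cons hv hx⟩
  | zero => simp
  | add a b _ _ ha hb =>
    have : a + b - counit gr (a + b) • 1 = (a - counit gr a • 1) + (b - counit gr b • 1) := by
      rw [map_add]; module
    rw [this]; exact add_mem ha hb
  | smul c a _ ha =>
    have : c • a - counit gr (c • a) • (1 : Sym gr) = c • (a - counit gr a • 1) := by
      rw [map_smul, smul_eq_mul]; module
    rw [this]; exact Submodule.smul_mem _ _ ha

theorem redDeg_of_ne {n : ℤ} (hn : n ≠ 0) : redDeg gr n = deg gr n := by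
  refine le_antisymm (redDeg_le_deg gr n) (Submodule.span_mono ?_)
  rintro x ⟨k, hx⟩
  refine ⟨k, Nat.pos_of_ne_zero ?_, hx⟩
  rintro rfl
  cases hx
  exact hn rfl

variable [DirectSum.Decomposition gr]

/-- The parity operator: multiplication by `(-1)^p` on degree `p`. -/
def parity : V →ₗ[ℂ] V :=
  (DirectSum.toModule ℂ ℤ V fun p => (-1 : ℂ) ^ p • (gr p).subtype) ∘ₗ
    (DirectSum.decomposeLinearEquiv gr).toLinearMap

theorem parity_of_mem {p : ℤ} {v : V} (hv : v ∈ gr p) : parity gr v = (-1 : ℂ) ^ p • v := by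
  simp only [parity, LinearMap.comp_apply, LinearEquiv.coe_coe, DirectSum.decomposeLinearEquiv_apply,
    DirectSum.decompose_of_mem gr hv]
  erw [DirectSum.toModule_lof]
  rfl

/-- The even part of a vector. -/
def evenPart : V →ₗ[ℂ] V := (1 / 2 : ℂ) • (LinearMap.id + parity gr)

/-- The odd part of a vector. -/
def oddPart : V →ₗ[ℂ] V := (1 / 2 : ℂ) • (LinearMap.id - parity gr)

/-- The parity automorphism of `Sym V`. -/
def sgn : Sym gr →ₐ[ℂ] Sym gr :=
  lift gr (ι gr ∘ₗ parity gr) (by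
    intro p q v w hv hw
    simp [parity_of_mem gr hv, parity_of_mem gr hw, ι_comm gr hv hw, smul_smul]
    ring_nf)

/-- Left multiplication by `Δ v = v ⊗ 1 + 1 ⊗ v` on the graded tensor product
`Sym V ⊗ Sym V`, i.e. `a ⊗ b ↦ v a ⊗ b + (-1)^{|v||a|} a ⊗ v b`. -/
def mulPrim : V →ₗ[ℂ] Module.End ℂ (Sym gr ⊗[ℂ] Sym gr) :=
  (LinearMap.rTensorHom (Sym gr)) ∘ₗ LinearMap.mul ℂ (Sym gr) ∘ₗ ι gr +
  (LinearMap.lTensorHom (Sym gr)) ∘ₗ LinearMap.mul ℂ (Sym gr) ∘ₗ ι gr ∘ₗ evenPart gr +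
  (TensorProduct.mapBilinear (RingHom.id ℂ) (Sym gr) (Sym gr) (Sym gr) (Sym gr)
    (sgn gr).toLinearMap) ∘ₗ LinearMap.mul ℂ (Sym gr) ∘ₗ ι gr ∘ₗ oddPart gr

theorem mulPrim_tmul (v : V) (a b : Sym gr) :
    mulPrim gr v (a ⊗ₜ b) = (ι gr v * a) ⊗ₜ b + a ⊗ₜ (ι gr (evenPart gr v) * b) +
      sgn gr a ⊗ₜ (ι gr (oddPart gr v) * b) := by
  simp [mulPrim]

theorem sgn_ι_mul {p : ℤ} {v : V} (hv : v ∈ gr p) (a : Sym gr) :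
    sgn gr (ι gr v * a) = (-1 : ℂ) ^ p • (ι gr v * sgn gr a) := by
  simp [sgn, parity_of_mem gr hv]

theorem evenPart_of_mem {p : ℤ} {v : V} (hv : v ∈ gr p) :
    evenPart gr v = (if Even p then (1 : ℂ) else 0) • v := by
  simp only [evenPart, LinearMap.smul_apply, LinearMap.add_apply, LinearMap.id_apply,
    parity_of_mem gr hv]
  split_ifs with h
  · rw [h.neg_one_zpow]; module
  · rw [(Int.not_even_iff_odd.1 h).neg_one_zpow]; module

theorem oddPart_of_mem {p : ℤ} {v : V} (hv : v ∈ gr p) :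
    oddPart gr v = (if Even p then (0 : ℂ) else 1) • v := by
  simp only [oddPart, LinearMap.smul_apply, LinearMap.sub_apply, LinearMap.id_apply,
    parity_of_mem gr hv]
  split_ifs with h
  · rw [h.neg_one_zpow]; module
  · rw [(Int.not_even_iff_odd.1 h).neg_one_zpow]; module

theorem mulPrim_comm (p q : ℤ) (v w : V) (hv : v ∈ gr p) (hw : w ∈ gr q) :
    mulPrim gr v * mulPrim gr w = (-1 : ℂ) ^ (p * q) • (mulPrim gr w * mulPrim gr v) := by
  ext1
  ext a b
  have hvw := ι_comm gr hv hw
  simp only [TensorProduct.AlgebraTensorModule.curry_apply, LinearMap.restrictScalars_self,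
    TensorProduct.curry_apply, Module.End.mul_apply, LinearMap.smul_apply, mulPrim_tmul, map_add,
    sgn_ι_mul gr hv, sgn_ι_mul gr hw, evenPart_of_mem gr hv, evenPart_of_mem gr hw,
    oddPart_of_mem gr hv, oddPart_of_mem gr hw]
  rcases Int.even_or_odd p with hp | hp <;> rcases Int.even_or_odd q with hq | hq <;>
    simp [hp, hq, hp.neg_one_zpow, hq.neg_one_zpow, Int.not_even_iff_odd.2,
      Even.neg_one_zpow, Odd.neg_one_zpow, ← mul_assoc, hvw, TensorProduct.neg_tmul,
      TensorProduct.tmul_neg] <;> module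

/-- The comultiplication of `Sym V`: the algebra map to the graded tensor product
`Sym V ⊗ Sym V` with `Δ v = v ⊗ 1 + 1 ⊗ v`. -/
def comul : Sym gr →ₗ[ℂ] Sym gr ⊗[ℂ] Sym gr :=
  (LinearMap.applyₗ (1 ⊗ₜ[ℂ] 1 : Sym gr ⊗[ℂ] Sym gr)) ∘ₗ
    (lift gr (A := Module.End ℂ (Sym gr ⊗[ℂ] Sym gr)) (mulPrim gr) (mulPrim_comm gr)).toLinearMap

/-- The coderivation of `Sym V` with corestriction `q : Sym V → V`, i.e.
`x ↦ ∑ q(x') x''` where `Δ x = ∑ x' ⊗ x''`. -/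
def coder (q : Sym gr →ₗ[ℂ] V) : Sym gr →ₗ[ℂ] Sym gr :=
  TensorProduct.lift (LinearMap.mul ℂ (Sym gr) ∘ₗ ι gr ∘ₗ q) ∘ₗ comul gr

/-- The convolution product `(θ ⊗ η) ∘ Δ` of functionals on `Sym V`. -/
def conv (θ η : Sym gr →ₗ[ℂ] ℂ) : Sym gr →ₗ[ℂ] ℂ :=
  LinearMap.mul' ℂ ℂ ∘ₗ TensorProduct.map θ η ∘ₗ comul gr

/-! Basic properties -/

theorem comul_one : comul gr 1 = 1 ⊗ₜ 1 := by simp [comul]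

theorem comul_ι_mul (v : V) (x : Sym gr) :
    comul gr (ι gr v * x) = mulPrim gr v (comul gr x) := by simp [comul]

theorem mem_span_monomial (x : Sym gr) :
    x ∈ Submodule.span ℂ {x | ∃ k n, IsMonomial gr k n x} := by
  set M := Submodule.span ℂ {x | ∃ k n, IsMonomial gr k n x} with hM
  have key : ∀ y ∈ Algebra.adjoin ℂ (Set.range (ι gr)), ∀ z ∈ M, y * z ∈ M := by
    intro y hy
    induction hy using Algebra.adjoin_induction with
    | mem y hy =>
      obtain ⟨v, rfl⟩ := hy
      intro z hz
      induction hz using Submodule.span_induction with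
      | mem z hz =>
        obtain ⟨k, n, hz⟩ := hz
        induction v using DirectSum.Decomposition.inductionOn gr with
        | zero => simp
        | homogeneous v => exact Submodule.subset_span ⟨_, _, .cons v.2 hz⟩
        | add v w hv hw => rw [map_add, add_mul]; exact add_mem hv hw
      | zero => simp
      | add a b _ _ ha hb => rw [mul_add]; exact add_mem ha hb
      | smul c a _ ha => rw [mul_smul_comm]; exact M.smul_mem _ ha
    | algebraMap r => intro z hz; rw [← Algebra.smul_def]; exact M.smul_mem _ hz
    | add a b _ _ ha hb => intro z hz; rw [add_mul]; exact add_mem (ha z hz) (hb z hz)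
    | mul a b _ _ ha hb => intro z hz; rw [mul_assoc]; exact ha _ (hb z hz)
  have := key x (by rw [adjoin_ι]; trivial) 1 (Submodule.subset_span ⟨0, 0, .one⟩)
  simpa using this

theorem ext_monomial {M : Type*} [AddCommMonoid M] [Module ℂ M] {f g : Sym gr →ₗ[ℂ] M}
    (h : ∀ k n x, IsMonomial gr k n x → f x = g x) : f = g := by
  ext x
  have hx := mem_span_monomial gr x
  induction hx using Submodule.span_induction with
  | mem x hx => obtain ⟨k, n, hx⟩ := hx; exact h k n x hx
  | zero => simp
  | add a b _ _ ha hb => simp [ha, hb]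
  | smul c a _ ha => simp [ha]

/-- Linear maps agreeing at `1` and compatibly with left multiplication by homogeneous vectors
are equal. -/
theorem ext_left {M : Type*} [AddCommMonoid M] [Module ℂ M] {f g : Sym gr →ₗ[ℂ] M}
    (h1 : f 1 = g 1)
    (h : ∀ p v x, v ∈ gr p → f x = g x → f (ι gr v * x) = g (ι gr v * x)) : f = g := by
  refine ext_monomial gr fun k n x hx => ?_
  induction hx with
  | one => exact h1
  | cons hv _ ih => exact h _ _ _ hv ih

theorem sgn_monomial {k n x} (hx : IsMonomial gr k n x) : sgn gr x = (-1 : ℂ) ^ n • x := by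
  induction hx with
  | one => simp
  | cons hv _ ih =>
    rw [sgn_ι_mul gr hv, ih, mul_smul_comm, smul_smul, zpow_add₀ (by norm_num)]

theorem sgn_sgn (x : Sym gr) : sgn gr (sgn gr x) = x := by
  have : (sgn gr).toLinearMap ∘ₗ (sgn gr).toLinearMap = LinearMap.id := by
    refine ext_monomial gr fun k n x hx => ?_
    simp [sgn_monomial gr hx, smul_smul, ← mul_zpow]
  exact LinearMap.congr_fun this x

theorem map_sgn_mulPrim {p : ℤ} {v : V} (hv : v ∈ gr p) (t : Sym gr ⊗[ℂ] Sym gr) :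
    TensorProduct.map (sgn gr).toLinearMap (sgn gr).toLinearMap (mulPrim gr v t) =
      (-1 : ℂ) ^ p • mulPrim gr v
        (TensorProduct.map (sgn gr).toLinearMap (sgn gr).toLinearMap t) := by
  induction t with
  | zero => simp
  | add a b ha hb => simp [ha, hb]
  | tmul a b =>
    simp only [mulPrim_tmul, map_add, TensorProduct.map_tmul, AlgHom.toLinearMap_apply,
      sgn_ι_mul gr hv, evenPart_of_mem gr hv, oddPart_of_mem gr hv]
    rcases Int.even_or_odd p with hp | hp <;>
      simp [hp, hp.neg_one_zpow, Int.not_even_iff_odd.2, sgn_ι_mul gr hv, sgn_sgn,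
        TensorProduct.neg_tmul, TensorProduct.tmul_neg]

theorem map_sgn_comul (x : Sym gr) :
    TensorProduct.map (sgn gr).toLinearMap (sgn gr).toLinearMap (comul gr x) =
      comul gr (sgn gr x) := by
  have : TensorProduct.map (sgn gr).toLinearMap (sgn gr).toLinearMap ∘ₗ comul gr =
      comul gr ∘ₗ (sgn gr).toLinearMap := by
    refine ext_left gr (by simp [comul_one]) fun p v x hv ih => ?_
    simp only [LinearMap.comp_apply, AlgHom.toLinearMap_apply] at ih ⊢
    rw [comul_ι_mul, map_sgn_mulPrim gr hv, ih, sgn_ι_mul gr hv, map_smul, comul_ι_mul]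
  exact LinearMap.congr_fun this x

/-- Left multiplication by `v ⊗ 1 ⊗ 1 + 1 ⊗ v ⊗ 1 + 1 ⊗ 1 ⊗ v`. -/
def mulPrim₃ (v : V) : Module.End ℂ (Sym gr ⊗[ℂ] (Sym gr ⊗[ℂ] Sym gr)) :=
  TensorProduct.map (LinearMap.mul ℂ (Sym gr) (ι gr v)) LinearMap.id +
  TensorProduct.map LinearMap.id (mulPrim gr (evenPart gr v)) +
  TensorProduct.map (sgn gr).toLinearMap (mulPrim gr (oddPart gr v))

theorem assoc_mulPrim {p : ℤ} {v : V} (hv : v ∈ gr p) (t : Sym gr ⊗[ℂ] Sym gr) (b : Sym gr) :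
    TensorProduct.assoc ℂ (Sym gr) (Sym gr) (Sym gr)
      (mulPrim gr v t ⊗ₜ b + t ⊗ₜ (ι gr (evenPart gr v) * b) +
        TensorProduct.map (sgn gr).toLinearMap (sgn gr).toLinearMap t ⊗ₜ
          (ι gr (oddPart gr v) * b)) =
      mulPrim₃ gr v (TensorProduct.assoc ℂ _ _ _ (t ⊗ₜ b)) := by
  induction t with
  | zero => simp
  | add a b ha hb =>
    simp only [map_add, TensorProduct.add_tmul] at ha hb ⊢
    rw [← ha, ← hb]; abel
  | tmul a c =>
    rcases Int.even_or_odd p with hp | hp <;>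
      simp [mulPrim₃, mulPrim_tmul, evenPart_of_mem gr hv, oddPart_of_mem gr hv, hp,
        Int.not_even_iff_odd.2, TensorProduct.add_tmul, TensorProduct.tmul_add] <;> abel

theorem coassoc (x : Sym gr) :
    TensorProduct.assoc ℂ (Sym gr) (Sym gr) (Sym gr)
      (LinearMap.rTensor (Sym gr) (comul gr) (comul gr x)) =
      LinearMap.lTensor (Sym gr) (comul gr) (comul gr x) := by
  have h1 : ∀ {p : ℤ} {v : V} (_ : v ∈ gr p) (t : Sym gr ⊗[ℂ] Sym gr),
      TensorProduct.assoc ℂ (Sym gr) (Sym gr) (Sym gr)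
        (LinearMap.rTensor (Sym gr) (comul gr) (mulPrim gr v t)) =
      mulPrim₃ gr v (TensorProduct.assoc ℂ (Sym gr) (Sym gr) (Sym gr)
        (LinearMap.rTensor (Sym gr) (comul gr) t)) := by
    intro p v hv t
    induction t with
    | zero => simp
    | add a b ha hb => simp only [map_add, ha, hb]
    | tmul a b =>
      simp only [mulPrim_tmul, map_add, LinearMap.rTensor_tmul, comul_ι_mul, ← map_sgn_comul]
      rw [← assoc_mulPrim gr hv]
      simp only [map_add]
  have h2 : ∀ (v : V) (t : Sym gr ⊗[ℂ] Sym gr),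
      LinearMap.lTensor (Sym gr) (comul gr) (mulPrim gr v t) =
      mulPrim₃ gr v (LinearMap.lTensor (Sym gr) (comul gr) t) := by
    intro v t
    induction t with
    | zero => simp
    | add a b ha hb => simp only [map_add, ha, hb]
    | tmul a b => simp [mulPrim_tmul, mulPrim₃, comul_ι_mul]
  have : (TensorProduct.assoc ℂ (Sym gr) (Sym gr) (Sym gr)).toLinearMap ∘ₗ
      LinearMap.rTensor (Sym gr) (comul gr) ∘ₗ comul gr =
      LinearMap.lTensor (Sym gr) (comul gr) ∘ₗ comul gr := by
    refine ext_left gr (by simp [comul_one]) fun p v x hv ih => ?_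
    simp only [LinearMap.comp_apply, LinearEquiv.coe_coe] at ih ⊢
    rw [comul_ι_mul, h1 hv, ih, h2]
  exact LinearMap.congr_fun this x

/-- The Koszul sign `a ⊗ b ↦ (-1)^{|a||b|} a ⊗ b`. -/
def koszul : Module.End ℂ (Sym gr ⊗[ℂ] Sym gr) :=
  (1 / 2 : ℂ) • (LinearMap.id + TensorProduct.map (sgn gr).toLinearMap LinearMap.id +
    TensorProduct.map LinearMap.id (sgn gr).toLinearMap -
    TensorProduct.map (sgn gr).toLinearMap (sgn gr).toLinearMap)

theorem koszul_tmul (a b : Sym gr) : koszul gr (a ⊗ₜ b) =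
    (1 / 2 : ℂ) • (a ⊗ₜ b + sgn gr a ⊗ₜ b + a ⊗ₜ sgn gr b - sgn gr a ⊗ₜ sgn gr b) := by
  simp [koszul]

theorem cocomm (x : Sym gr) :
    TensorProduct.comm ℂ (Sym gr) (Sym gr) (koszul gr (comul gr x)) = comul gr x := by
  have h1 : ∀ {p : ℤ} {v : V} (_ : v ∈ gr p) (t : Sym gr ⊗[ℂ] Sym gr),
      TensorProduct.comm ℂ (Sym gr) (Sym gr) (koszul gr (mulPrim gr v t)) =
      mulPrim gr v (TensorProduct.comm ℂ (Sym gr) (Sym gr) (koszul gr t)) := by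
    intro p v hv t
    induction t with
    | zero => simp
    | add a b ha hb => simp only [map_add, ha, hb]
    | tmul a b =>
      rcases Int.even_or_odd p with hp | hp <;>
        simp [mulPrim_tmul, koszul_tmul, evenPart_of_mem gr hv, oddPart_of_mem gr hv, hp,
          hp.neg_one_zpow, sgn_ι_mul gr hv, sgn_sgn,
          Int.not_even_iff_odd.2, TensorProduct.neg_tmul, TensorProduct.tmul_neg] <;> module
  have : (TensorProduct.comm ℂ (Sym gr) (Sym gr)).toLinearMap ∘ₗ koszul gr ∘ₗ comul gr =
      comul gr := by
    refine ext_left gr ?_ fun p v x hv ih => ?_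
    · simp [comul_one, koszul_tmul]
      module
    simp only [LinearMap.comp_apply, LinearEquiv.coe_coe] at ih ⊢
    rw [comul_ι_mul, h1 hv, ih]
  exact LinearMap.congr_fun this x

/-! Coderivations -/

theorem comul_coder {q : Sym gr →ₗ[ℂ] V} (hq : ∀ x, q (sgn gr x) = -parity gr (q x))
    (x : Sym gr) : comul gr (coder gr q x) =
      LinearMap.rTensor (Sym gr) (coder gr q) (comul gr x) +
      TensorProduct.map (sgn gr).toLinearMap (coder gr q) (comul gr x) := by
  -- the three maps `a ⊗ b ⊗ c ↦ q(a) b ⊗ c`, `± b ⊗ q(a) c`, `(-1)^{|a|} a ⊗ q(b) c`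
  let μ : Sym gr ⊗[ℂ] Sym gr →ₗ[ℂ] Sym gr :=
    TensorProduct.lift (LinearMap.mul ℂ (Sym gr) ∘ₗ ι gr ∘ₗ q)
  let E : Sym gr ⊗[ℂ] Sym gr →ₗ[ℂ] Sym gr :=
    TensorProduct.lift (LinearMap.mul ℂ (Sym gr) ∘ₗ ι gr ∘ₗ evenPart gr ∘ₗ q)
  let O : Sym gr ⊗[ℂ] Sym gr →ₗ[ℂ] Sym gr :=
    TensorProduct.lift (LinearMap.mul ℂ (Sym gr) ∘ₗ ι gr ∘ₗ oddPart gr ∘ₗ q)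
  let F1 : Sym gr ⊗[ℂ] (Sym gr ⊗[ℂ] Sym gr) →ₗ[ℂ] Sym gr ⊗[ℂ] Sym gr :=
    LinearMap.rTensor (Sym gr) μ ∘ₗ (TensorProduct.assoc ℂ _ _ _).symm.toLinearMap
  let F2 : Sym gr ⊗[ℂ] (Sym gr ⊗[ℂ] Sym gr) →ₗ[ℂ] Sym gr ⊗[ℂ] Sym gr :=
    (LinearMap.lTensor (Sym gr) E + TensorProduct.map (sgn gr).toLinearMap O) ∘ₗ
      (TensorProduct.leftComm ℂ (Sym gr) (Sym gr) (Sym gr)).toLinearMap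
  let G : Sym gr ⊗[ℂ] (Sym gr ⊗[ℂ] Sym gr) →ₗ[ℂ] Sym gr ⊗[ℂ] Sym gr :=
    TensorProduct.map (sgn gr).toLinearMap μ
  have e1 : ∀ t, comul gr (μ t) = (F1 + F2) (LinearMap.lTensor (Sym gr) (comul gr) t) := by
    intro t
    induction t with
    | zero => simp
    | add a b ha hb => simp only [map_add, ha, hb]
    | tmul a b =>
      have : ∀ s, mulPrim gr (q a) s = (F1 + F2) (a ⊗ₜ s) := by
        intro s
        induction s with
        | zero => simp
        | add c d hc hd => simp only [map_add, hc, hd, TensorProduct.tmul_add]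
        | tmul c d => simp [F1, F2, μ, E, O, mulPrim_tmul, add_assoc]
      simp only [LinearMap.lTensor_tmul, ← this]
      simp [μ, comul_ι_mul]
  have e2 : ∀ t, F1 (TensorProduct.assoc ℂ _ _ _ (LinearMap.rTensor (Sym gr) (comul gr) t)) =
      LinearMap.rTensor (Sym gr) (coder gr q) t := by
    intro t
    induction t with
    | zero => simp
    | add a b ha hb => simp only [map_add, ha, hb]
    | tmul a b => simp [F1, μ, coder]
  have e3 : ∀ t, G (LinearMap.lTensor (Sym gr) (comul gr) t) =
      TensorProduct.map (sgn gr).toLinearMap (coder gr q) t := by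
    intro t
    induction t with
    | zero => simp
    | add a b ha hb => simp only [map_add, ha, hb]
    | tmul a b => simp [G, μ, coder]
  have e4 : ∀ s c, F2 (TensorProduct.assoc ℂ _ _ _
      (TensorProduct.comm ℂ (Sym gr) (Sym gr) (koszul gr s) ⊗ₜ c)) =
      G (TensorProduct.assoc ℂ _ _ _ (s ⊗ₜ c)) := by
    intro s c
    induction s with
    | zero => simp
    | add a b ha hb => simp only [map_add, TensorProduct.add_tmul, ha, hb]
    | tmul a b =>
      have hF : ∀ y z : Sym gr, F2 (y ⊗ₜ (z ⊗ₜ c)) =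
          z ⊗ₜ (ι gr (evenPart gr (q y)) * c) + sgn gr z ⊗ₜ (ι gr (oddPart gr (q y)) * c) := by
        intro y z; simp [F2, E, O]
      have hG : G (TensorProduct.assoc ℂ _ _ _ ((a ⊗ₜ[ℂ] b) ⊗ₜ[ℂ] c)) =
          sgn gr a ⊗ₜ (ι gr (q b) * c) := by simp [G, μ]
      have hp : ∀ y, parity gr (q y) = -q (sgn gr y) := by intro y; rw [hq, neg_neg]
      rw [hG, koszul_tmul]
      simp only [map_smul, map_add, map_sub, TensorProduct.comm_tmul, TensorProduct.add_tmul,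
        TensorProduct.sub_tmul, ← TensorProduct.smul_tmul', TensorProduct.assoc_tmul, hF]
      simp only [evenPart, oddPart, LinearMap.smul_apply, LinearMap.add_apply,
        LinearMap.sub_apply, LinearMap.id_apply, hp, sgn_sgn, map_smul, map_add, map_sub, map_neg,
        smul_mul_assoc, add_mul, sub_mul, neg_mul, TensorProduct.tmul_smul, TensorProduct.tmul_add,
        TensorProduct.tmul_sub, TensorProduct.tmul_neg]
      module
  have e5 : ∀ t, F2 (TensorProduct.assoc ℂ _ _ _ (LinearMap.rTensor (Sym gr) (comul gr) t)) =
      G (TensorProduct.assoc ℂ _ _ _ (LinearMap.rTensor (Sym gr) (comul gr) t)) := by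
    intro t
    induction t with
    | zero => simp
    | add a b ha hb => simp only [map_add, ha, hb]
    | tmul a b =>
      simp only [LinearMap.rTensor_tmul]
      rw [← e4, cocomm]
  have e6 : coder gr q x = μ (comul gr x) := rfl
  rw [e6, e1, LinearMap.add_apply, ← coassoc, e2, e5, coassoc, e3]

theorem conv_add (θ η ζ : Sym gr →ₗ[ℂ] ℂ) : conv gr θ (η + ζ) = conv gr θ η + conv gr θ ζ := by
  simp only [conv, TensorProduct.map_add_right, LinearMap.add_comp, LinearMap.comp_add]

theorem conv_smul (c : ℂ) (θ η : Sym gr →ₗ[ℂ] ℂ) : conv gr θ (c • η) = c • conv gr θ η := by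
  simp only [conv, TensorProduct.map_smul_right, LinearMap.smul_comp, LinearMap.comp_smul]

theorem conv_sub (θ η ζ : Sym gr →ₗ[ℂ] ℂ) : conv gr (θ - η) ζ = conv gr θ ζ - conv gr η ζ := by
  rw [eq_sub_iff_add_eq]
  simp only [conv, ← LinearMap.comp_add, ← LinearMap.add_comp, ← TensorProduct.map_add_left,
    sub_add_cancel]

/-! Degrees -/

theorem comul_monomial {k n x} (hx : IsMonomial gr k n x) :
    comul gr x ∈ Submodule.span ℂ {t | ∃ k₁ k₂ n₁ n₂ a b, IsMonomial gr k₁ n₁ a ∧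
      IsMonomial gr k₂ n₂ b ∧ k₁ + k₂ = k ∧ n₁ + n₂ = n ∧ t = a ⊗ₜ[ℂ] b} := by
  induction hx with
  | one =>
    rw [comul_one]
    exact Submodule.subset_span ⟨0, 0, 0, 0, 1, 1, .one, .one, rfl, rfl, rfl⟩
  | @cons k p n v x hv hx ih =>
    rw [comul_ι_mul]
    generalize comul gr x = t at ih
    induction ih using Submodule.span_induction with
    | zero => simp
    | add a b _ _ ha hb => rw [map_add]; exact add_mem ha hb
    | smul c a _ ha => rw [map_smul]; exact Submodule.smul_mem _ _ ha
    | mem t ht =>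
      obtain ⟨k₁, k₂, n₁, n₂, a, b, ha, hb, hk, hn, rfl⟩ := ht
      rw [mulPrim_tmul, evenPart_of_mem gr hv, oddPart_of_mem gr hv, sgn_monomial gr ha]
      simp only [map_smul, smul_mul_assoc, TensorProduct.tmul_smul, ← TensorProduct.smul_tmul']
      refine add_mem (add_mem ?_ (Submodule.smul_mem _ _ ?_))
        (Submodule.smul_mem _ _ (Submodule.smul_mem _ _ ?_)) <;> refine Submodule.subset_span ?_
      · exact ⟨k₁ + 1, k₂, p + n₁, n₂, _, _, .cons hv ha, hb, by omega, by omega, rfl⟩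
      · exact ⟨k₁, k₂ + 1, n₁, p + n₂, _, _, ha, .cons hv hb, by omega, by omega, rfl⟩
      · exact ⟨k₁, k₂ + 1, n₁, p + n₂, _, _, ha, .cons hv hb, by omega, by omega, rfl⟩

/-- The map `V → (Sym V)[T, T⁻¹]`, `v ↦ v T^p` for `v` of degree `p`. -/
def degreeMap : V →ₗ[ℂ] AddMonoidAlgebra (Sym gr) ℤ :=
  (DirectSum.toModule ℂ ℤ _ fun p =>
    AddMonoidAlgebra.lsingle p ∘ₗ ι gr ∘ₗ (gr p).subtype) ∘ₗ
      (DirectSum.decomposeLinearEquiv gr).toLinearMap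

theorem degreeMap_of_mem {p : ℤ} {v : V} (hv : v ∈ gr p) :
    degreeMap gr v = AddMonoidAlgebra.single p (ι gr v) := by
  simp only [degreeMap, LinearMap.comp_apply, LinearEquiv.coe_coe,
    DirectSum.decomposeLinearEquiv_apply, DirectSum.decompose_of_mem gr hv]
  erw [DirectSum.toModule_lof]
  rfl

/-- The projection of `Sym V` onto its degree `n` part. -/
def degProj (n : ℤ) : Sym gr →ₗ[ℂ] Sym gr :=
  Finsupp.lapply n ∘ₗ (AddMonoidAlgebra.coeffLinearEquiv (M := ℤ) (S := Sym gr) ℂ).toLinearMap ∘ₗ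
    (lift gr (A := AddMonoidAlgebra (Sym gr) ℤ) (degreeMap gr) (by
      intro p q v w hv hw
      simp only [degreeMap_of_mem gr hv, degreeMap_of_mem gr hw,
        AddMonoidAlgebra.single_mul_single, ι_comm gr hv hw, AddMonoidAlgebra.smul_single,
        add_comm])).toLinearMap

theorem degProj_monomial {k m x} (hx : IsMonomial gr k m x) (n : ℤ) :
    degProj gr n x = if m = n then x else 0 := by
  have key : lift gr (A := AddMonoidAlgebra (Sym gr) ℤ) (degreeMap gr) (by
      intro p q v w hv hw
      simp only [degreeMap_of_mem gr hv, degreeMap_of_mem gr hw,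
        AddMonoidAlgebra.single_mul_single, ι_comm gr hv hw, AddMonoidAlgebra.smul_single,
        add_comm]) x = AddMonoidAlgebra.single m x := by
    induction hx with
    | one => rw [map_one]; rfl
    | cons hv _ ih =>
      rw [map_mul, ih, lift_ι, degreeMap_of_mem gr hv, AddMonoidAlgebra.single_mul_single]
  simp only [degProj, LinearMap.comp_apply, AlgHom.toLinearMap_apply, key]
  exact Finsupp.single_apply

theorem degProj_of_mem {m : ℤ} {x : Sym gr} (hx : x ∈ deg gr m) (n : ℤ) :
    degProj gr n x = if m = n then x else 0 := by
  induction hx using Submodule.span_induction with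
  | mem x hx => obtain ⟨k, hx⟩ := hx; exact degProj_monomial gr hx n
  | zero => simp
  | add a b _ _ ha hb => rw [map_add, ha, hb]; split_ifs <;> simp
  | smul c a _ ha => rw [map_smul, ha]; split_ifs <;> simp

theorem degProj_mem (n : ℤ) (x : Sym gr) : degProj gr n x ∈ deg gr n := by
  have hx := mem_span_monomial gr x
  induction hx using Submodule.span_induction with
  | mem x hx =>
    obtain ⟨k, m, hx⟩ := hx
    rw [degProj_monomial gr hx]
    split_ifs with h
    · subst h; exact Submodule.subset_span ⟨k, hx⟩
    · exact zero_mem _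
  | zero => simp
  | add a b _ _ ha hb => rw [map_add]; exact add_mem ha hb
  | smul c a _ ha => rw [map_smul]; exact Submodule.smul_mem _ _ ha

theorem coder_one {q : Sym gr →ₗ[ℂ] V} (hq : q 1 = 0) : coder gr q 1 = 0 := by
  simp [coder, comul_one, hq]

theorem coder_mem {q : Sym gr →ₗ[ℂ] V} (hq : ∀ n, ∀ x ∈ deg gr n, q x ∈ gr (n + 1))
    {n : ℤ} {x : Sym gr} (hx : x ∈ deg gr n) : coder gr q x ∈ redDeg gr (n + 1) := by
  induction hx using Submodule.span_induction with
  | mem x hx =>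
    obtain ⟨k, hx⟩ := hx
    have h := comul_monomial gr hx
    simp only [coder, LinearMap.comp_apply]
    generalize comul gr x = t at h
    induction h using Submodule.span_induction with
    | mem t ht =>
      obtain ⟨k₁, k₂, n₁, n₂, a, b, ha, hb, -, rfl, rfl⟩ := ht
      have := IsMonomial.cons (hq n₁ a (Submodule.subset_span ⟨_, ha⟩)) hb
      rw [show n₁ + n₂ + 1 = n₁ + 1 + n₂ by ring]
      exact Submodule.subset_span ⟨_, Nat.succ_pos _, by simpa using this⟩
    | zero => simp
    | add a b _ _ ha hb => rw [map_add]; exact add_mem ha hb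
    | smul c a _ ha => rw [map_smul]; exact Submodule.smul_mem _ _ ha
  | zero => simp
  | add a b _ _ ha hb => rw [map_add]; exact add_mem ha hb
  | smul c a _ ha => rw [map_smul]; exact Submodule.smul_mem _ _ ha

theorem odd_of_degree {q : Sym gr →ₗ[ℂ] V} (hq : ∀ n, ∀ x ∈ deg gr n, q x ∈ gr (n + 1))
    (x : Sym gr) : q (sgn gr x) = -parity gr (q x) := by
  have : q ∘ₗ (sgn gr).toLinearMap = -(parity gr ∘ₗ q) := by
    refine ext_monomial gr fun k n x hx => ?_
    simp only [LinearMap.comp_apply, AlgHom.toLinearMap_apply, LinearMap.neg_apply,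
      sgn_monomial gr hx, map_smul, parity_of_mem gr (hq n x (Submodule.subset_span ⟨k, hx⟩)),
      zpow_add_one₀ (show (-1 : ℂ) ≠ 0 by norm_num)]
    module
  exact LinearMap.congr_fun this x

end Basic

/-- The `n`-th cohomology of a graded vector space with a differential `d` of degree `1`:
the cocycles of degree `n` modulo the coboundaries `d(M^{n-1})`. -/
abbrev Cohomology {M : Type*} [AddCommGroup M] [Module ℂ M] (gr : ℤ → Submodule ℂ M)
    (d : M →ₗ[ℂ] M) (n : ℤ) : Type _ :=
  ↥(LinearMap.ker d ⊓ gr n) ⧸ ((gr (n - 1)).map d).submoduleOf (LinearMap.ker d ⊓ gr n)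

theorem exists_extension {M : Type*} [AddCommGroup M] [Module ℂ M] (gr : ℤ → Submodule ℂ M)
    (d : M →ₗ[ℂ] M) (n : ℤ) (N : Submodule ℂ M) (hBN : ∀ x ∈ gr (n - 1), d x ∈ N)
    (h : ∀ z, d z = 0 → z ∈ gr n → z ∈ N → ∃ x ∈ gr (n - 1), d x = z) :
    ∃ π : M →ₗ[ℂ] Cohomology gr d n, (∀ x ∈ N, π x = 0) ∧
      ∀ z : ↥(LinearMap.ker d ⊓ gr n), π z = Submodule.Quotient.mk z := by
  unfold Cohomology
  generalize hZ : LinearMap.ker d ⊓ gr n = Z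
  have hZ' : ∀ z ∈ Z, d z = 0 ∧ z ∈ gr n := by
    rw [← hZ]; exact fun z hz => ⟨hz.1, hz.2⟩
  have hker : ((gr (n - 1)).map d).submoduleOf Z = LinearMap.ker (N.mkQ ∘ₗ Z.subtype) := by
    ext z
    rw [LinearMap.mem_ker, LinearMap.comp_apply, Submodule.mkQ_apply,
      Submodule.Quotient.mk_eq_zero, Submodule.subtype_apply]
    exact ⟨fun ⟨x, hx, hxz⟩ => by rw [← show d x = z from hxz]; exact hBN x hx,
      fun hz => h z (hZ' z z.2).1 (hZ' z z.2).2 hz⟩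
  generalize ((gr (n - 1)).map d).submoduleOf Z = C at hker
  subst hker
  obtain ⟨r, hr⟩ := LinearMap.exists_leftInverse_of_injective
    ((LinearMap.ker (N.mkQ ∘ₗ Z.subtype)).liftQ (N.mkQ ∘ₗ Z.subtype) le_rfl)
    (Submodule.ker_liftQ_eq_bot _ _ _ le_rfl)
  refine ⟨r ∘ₗ N.mkQ, fun x hx => ?_, fun z => ?_⟩
  · rw [LinearMap.comp_apply, Submodule.mkQ_apply, (Submodule.Quotient.mk_eq_zero N).2 hx, map_zero]
  · exact LinearMap.congr_fun hr (Submodule.Quotient.mk z)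

section Cocycles

variable {V : Type*} [AddCommGroup V] [Module ℂ V] (gr : ℤ → Submodule ℂ V)
  [DirectSum.Decomposition gr] (q : Sym gr →ₗ[ℂ] V)

/-- Functionals on the degree `0` part of the reduced coalgebra, extended by zero, which vanish on
coboundaries. -/
structure IsCocycle (θ : Sym gr →ₗ[ℂ] ℂ) : Prop where
  one : θ 1 = 0
  degree : ∀ n ≠ 0, ∀ x ∈ deg gr n, θ x = 0
  closed : ∀ x, θ (coder gr q x) = 0

variable {gr q}

theorem IsCocycle.sub {θ η : Sym gr →ₗ[ℂ] ℂ} (hθ : IsCocycle gr q θ) (hη : IsCocycle gr q η) :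
    IsCocycle gr q (θ - η) where
  one := by simp [hθ.one, hη.one]
  degree n hn x hx := by simp [hθ.degree n hn x hx, hη.degree n hn x hx]
  closed x := by simp [hθ.closed, hη.closed]

theorem IsCocycle.sgn {θ : Sym gr →ₗ[ℂ] ℂ} (hθ : IsCocycle gr q θ) (x : Sym gr) :
    θ (sgn gr x) = θ x := by
  have : θ ∘ₗ (KoszulSym.sgn gr).toLinearMap = θ := by
    refine ext_monomial gr fun k n x hx => ?_
    simp only [LinearMap.comp_apply, AlgHom.toLinearMap_apply, sgn_monomial gr hx, map_smul]
    by_cases hn : n = 0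
    · simp [hn]
    · simp [hθ.degree n hn x (Submodule.subset_span ⟨k, hx⟩)]
  exact LinearMap.congr_fun this x

theorem IsCocycle.conv_comm {θ η : Sym gr →ₗ[ℂ] ℂ} (hθ : IsCocycle gr q θ)
    (hη : IsCocycle gr q η) : conv gr θ η = conv gr η θ := by
  have key : ∀ t, LinearMap.mul' ℂ ℂ (TensorProduct.map θ η
      (TensorProduct.comm ℂ (Sym gr) (Sym gr) (koszul gr t))) =
      LinearMap.mul' ℂ ℂ (TensorProduct.map η θ t) := by
    intro t
    induction t with
    | zero => simp
    | add a b ha hb => simp only [map_add, ha, hb]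
    | tmul a b => simp [koszul_tmul, hθ.sgn, hη.sgn]; ring
  ext x
  have := key (comul gr x)
  rw [cocomm] at this
  exact this

theorem IsCocycle.conv (hq : ∀ n, ∀ x ∈ deg gr n, q x ∈ gr (n + 1)) {θ η : Sym gr →ₗ[ℂ] ℂ}
    (hθ : IsCocycle gr q θ) (hη : IsCocycle gr q η) : IsCocycle gr q (conv gr θ η) where
  one := by simp [KoszulSym.conv, comul_one, hθ.one]
  degree n hn x hx := by
    induction hx using Submodule.span_induction with
    | mem x hx =>
      obtain ⟨k, hx⟩ := hx
      have h := comul_monomial gr hx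
      simp only [KoszulSym.conv, LinearMap.comp_apply]
      generalize comul gr x = t at h
      induction h using Submodule.span_induction with
      | mem t ht =>
        obtain ⟨k₁, k₂, n₁, n₂, a, b, ha, hb, -, rfl, rfl⟩ := ht
        by_cases h1 : n₁ = 0
        · have h2 : n₂ ≠ 0 := by omega
          simp [hη.degree n₂ h2 b (Submodule.subset_span ⟨_, hb⟩)]
        · simp [hθ.degree n₁ h1 a (Submodule.subset_span ⟨_, ha⟩)]
      | zero => simp
      | add a b _ _ ha hb => simp only [map_add, ha, hb, add_zero]
      | smul c a _ ha => simp only [map_smul, ha, smul_zero]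
    | zero => simp
    | add a b _ _ ha hb => simp only [map_add, ha, hb, add_zero]
    | smul c a _ ha => simp only [map_smul, ha, smul_zero]
  closed x := by
    simp only [KoszulSym.conv, LinearMap.comp_apply, comul_coder gr (odd_of_degree gr hq)]
    generalize comul gr x = t
    induction t with
    | zero => simp
    | add a b ha hb =>
      simp only [map_add] at ha hb ⊢
      linear_combination ha + hb
    | tmul a b => simp [hθ.closed, hη.closed]

theorem IsCocycle.eq_comp_coder (hq : ∀ n, ∀ x ∈ deg gr n, q x ∈ gr (n + 1)) (hq1 : q 1 = 0)
    {θ : Sym gr →ₗ[ℂ] ℂ} (hθ : IsCocycle gr q θ)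
    (h0 : ∀ z ∈ LinearMap.ker (coder gr q) ⊓ redDeg gr 0, θ z = 0) :
    ∃ f : Sym gr →ₗ[ℂ] ℂ, θ = f ∘ₗ coder gr q := by
  have h1 : θ = θ ∘ₗ degProj gr 0 := by
    refine ext_monomial gr fun k n x hx => ?_
    rw [LinearMap.comp_apply, degProj_monomial gr hx]
    split_ifs with h
    · rfl
    · rw [map_zero]; exact hθ.degree n h x (Submodule.subset_span ⟨k, hx⟩)
  have h2 : coder gr q ∘ₗ degProj gr 0 = degProj gr 1 ∘ₗ coder gr q := by
    refine ext_monomial gr fun k n x hx => ?_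
    have hm := redDeg_le_deg gr _ (coder_mem gr hq (Submodule.subset_span ⟨k, hx⟩ : x ∈ deg gr n))
    rw [LinearMap.comp_apply, LinearMap.comp_apply, degProj_monomial gr hx, degProj_of_mem gr hm]
    by_cases h : n = 0
    · simp [h]
    · simp [h]
  have h3 : LinearMap.ker (coder gr q) ≤ LinearMap.ker θ := by
    intro x hx
    rw [LinearMap.mem_ker] at hx ⊢
    have hk : coder gr q (degProj gr 0 x) = 0 := by
      have := LinearMap.congr_fun h2 x
      simpa [hx] using this
    have hz := h0 (degProj gr 0 x - counit gr (degProj gr 0 x) • 1)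
      ⟨by simp [hk, coder_one gr hq1], sub_counit_mem gr (degProj_mem gr 0 x)⟩
    rw [map_sub, map_smul, hθ.one, smul_zero, sub_zero] at hz
    rw [h1]; exact hz
  have h4 : θ ∈ LinearMap.range (coder gr q).dualMap := by
    rw [LinearMap.range_dualMap_eq_dualAnnihilator_ker, Submodule.mem_dualAnnihilator]
    exact fun w hw => h3 hw
  obtain ⟨f, hf⟩ := h4
  exact ⟨f, hf.symm⟩

theorem IsCocycle.conv_eq_zero (hq : ∀ n, ∀ x ∈ deg gr n, q x ∈ gr (n + 1)) (hq1 : q 1 = 0)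
    {θ η : Sym gr →ₗ[ℂ] ℂ} (hθ : IsCocycle gr q θ) (hη : IsCocycle gr q η)
    (h0 : ∀ z ∈ LinearMap.ker (coder gr q) ⊓ redDeg gr 0, θ z = 0)
    {z : Sym gr} (hz : coder gr q z = 0) : KoszulSym.conv gr θ η z = 0 := by
  obtain ⟨f, rfl⟩ := hθ.eq_comp_coder hq hq1 h0
  have h := comul_coder gr (odd_of_degree gr hq) z
  rw [hz, map_zero] at h
  have key : ∀ t, LinearMap.mul' ℂ ℂ (TensorProduct.map (f ∘ₗ coder gr q) η t) =
      LinearMap.mul' ℂ ℂ (TensorProduct.map f η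
        (LinearMap.rTensor (Sym gr) (coder gr q) t +
      TensorProduct.map (KoszulSym.sgn gr).toLinearMap (coder gr q) t)) := by
    intro t
    induction t with
    | zero => simp
    | add a b ha hb => simp only [map_add] at ha hb ⊢; linear_combination ha + hb
    | tmul a b => simp [hη.closed]
  simp only [KoszulSym.conv, LinearMap.comp_apply]
  rw [key, ← h]
  simp

theorem conv_assoc (θ η ζ : Sym gr →ₗ[ℂ] ℂ) :
    conv gr (conv gr θ η) ζ = conv gr θ (conv gr η ζ) := by
  have k1 : ∀ t, LinearMap.mul' ℂ ℂ (TensorProduct.map (conv gr θ η) ζ t) =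
      LinearMap.mul' ℂ ℂ (TensorProduct.map θ (LinearMap.mul' ℂ ℂ ∘ₗ TensorProduct.map η ζ)
        (TensorProduct.assoc ℂ _ _ _ (LinearMap.rTensor (Sym gr) (comul gr) t))) := by
    intro t
    induction t with
    | zero => simp
    | add a b ha hb => simp only [map_add, ha, hb]
    | tmul a b =>
      simp only [LinearMap.rTensor_tmul, TensorProduct.map_tmul, conv, LinearMap.comp_apply]
      generalize comul gr a = s
      induction s with
      | zero => simp
      | add c d hc hd =>
        simp only [map_add, TensorProduct.add_tmul, ← hc, ← hd, LinearMap.mul'_apply]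
      | tmul c d => simp [mul_assoc]
  have k2 : ∀ t, LinearMap.mul' ℂ ℂ (TensorProduct.map θ (conv gr η ζ) t) =
      LinearMap.mul' ℂ ℂ (TensorProduct.map θ (LinearMap.mul' ℂ ℂ ∘ₗ TensorProduct.map η ζ)
        (LinearMap.lTensor (Sym gr) (comul gr) t)) := by
    intro t
    induction t with
    | zero => simp
    | add a b ha hb => simp only [map_add, ha, hb]
    | tmul a b => simp [conv]
  ext x
  have h1 := k1 (comul gr x)
  rw [coassoc, ← k2] at h1
  exact h1

variable (gr q)

/-- The span of the coboundaries of degree `0`, of `1`, and of the elements of non-zero degree. -/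
def nullPart : Submodule ℂ (Sym gr) :=
  Submodule.map (coder gr q) (redDeg gr (0 - 1)) ⊔ Submodule.span ℂ {(1 : Sym gr)} ⊔
    ⨆ n : {n : ℤ // n ≠ 0}, deg gr n

/-- There is a linear map from `Sym V` to the degree `0` cohomology of the reduced coalgebra which
kills `1`, the components of non-zero degree and all coboundaries, and sends a cocycle to its
class. -/
theorem exists_classMap (hq : ∀ n, ∀ x ∈ deg gr n, q x ∈ gr (n + 1)) :
    ∃ π : Sym gr →ₗ[ℂ] Cohomology (redDeg gr) (coder gr q) 0,
      π 1 = 0 ∧ (∀ n ≠ 0, ∀ x ∈ deg gr n, π x = 0) ∧ (∀ x, π (coder gr q x) = 0) ∧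
      ∀ z : ↥(LinearMap.ker (coder gr q) ⊓ redDeg gr 0), π z = Submodule.Quotient.mk z := by
  have hBr : ∀ x ∈ redDeg gr (0 - 1), coder gr q x ∈ redDeg gr 0 := by
    intro x hx
    have := coder_mem gr hq (redDeg_le_deg gr _ hx)
    rwa [sub_add_cancel] at this
  have hN : ∀ z, coder gr q z = 0 → z ∈ redDeg gr 0 → z ∈ nullPart gr q →
      ∃ x ∈ redDeg gr (0 - 1), coder gr q x = z := by
    intro z hz0 hz hzN
    obtain ⟨y, hy, s, hs, hys⟩ := Submodule.mem_sup.1 hzN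
    obtain ⟨b, ⟨x, hx, rfl⟩, c, hc, rfl⟩ := Submodule.mem_sup.1 hy
    obtain ⟨c, rfl⟩ := Submodule.mem_span_singleton.1 hc
    have hs0 : degProj gr 0 s = 0 := by
      have : (⨆ n : {n : ℤ // n ≠ 0}, deg gr n) ≤ LinearMap.ker (degProj gr 0) := by
        refine iSup_le fun n x hx => ?_
        rw [LinearMap.mem_ker, degProj_of_mem gr hx, if_neg n.2]
      exact this hs
    have h0 := congrArg (degProj gr 0) hys
    rw [map_add, map_add, map_smul, hs0, add_zero,
      degProj_of_mem gr (redDeg_le_deg gr 0 (hBr x hx)), if_pos rfl,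
      degProj_monomial gr .one, if_pos rfl,
      degProj_of_mem gr (redDeg_le_deg gr 0 hz), if_pos rfl] at h0
    have h1 := congrArg (counit gr) h0
    rw [map_add, counit_of_mem_redDeg gr (hBr x hx), counit_of_mem_redDeg gr hz, map_smul,
      map_one, zero_add, smul_eq_mul, mul_one] at h1
    rw [h1, zero_smul, add_zero] at h0
    exact ⟨x, hx, h0⟩
  obtain ⟨π, hπN, hπZ⟩ := exists_extension (redDeg gr) (coder gr q) 0 (nullPart gr q)
    (fun x hx => Submodule.mem_sup_left (Submodule.mem_sup_left ⟨x, hx, rfl⟩)) hN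
  have hd : ∀ n ≠ 0, ∀ x ∈ deg gr n, π x = 0 := fun n hn x hx =>
    hπN x (Submodule.mem_sup_right (Submodule.mem_iSup_of_mem ⟨n, hn⟩ hx))
  refine ⟨π, ?_, hd, ?_, hπZ⟩
  · exact hπN _ (Submodule.mem_sup_left (Submodule.mem_sup_right
      (Submodule.mem_span_singleton_self _)))
  · have : π ∘ₗ coder gr q = 0 := by
      refine ext_monomial gr fun k n x hx => ?_
      have hx' : x ∈ deg gr n := Submodule.subset_span ⟨k, hx⟩
      rw [LinearMap.comp_apply, LinearMap.zero_apply]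
      by_cases hn : n = -1
      · subst hn
        refine hπN _ (Submodule.mem_sup_left (Submodule.mem_sup_left ⟨x, ?_, rfl⟩))
        simpa [redDeg_of_ne] using hx'
      · exact hd (n + 1) (by omega) _ (redDeg_le_deg gr _ (coder_mem gr hq hx'))
    exact fun x => LinearMap.congr_fun this x

end Cocycles
end KoszulSym

/-- A differential graded Lie algebra over `ℂ`, with underlying vector space `L`, grading
`L = ⨁ₙ gr n`, differential `d` of degree `1` and graded Lie bracket. -/
structure DGLieAlgebra (L : Type*) [AddCommGroup L] [Module ℂ L] where
  gr : ℤ → Submodule ℂ L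
  isInternal : DirectSum.IsInternal gr
  d : L →ₗ[ℂ] L
  bracket : L →ₗ[ℂ] L →ₗ[ℂ] L
  d_mem : ∀ n, ∀ x ∈ gr n, d x ∈ gr (n + 1)
  d_d : ∀ x, d (d x) = 0
  bracket_mem : ∀ m n, ∀ x ∈ gr m, ∀ y ∈ gr n, bracket x y ∈ gr (m + n)
  bracket_skew : ∀ m n, ∀ x ∈ gr m, ∀ y ∈ gr n,
    bracket x y = -((-1 : ℂ) ^ (m * n) • bracket y x)
  jacobi : ∀ m n, ∀ x ∈ gr m, ∀ y ∈ gr n, ∀ z,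
    bracket x (bracket y z) = bracket (bracket x y) z + (-1 : ℂ) ^ (m * n) • bracket y (bracket x z)
  leibniz : ∀ m, ∀ x ∈ gr m, ∀ y,
    d (bracket x y) = bracket (d x) y + (-1 : ℂ) ^ m • bracket x (d y)

/-- A differential graded Lie pair `𝔤 → 𝔥`: a homomorphism of differential graded Lie algebras. -/
structure DGLiePair (G H : Type*) [AddCommGroup G] [Module ℂ G] [AddCommGroup H]
    [Module ℂ H] where
  source : DGLieAlgebra G
  target : DGLieAlgebra H
  i : G →ₗ[ℂ] H
  i_mem : ∀ n, ∀ x ∈ source.gr n, i x ∈ target.gr n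
  i_d : ∀ x, i (source.d x) = target.d (i x)
  i_bracket : ∀ x y, i (source.bracket x y) = target.bracket (i x) (i y)

instance DGLieAlgebra.decomposition {L : Type*} [AddCommGroup L] [Module ℂ L]
    (A : DGLieAlgebra L) : DirectSum.Decomposition A.gr := A.isInternal.chooseDecomposition

namespace DGLiePair

open KoszulSym

variable {G H : Type*} [AddCommGroup G] [Module ℂ G] [AddCommGroup H] [Module ℂ H]
  (P : DGLiePair G H)

/-! The pair as a complex `𝔤 → 𝔥` with `𝔤`, `𝔥` placed in degrees `0`, `1`. -/

/-- The degree `n` part `𝔤ⁿ ⊕ 𝔥ⁿ⁻¹` of the total complex of `𝔤 → 𝔥`. -/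
def atomGr (n : ℤ) : Submodule ℂ (G × H) := (P.source.gr n).prod (P.target.gr (n - 1))

/-- The differential `(a, b) ↦ (d a, i(a) - d b)` of the total complex of `𝔤 → 𝔥`. -/
def atomD : G × H →ₗ[ℂ] G × H :=
  (P.source.d ∘ₗ LinearMap.fst ℂ G H).prod
    (P.i ∘ₗ LinearMap.fst ℂ G H - P.target.d ∘ₗ LinearMap.snd ℂ G H)

/-- The cohomology `ℍⁿ(𝔤^♯)` of the pair. -/
abbrev AtomCohomology (n : ℤ) : Type _ := Cohomology P.atomGr P.atomD n

/-! The Jacobi-Bernoulli complex. -/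

/-- The grading of `V = 𝔤[1] ⊕ 𝔥`: the degree `p` part is `𝔤^{p+1} ⊕ 𝔥^p`. -/
def shiftGr (p : ℤ) : Submodule ℂ (G × H) := (P.source.gr (p + 1)).prod (P.target.gr p)

theorem isInternal_shiftGr : DirectSum.IsInternal P.shiftGr := by
  let π : ℤ → G × H →ₗ[ℂ] G × H := fun r =>
    LinearMap.prodMap
      ((P.source.gr (r + 1)).subtype ∘ₗ DirectSum.component ℂ ℤ _ (r + 1) ∘ₗ
        (DirectSum.decomposeLinearEquiv P.source.gr).toLinearMap)
      ((P.target.gr r).subtype ∘ₗ DirectSum.component ℂ ℤ _ r ∘ₗ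
        (DirectSum.decomposeLinearEquiv P.target.gr).toLinearMap)
  have hπ : ∀ r (z : G × H), π r z = ((DirectSum.decompose P.source.gr z.1 (r + 1) : G),
      (DirectSum.decompose P.target.gr z.2 r : H)) := fun r z => rfl
  have hsame : ∀ r (z : P.shiftGr r), π r z = z := by
    rintro r ⟨⟨a, b⟩, ha, hb⟩
    rw [hπ]
    exact Prod.ext (DirectSum.decompose_of_mem_same _ ha) (DirectSum.decompose_of_mem_same _ hb)
  have hne : ∀ r s (z : P.shiftGr s), s ≠ r → π r z = 0 := by
    rintro r s ⟨⟨a, b⟩, ha, hb⟩ h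
    rw [hπ]
    exact Prod.ext (DirectSum.decompose_of_mem_ne _ ha (by omega))
      (DirectSum.decompose_of_mem_ne _ hb h)
  have hcoe : ∀ r (x : DirectSum ℤ fun p => P.shiftGr p),
      π r (DirectSum.coeAddMonoidHom P.shiftGr x) = x r := by
    intro r x
    induction x using DirectSum.induction_on with
    | zero => simp
    | of s z =>
      rw [DirectSum.coeAddMonoidHom_of]
      by_cases h : s = r
      · subst h; rw [hsame, DirectSum.of_eq_same]
      · rw [hne r s z h, DirectSum.of_eq_of_ne _ _ _ (Ne.symm h)]; rfl
    | add x y hx hy => rw [map_add, map_add, hx, hy]; rfl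
  constructor
  · refine (injective_iff_map_eq_zero _).2 fun x hx => ?_
    ext1 r
    have := hcoe r x
    rw [hx, map_zero] at this
    exact Subtype.ext this.symm
  · rintro ⟨a, b⟩
    have h1 : ∀ a : G, (a, (0 : H)) ∈ LinearMap.range (DirectSum.coeLinearMap P.shiftGr) := by
      intro a
      induction a using DirectSum.Decomposition.inductionOn P.source.gr with
      | zero => exact zero_mem _
      | @homogeneous n a =>
        refine ⟨DirectSum.of (fun p => P.shiftGr p) (n - 1) ⟨(a, 0), ?_, zero_mem _⟩, ?_⟩
        · rw [sub_add_cancel]; exact a.2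
        · exact DirectSum.coeLinearMap_lof P.shiftGr _ _
      | add a a' ha ha' => simpa using add_mem ha ha'
    have h2 : ∀ b : H, ((0 : G), b) ∈ LinearMap.range (DirectSum.coeLinearMap P.shiftGr) := by
      intro b
      induction b using DirectSum.Decomposition.inductionOn P.target.gr with
      | zero => exact zero_mem _
      | @homogeneous n b =>
        refine ⟨DirectSum.of (fun p => P.shiftGr p) n ⟨(0, b), zero_mem _, b.2⟩, ?_⟩
        exact DirectSum.coeLinearMap_lof P.shiftGr _ _
      | add a a' ha ha' => simpa using add_mem ha ha'
    have h3 := add_mem (h1 a) (h2 b)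
    rw [Prod.mk_add_mk, add_zero, zero_add] at h3
    exact h3

instance decomposition : DirectSum.Decomposition P.shiftGr :=
  P.isInternal_shiftGr.chooseDecomposition

/-- The coalgebra `Sym(𝔤[1] ⊕ 𝔥) = Λ𝔤 ⊗ Sym 𝔥`; the element `(a, b)` of `𝔤 × 𝔥` stands for the sum of
`a ∈ Λ^1 𝔤` and `b ∈ Sym^1 𝔥`. -/
abbrev JSym : Type _ := Sym P.shiftGr

/-- The component of `Λ^1 𝔤 ⊗ Sym^0 𝔥 = 𝔤`. -/
def projG : P.JSym →ₗ[ℂ] G := LinearMap.fst ℂ G H ∘ₗ proj P.shiftGr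

/-- The component of `Λ^0 𝔤 ⊗ Sym^1 𝔥 = 𝔥`. -/
def projH : P.JSym →ₗ[ℂ] H := LinearMap.snd ℂ G H ∘ₗ proj P.shiftGr

/-- The internal differential on `𝔤[1] ⊕ 𝔥`. -/
def linearPart : G × H →ₗ[ℂ] G × H := (-P.source.d).prodMap P.target.d

/-- The map `Λ²𝔤 → 𝔤`, `a₁ ∧ a₂ ↦ (-1)^{|a₁| + 1} [a₁, a₂]` (zero on the other components).
The sign is the one for which, with `B₁ = -1/2`, the Jacobi-Bernoulli differential squares to `0`. -/
def bracketPart : P.JSym →ₗ[ℂ] G :=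
  (1 / 2 : ℂ) • TensorProduct.lift (-(P.source.bracket ∘ₗ parity P.source.gr)) ∘ₗ
    TensorProduct.map P.projG P.projG ∘ₗ comul P.shiftGr

/-- The map `𝔤 ⊗ Sym^t 𝔥 → 𝔥`, `a ⊗ b₁⋯b_t ↦ ∑_σ ± [⋯[[i(a), b_{σ1}], b_{σ2}], ⋯, b_{σt}]`
(which is `i(a)_@ b^t` on the symmetric tensor `b^{⊗ t}`, i.e. on the divided power `b^t / t!`). -/
def iterBracket : ℕ → P.JSym →ₗ[ℂ] H
  | 0 => P.i ∘ₗ P.projG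
  | t + 1 => TensorProduct.lift P.target.bracket ∘ₗ
      TensorProduct.map (iterBracket t) P.projH ∘ₗ comul P.shiftGr

/-- The sum over `t` of the maps `c_t • iterBracket t : 𝔤 ⊗ Sym^t 𝔥 → 𝔥`, with the normalized
Bernoulli numbers `c_t = B_t / t!`. -/
def bernoulliPart : P.JSym →ₗ[ℂ] H :=
  Polynomial.lsum (fun k => match k with
    | 0 => 0
    | t + 1 => ((bernoulli t / t.factorial : ℚ) : ℂ) • P.iterBracket t) ∘ₗ
      (weight P.shiftGr).toLinearMap

/-- The corestriction `Sym(𝔤[1] ⊕ 𝔥) → 𝔤[1] ⊕ 𝔥` of the Jacobi-Bernoulli differential. -/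
def corestriction : P.JSym →ₗ[ℂ] G × H :=
  P.linearPart ∘ₗ proj P.shiftGr + LinearMap.inl ℂ G H ∘ₗ P.bracketPart +
    LinearMap.inr ℂ G H ∘ₗ P.bernoulliPart

/-- The Jacobi-Bernoulli differential: the coderivation with the given corestriction. In
particular on `𝔤 ⊗ Sym 𝔥`, in terms of divided powers, it is the sum of the internal
differential and of `a ⊗ b^m / m! ↦ ∑_t c_t (i(a)_@ b^t) · b^{m-t} / (m-t)!`. -/
def jacobiD : P.JSym →ₗ[ℂ] P.JSym := coder P.shiftGr P.corestriction

/-- The Jacobi-Bernoulli cohomology `ℍⁿ(J^♯(𝔤^♯))`, where `J^♯` is the reduced coalgebra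
`⨁_{k > 0} Sym^k(𝔤[1] ⊕ 𝔥)` with the Jacobi-Bernoulli differential. -/
abbrev JCohomology (n : ℤ) : Type _ := Cohomology (redDeg P.shiftGr) P.jacobiD n

theorem corestriction_one : P.corestriction 1 = 0 := by
  have h : ∀ t, P.iterBracket t 1 = 0 := by
    intro t
    cases t with
    | zero => simp [iterBracket, projG, proj_one]
    | succ t => simp [iterBracket, projH, proj_one, comul_one]
  have h1 : P.bernoulliPart 1 = 0 := by
    simp only [bernoulliPart, LinearMap.comp_apply, AlgHom.toLinearMap_apply,
      weight_monomial P.shiftGr .one, Polynomial.lsum_apply]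
    rw [Polynomial.sum_monomial_index] <;> simp
  simp [corestriction, proj_one, bracketPart, projG, comul_one, h1]

theorem projG_mem {k n x} (hx : IsMonomial P.shiftGr k n x) : P.projG x ∈ P.source.gr (n + 1) :=
  (proj_monomial P.shiftGr hx).1

theorem projH_mem {k n x} (hx : IsMonomial P.shiftGr k n x) : P.projH x ∈ P.target.gr n :=
  (proj_monomial P.shiftGr hx).2

theorem iterBracket_mem (t : ℕ) : ∀ {k n x}, IsMonomial P.shiftGr k n x →
    P.iterBracket t x ∈ P.target.gr (n + 1) := by
  induction t with
  | zero => exact fun hx => P.i_mem _ _ (P.projG_mem hx)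
  | succ t ih =>
    intro k n x hx
    have h := comul_monomial P.shiftGr hx
    simp only [iterBracket, LinearMap.comp_apply]
    generalize comul P.shiftGr x = s at h
    induction h using Submodule.span_induction with
    | mem s hs =>
      obtain ⟨k₁, k₂, n₁, n₂, a, b, ha, hb, -, rfl, rfl⟩ := hs
      have := P.target.bracket_mem _ _ _ (ih ha) _ (P.projH_mem hb)
      rw [show n₁ + n₂ + 1 = n₁ + 1 + n₂ by ring]
      simpa using this
    | zero => simp
    | add a b _ _ ha hb => simp only [map_add]; exact add_mem ha hb
    | smul c a _ ha => simp only [map_smul]; exact Submodule.smul_mem _ _ ha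

theorem bernoulliPart_mem {k n x} (hx : IsMonomial P.shiftGr k n x) :
    P.bernoulliPart x ∈ P.target.gr (n + 1) := by
  simp only [bernoulliPart, LinearMap.comp_apply, AlgHom.toLinearMap_apply,
    weight_monomial P.shiftGr hx, Polynomial.lsum_apply]
  rw [Polynomial.sum_monomial_index _ _ (by simp)]
  cases k with
  | zero => exact zero_mem _
  | succ t => exact Submodule.smul_mem _ _ (P.iterBracket_mem t hx)

theorem bracketPart_mem {k n x} (hx : IsMonomial P.shiftGr k n x) :
    P.bracketPart x ∈ P.source.gr (n + 1 + 1) := by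
  have h := comul_monomial P.shiftGr hx
  simp only [bracketPart, LinearMap.comp_apply, LinearMap.smul_apply]
  refine Submodule.smul_mem _ _ ?_
  generalize comul P.shiftGr x = s at h
  induction h using Submodule.span_induction with
  | mem s hs =>
    obtain ⟨k₁, k₂, n₁, n₂, a, b, ha, hb, -, rfl, rfl⟩ := hs
    have := P.source.bracket_mem _ _ _ (P.projG_mem ha) _ (P.projG_mem hb)
    rw [show n₁ + n₂ + 1 + 1 = n₁ + 1 + (n₂ + 1) by ring]
    simpa [parity_of_mem P.source.gr (P.projG_mem ha)] using Submodule.smul_mem _ _ this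
  | zero => simp
  | add a b _ _ ha hb => simp only [map_add]; exact add_mem ha hb
  | smul c a _ ha => simp only [map_smul]; exact Submodule.smul_mem _ _ ha

theorem corestriction_mem (n : ℤ) (x : P.JSym) (hx : x ∈ deg P.shiftGr n) :
    P.corestriction x ∈ P.shiftGr (n + 1) := by
  induction hx using Submodule.span_induction with
  | mem x hx =>
    obtain ⟨k, hx⟩ := hx
    refine add_mem (add_mem ⟨?_, ?_⟩ ⟨P.bracketPart_mem hx, zero_mem _⟩)
      ⟨zero_mem _, P.bernoulliPart_mem hx⟩
    · exact neg_mem (P.source.d_mem _ _ (P.projG_mem hx))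
    · exact P.target.d_mem _ _ (P.projH_mem hx)
  | zero => simp
  | add a b _ _ ha hb => rw [map_add]; exact add_mem ha hb
  | smul c a _ ha => rw [map_smul]; exact Submodule.smul_mem _ _ ha

/-- The projection of the Jacobi-Bernoulli complex to its cohomology in degree `0`: a linear map
which kills `1`, the components of non-zero degree and all coboundaries, and sends a cocycle to its
class. -/
def classMap : P.JSym →ₗ[ℂ] P.JCohomology 0 :=
  (exists_classMap P.shiftGr P.corestriction P.corestriction_mem).choose

theorem classMap_spec : P.classMap 1 = 0 ∧
    (∀ n ≠ 0, ∀ x ∈ deg P.shiftGr n, P.classMap x = 0) ∧ (∀ x, P.classMap (P.jacobiD x) = 0) ∧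
      ∀ z : ↥(LinearMap.ker P.jacobiD ⊓ redDeg P.shiftGr 0),
        P.classMap z = Submodule.Quotient.mk z :=
  (exists_classMap P.shiftGr P.corestriction P.corestriction_mem).choose_spec

/-- The dual space `ℍ⁰(J^♯(𝔤^♯))^*`. -/
def CohomologyDual : Type _ := Module.Dual ℂ (P.JCohomology 0)

instance : AddCommGroup P.CohomologyDual :=
  inferInstanceAs (AddCommGroup (Module.Dual ℂ (P.JCohomology 0)))

instance : Module ℂ P.CohomologyDual :=
  inferInstanceAs (Module ℂ (Module.Dual ℂ (P.JCohomology 0)))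

/-- The elements of `CohomologyDual` are the functionals on `ℍ⁰(J^♯)`. -/
def toDual : P.CohomologyDual ≃ₗ[ℂ] Module.Dual ℂ (P.JCohomology 0) :=
  LinearEquiv.refl ℂ (Module.Dual ℂ (P.JCohomology 0))

/-- A functional on `ℍ⁰(J^♯)`, as a functional on cochains. -/
def pull : P.CohomologyDual →ₗ[ℂ] (P.JSym →ₗ[ℂ] ℂ) :=
  LinearMap.lcomp ℂ ℂ P.classMap ∘ₗ P.toDual.toLinearMap

theorem pull_apply (φ : P.CohomologyDual) (x : P.JSym) :
    P.pull φ x = P.toDual φ (P.classMap x) := rfl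

variable {P} in
theorem isCocycle_pull (φ : P.CohomologyDual) : IsCocycle P.shiftGr P.corestriction (P.pull φ) where
  one := by rw [pull_apply, P.classMap_spec.1, map_zero]
  degree n hn x hx := by rw [pull_apply, P.classMap_spec.2.1 n hn x hx, map_zero]
  closed x := by rw [pull_apply, ← jacobiD, P.classMap_spec.2.2.1 x, map_zero]

/-- The functional on `ℍ⁰(J^♯)` induced by a cocycle. -/
def push (θ : P.JSym →ₗ[ℂ] ℂ) (hθ : IsCocycle P.shiftGr P.corestriction θ) : P.CohomologyDual :=
  P.toDual.symm <| Submodule.liftQ _ (θ ∘ₗ (LinearMap.ker P.jacobiD ⊓ redDeg P.shiftGr 0).subtype) (by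
    rintro z ⟨x, _, hx⟩
    rw [LinearMap.mem_ker, LinearMap.comp_apply, ← hx]
    exact hθ.closed x)

variable {P} in
theorem pull_push (θ : P.JSym →ₗ[ℂ] ℂ) (hθ : IsCocycle P.shiftGr P.corestriction θ)
    (z : P.JSym) (hz : z ∈ LinearMap.ker P.jacobiD ⊓ redDeg P.shiftGr 0) :
    P.pull (P.push θ hθ) z = θ z := by
  have := P.classMap_spec.2.2.2 ⟨z, hz⟩
  rw [pull_apply, this]
  rfl

variable {P} in
theorem dual_ext {φ ψ : P.CohomologyDual}
    (h : ∀ z ∈ LinearMap.ker P.jacobiD ⊓ redDeg P.shiftGr 0, P.pull φ z = P.pull ψ z) : φ = ψ := by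
  refine P.toDual.injective (LinearMap.ext fun c => ?_)
  obtain ⟨z, rfl⟩ := Submodule.Quotient.mk_surjective _ c
  rw [← P.classMap_spec.2.2.2 z]
  exact h z z.2

/-- The product on `ℍ⁰(J^♯)^*` dual to the comultiplication of `J^♯`: on the class of a cocycle `z`,
`(φ ψ)(z) = ∑ φ(z') ψ(z'')` where `Δ z = ∑ z' ⊗ z''`. -/
instance : Mul P.CohomologyDual where
  mul φ ψ := P.push (conv P.shiftGr (P.pull φ) (P.pull ψ))
    ((isCocycle_pull φ).conv P.corestriction_mem (isCocycle_pull ψ))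

variable {P} in
theorem pull_mul (φ ψ : P.CohomologyDual) (z : P.JSym)
    (hz : z ∈ LinearMap.ker P.jacobiD ⊓ redDeg P.shiftGr 0) :
    P.pull (φ * ψ) z = conv P.shiftGr (P.pull φ) (P.pull ψ) z := pull_push _ _ z hz

/-- The product may be computed with any cocycles representing the two functionals. -/
theorem push_mul_push (θ η : P.JSym →ₗ[ℂ] ℂ) (hθ : IsCocycle P.shiftGr P.corestriction θ)
    (hη : IsCocycle P.shiftGr P.corestriction η) :
    P.push θ hθ * P.push η hη =
      P.push (conv P.shiftGr θ η) (hθ.conv P.corestriction_mem hη) := by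
  refine dual_ext fun z hz => ?_
  rw [pull_mul _ _ z hz, pull_push _ _ z hz]
  have h : ∀ (θ η : P.JSym →ₗ[ℂ] ℂ) (hθ : IsCocycle P.shiftGr P.corestriction θ)
      (_ : IsCocycle P.shiftGr P.corestriction η),
      conv P.shiftGr (P.pull (P.push θ hθ)) η z = conv P.shiftGr θ η z := by
    intro θ η hθ hη
    have := IsCocycle.conv_eq_zero P.corestriction_mem P.corestriction_one
      ((isCocycle_pull (P.push θ hθ)).sub hθ) hη (fun w hw => by
        rw [LinearMap.sub_apply, pull_push θ hθ w hw, sub_self]) hz.1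
    rw [conv_sub, LinearMap.sub_apply, sub_eq_zero] at this
    exact this
  rw [h θ _ hθ (isCocycle_pull _), hθ.conv_comm (isCocycle_pull _), h η θ hη hθ,
    hη.conv_comm hθ]

theorem push_pull (φ : P.CohomologyDual) : P.push (P.pull φ) (isCocycle_pull φ) = φ :=
  dual_ext fun z hz => pull_push _ _ z hz

theorem mul_def (φ ψ : P.CohomologyDual) :
    φ * ψ = P.push (conv P.shiftGr (P.pull φ) (P.pull ψ))
      ((isCocycle_pull φ).conv P.corestriction_mem (isCocycle_pull ψ)) := rfl

theorem dual_mul_assoc (φ ψ χ : P.CohomologyDual) : φ * ψ * χ = φ * (ψ * χ) := by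
  conv_lhs => rw [mul_def P φ ψ, ← push_pull P χ, push_mul_push]
  conv_rhs => rw [mul_def P ψ χ, ← push_pull P φ, push_mul_push]
  refine dual_ext fun z hz => ?_
  rw [pull_push _ _ z hz, pull_push _ _ z hz, conv_assoc]

theorem dual_mul_comm (φ ψ : P.CohomologyDual) : φ * ψ = ψ * φ := by
  refine dual_ext fun z hz => ?_
  rw [pull_mul _ _ z hz, pull_mul _ _ z hz, (isCocycle_pull φ).conv_comm (isCocycle_pull ψ)]

theorem dual_mul_add (φ ψ χ : P.CohomologyDual) : φ * (ψ + χ) = φ * ψ + φ * χ := by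
  refine dual_ext fun z hz => ?_
  rw [map_add, LinearMap.add_apply, pull_mul _ _ z hz, pull_mul _ _ z hz, pull_mul _ _ z hz, map_add,
    conv_add, LinearMap.add_apply]

theorem dual_mul_smul (c : ℂ) (φ ψ : P.CohomologyDual) : φ * (c • ψ) = c • (φ * ψ) := by
  refine dual_ext fun z hz => ?_
  rw [map_smul, LinearMap.smul_apply, pull_mul _ _ z hz, pull_mul _ _ z hz, map_smul, conv_smul,
    LinearMap.smul_apply]

instance : NonUnitalCommRing P.CohomologyDual where
  left_distrib := P.dual_mul_add
  right_distrib φ ψ χ := by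
    rw [dual_mul_comm, dual_mul_add, dual_mul_comm P χ φ, dual_mul_comm P χ ψ]
  zero_mul φ := by
    have := P.dual_mul_smul 0 φ 0
    rwa [zero_smul, zero_smul, dual_mul_comm] at this
  mul_zero φ := by
    have := P.dual_mul_smul 0 φ 0
    rwa [zero_smul, zero_smul] at this
  mul_assoc := P.dual_mul_assoc
  mul_comm := P.dual_mul_comm

instance : SMulCommClass ℂ P.CohomologyDual P.CohomologyDual :=
  ⟨fun c φ ψ => (P.dual_mul_smul c φ ψ).symm⟩

instance : IsScalarTower ℂ P.CohomologyDual P.CohomologyDual :=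
  ⟨fun c φ ψ => by
    rw [smul_eq_mul, smul_eq_mul, dual_mul_comm, dual_mul_smul, dual_mul_comm]⟩

/-- The deformation ring `R(𝔤^♯) = ℂ ⊕ ℍ⁰(J^♯(𝔤^♯))^*`. -/
abbrev DeformationRing : Type _ := Unitization ℂ P.CohomologyDual

/-- The maximal ideal `ℍ⁰(J^♯(𝔤^♯))^*` of `R(𝔤^♯)`. -/
def maximalIdeal : Ideal P.DeformationRing :=
  RingHom.ker (Unitization.fstHom ℂ P.CohomologyDual)

/-- The completed deformation ring `lim_e R / 𝔪^e`. -/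
abbrev CompletedDeformationRing : Type _ := AdicCompletion P.maximalIdeal P.DeformationRing

end DGLiePair

end

/-! Put V = 𝔤[1] ⊕ 𝔥, let D be the Jacobi-Bernoulli differential on Sym V, d its linear part on V,
and n = h¹, r = h². Up to signs, d is the differential of the total complex shifted by one, so H⁰(V,
d) = ℍ¹ and H¹(V, d) = ℍ². The estimate follows from a surjection of the completed deformation ring
onto ℂ[[X₁, …, Xₙ]]/I, where I has r generators without constant term: that quotient has dimension
at least n - r.

The surjection comes from a formal Kuranishi family. Choose cocycles e_i representing a basis of ℍ¹
and build z = exp(∑ e_i X_i + higher terms), where the higher terms absorb the exact part of the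
obstruction. Then z is group-like, and D z vanishes modulo the ideal I of the r remaining
obstruction coefficients (`KoszulSym.exists_kuranishi_family`). Evaluation on z sends a functional θ
to ∑ θ(z_m) X^m. It is multiplicative because z is group-like, and it is well defined on cohomology
modulo I because D z lies in I (`DGLiePair.familyHom`).

Surjectivity on completions needs, for each i, a class θ_i whose series is X_i up to order two. Such
classes exist once ℍ¹ → ℍ⁰(J^♯) is injective, and this is where the vanishing of ℍⁿ for n ≤ 0 enters
(`KoszulSym.exists_of_coder_eq_ι`). A contracting homotopy s of V in negative degrees extends to a
coderivation S. Up to terms of lower weight, DS + SD acts on degree -1 by positive integer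
eigenvalues, so there a polynomial in it with non-zero constant term vanishes. This turns a
primitive of a vector in Sym V into a primitive in V.

Both arguments use D² = 0 (`DGLiePair.jacobiD_jacobiD`). A coderivation is determined by its
corestriction, so it suffices to compute the two components of D² in V. The 𝔤-component vanishes by
the Jacobi identity. The 𝔥-component is a combination of the brackets [A_s, A_t] of iterated
brackets. Encoding [A_s, A_t] as x^s y^t turns its vanishing into a functional equation of X/(e^X -
1), a consequence of e^(a+b) = e^a e^b. -/

noncomputable section

namespace KoszulSym

/-! ### Coderivations of the graded symmetric coalgebra -/

section Coderivations

variable {V : Type*} [AddCommGroup V] [Module ℂ V] (gr : ℤ → Submodule ℂ V)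

/-- In Sym V / Sym^{≥ 2} V a product v x only sees the constant term of x, because `Sym gr` acts on
the first coordinate of ℂ × V through the augmentation. -/
theorem proj_ι_mul (v : V) (x : Sym gr) : proj gr (ι gr v * x) = counit gr x • v := by
  suffices h : ∀ x, LinearMap.fst ℂ ℂ V (truncAction gr x (1, 0)) = counit gr x by
    rw [← h x]
    simp [proj, truncAction, shiftAction]
  have h2 : ∀ y z : Sym gr, ∀ w : ℂ × V, (truncAction gr y w).1 = counit gr y * w.1 := by
    intro y _
    have hy : y ∈ Algebra.adjoin ℂ (Set.range (ι gr)) := by rw [adjoin_ι]; trivial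
    induction hy using Algebra.adjoin_induction with
    | mem y hy =>
      obtain ⟨v, rfl⟩ := hy
      intro w
      simp [truncAction, shiftAction, counit]
    | algebraMap r => intro w; simp [Algebra.algebraMap_eq_smul_one]
    | add a b _ _ ha hb => intro w; simp [ha, hb, add_mul]
    | mul a b _ _ ha hb => intro w; simp [ha, hb, mul_assoc]
  intro x
  simp [h2 x 0]

theorem proj_ι (v : V) : proj gr (ι gr v) = v := by
  simpa using proj_ι_mul_one gr v

theorem proj_sgn_of_parity [DirectSum.Decomposition gr] (x : Sym gr) :
    proj gr (sgn gr x) = parity gr (proj gr x) := by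
  have : proj gr ∘ₗ (sgn gr).toLinearMap = parity gr ∘ₗ proj gr := by
    refine ext_monomial gr fun k n x hx => ?_
    simp [sgn_monomial gr hx, parity_of_mem gr (proj_monomial gr hx)]
  exact LinearMap.congr_fun this x

theorem proj_of_weight_zero {n x} (hx : IsMonomial gr 0 n x) : proj gr x = 0 := by
  cases hx
  exact proj_one gr

variable [DirectSum.Decomposition gr]

theorem ι_mul_ι_of_even {p : ℤ} (hp : Even p) {v : V} (hv : v ∈ gr p) (u : V) :
    ι gr u * ι gr v = ι gr v * ι gr u := by
  induction u using DirectSum.Decomposition.inductionOn gr with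
  | zero => simp
  | @homogeneous q u => rw [ι_comm gr u.2 hv, (hp.mul_left q).neg_one_zpow, one_smul]
  | add v w hv hw => rw [map_add, add_mul, mul_add, hv, hw]

/-- Moving u past an odd v costs (-1)^{|u|}. The parity operator absorbs this sign, so the identity
becomes linear in u and needs no homogeneity of u. -/
theorem ι_mul_ι_of_odd {p : ℤ} (hp : Odd p) {v : V} (hv : v ∈ gr p) (u : V) :
    ι gr (parity gr u) * ι gr v = ι gr v * ι gr u := by
  induction u using DirectSum.Decomposition.inductionOn gr with
  | zero => simp
  | @homogeneous q u =>
    rw [parity_of_mem gr u.2, map_smul, smul_mul_assoc, ι_comm gr u.2 hv, smul_smul]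
    rcases Int.even_or_odd q with hq | hq
    · rw [hq.neg_one_zpow, (hq.mul_right p).neg_one_zpow]; simp
    · rw [hq.neg_one_zpow, (hq.mul hp).neg_one_zpow]; simp
  | add v w hv hw => rw [map_add, map_add, map_add, add_mul, mul_add, hv, hw]

theorem counit_sgn (x : Sym gr) : counit gr (sgn gr x) = counit gr x := by
  have : (counit gr).toLinearMap ∘ₗ (sgn gr).toLinearMap = (counit gr).toLinearMap := by
    refine ext_monomial gr fun k n x hx => ?_
    cases hx with
    | one => simp
    | cons hv hx => simp [counit_ι_mul, sgn_ι_mul gr hv]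
  exact LinearMap.congr_fun this x

theorem lid_counit_comul (x : Sym gr) :
    TensorProduct.lid ℂ (Sym gr) (LinearMap.rTensor (Sym gr) (counit gr).toLinearMap
      (comul gr x)) = x := by
  have : (TensorProduct.lid ℂ (Sym gr)).toLinearMap ∘ₗ
      LinearMap.rTensor (Sym gr) (counit gr).toLinearMap ∘ₗ comul gr = LinearMap.id := by
    refine ext_left gr (by simp [comul_one]) fun p v x hv ih => ?_
    simp only [LinearMap.comp_apply, LinearEquiv.coe_coe, LinearMap.id_apply] at ih ⊢
    conv_rhs => rw [← ih]
    rw [comul_ι_mul]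
    generalize comul gr x = t
    induction t with
    | zero => simp
    | add a b ha hb => simp only [map_add, ha, hb, mul_add]
    | tmul a b =>
      have : ι gr v = ι gr (evenPart gr v) + ι gr (oddPart gr v) := by
        rw [← map_add]; congr 1; simp only [evenPart, oddPart, LinearMap.smul_apply,
          LinearMap.add_apply, LinearMap.sub_apply, LinearMap.id_apply]; module
      simp only [mulPrim_tmul, map_add, LinearMap.rTensor_tmul, AlgHom.toLinearMap_apply,
        counit_ι_mul, counit_sgn, TensorProduct.lid_tmul, zero_smul, zero_add]
      conv_rhs => rw [this]
      rw [add_mul, mul_smul_comm, mul_smul_comm]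
  exact LinearMap.congr_fun this x

theorem rid_counit_comul (x : Sym gr) :
    TensorProduct.rid ℂ (Sym gr) (LinearMap.lTensor (Sym gr) (counit gr).toLinearMap
      (comul gr x)) = x := by
  have : (TensorProduct.rid ℂ (Sym gr)).toLinearMap ∘ₗ
      LinearMap.lTensor (Sym gr) (counit gr).toLinearMap ∘ₗ comul gr = LinearMap.id := by
    refine ext_left gr (by simp [comul_one]) fun p v x hv ih => ?_
    simp only [LinearMap.comp_apply, LinearEquiv.coe_coe, LinearMap.id_apply] at ih ⊢
    conv_rhs => rw [← ih]
    rw [comul_ι_mul]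
    generalize comul gr x = t
    induction t with
    | zero => simp
    | add a b ha hb => simp only [map_add, ha, hb, mul_add]
    | tmul a b =>
      simp only [mulPrim_tmul, map_add, LinearMap.lTensor_tmul, AlgHom.toLinearMap_apply,
        counit_ι_mul, TensorProduct.rid_tmul, zero_smul, add_zero, mul_smul_comm]
  exact LinearMap.congr_fun this x

/-- The projection of q(x') x'' to V keeps only the constant term of x'', and the counit axiom then
collapses the sum. -/
theorem proj_coder (q : Sym gr →ₗ[ℂ] V) (x : Sym gr) : proj gr (coder gr q x) = q x := by
  conv_rhs => rw [← rid_counit_comul gr x]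
  rw [coder, LinearMap.comp_apply]
  generalize comul gr x = t
  induction t with
  | zero => simp
  | add a b ha hb => simp only [map_add, ha, hb]
  | tmul a b => simp [proj_ι_mul]

theorem counit_coder (q : Sym gr →ₗ[ℂ] V) (x : Sym gr) : counit gr (coder gr q x) = 0 := by
  rw [coder, LinearMap.comp_apply]
  generalize comul gr x = t
  induction t with
  | zero => simp
  | add a b ha hb => simp only [map_add, ha, hb, add_zero]
  | tmul a b => simp [counit_ι_mul, -map_mul]

/-- The coderivation whose corestriction is concentrated on `Sym^1` is a (graded) derivation. -/
theorem coder_comp_proj_ι_mul {ξ : V →ₗ[ℂ] V} {ε : ℂ}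
    (hξ : ∀ u, ξ (parity gr u) = ε • parity gr (ξ u)) {p : ℤ} {v : V} (hv : v ∈ gr p)
    (x : Sym gr) : coder gr (ξ ∘ₗ proj gr) (ι gr v * x) =
      ι gr (ξ v) * x + (if Even p then 1 else ε) • (ι gr v * coder gr (ξ ∘ₗ proj gr) x) := by
  have key : ∀ t : Sym gr ⊗[ℂ] Sym gr,
      TensorProduct.lift (LinearMap.mul ℂ (Sym gr) ∘ₗ ι gr ∘ₗ ξ ∘ₗ proj gr) (mulPrim gr v t) =
      ι gr (ξ v) * TensorProduct.lid ℂ (Sym gr) (LinearMap.rTensor (Sym gr)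
        (counit gr).toLinearMap t) + (if Even p then 1 else ε) • (ι gr v *
        TensorProduct.lift (LinearMap.mul ℂ (Sym gr) ∘ₗ ι gr ∘ₗ ξ ∘ₗ proj gr) t) := by
    intro t
    induction t with
    | zero => simp
    | add a b ha hb => simp only [map_add, ha, hb, mul_add, smul_add]; abel
    | tmul a b =>
      simp only [mulPrim_tmul, map_add, TensorProduct.lift.tmul, LinearMap.comp_apply,
        LinearMap.mul_apply', proj_ι_mul, proj_sgn_of_parity, hξ, map_smul, LinearMap.rTensor_tmul,
        AlgHom.toLinearMap_apply, TensorProduct.lid_tmul, evenPart_of_mem gr hv,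
        oddPart_of_mem gr hv, smul_mul_assoc, mul_smul_comm, LinearMap.smul_apply]
      rcases Int.even_or_odd p with hp | hp
      · simp only [hp, if_true, one_smul, zero_smul, add_zero]
        rw [← mul_assoc, ι_mul_ι_of_even gr hp hv, mul_assoc]
      · simp only [Int.not_even_iff_odd.2 hp, if_false, one_smul, zero_smul, add_zero]
        rw [← mul_assoc, ι_mul_ι_of_odd gr hp hv, mul_assoc]
  have h := key (comul gr x)
  rw [lid_counit_comul] at h
  rw [coder, LinearMap.comp_apply, comul_ι_mul]
  exact h

/-- The coderivation with corestriction `proj` is also the derivation extending the identity of V,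
that is, the Euler operator counting factors. -/
theorem coder_proj_monomial {k n x} (hx : IsMonomial gr k n x) :
    coder gr (proj gr) x = (k : ℂ) • x := by
  have h0 : coder gr (proj gr) = coder gr (LinearMap.id ∘ₗ proj gr) := by rw [LinearMap.id_comp]
  rw [h0]
  induction hx with
  | one => simp [coder_one, proj_one]
  | cons hv hx ih =>
    rw [coder_comp_proj_ι_mul gr (ε := 1) (by simp) hv, ih]
    simp [add_smul, add_comm]

/-- The Euler operator multiplies the weight j component by j, so in characteristic zero its kernel
is the weight 0 part, which the augmentation detects. -/
theorem eq_zero_of_coder_proj {y : Sym gr} (h : coder gr (proj gr) y = 0)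
    (h0 : counit gr y = 0) : y = 0 := by
  have h1 : Polynomial.lsum (fun _ : ℕ => (LinearMap.id : Sym gr →ₗ[ℂ] Sym gr)) ∘ₗ
      (weight gr).toLinearMap = LinearMap.id := by
    refine ext_monomial gr fun k n x hx => ?_
    simp only [LinearMap.comp_apply, AlgHom.toLinearMap_apply, weight_monomial gr hx,
      Polynomial.lsum_apply]
    rw [Polynomial.sum_monomial_index _ _ (by simp)]
  have h2 : ∀ j : ℕ, (Polynomial.lcoeff (Sym gr) j).restrictScalars ℂ ∘ₗ
      (weight gr).toLinearMap ∘ₗ coder gr (proj gr) =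
      (j : ℂ) • ((Polynomial.lcoeff (Sym gr) j).restrictScalars ℂ ∘ₗ
        (weight gr).toLinearMap) := by
    intro j
    refine ext_monomial gr fun k n x hx => ?_
    simp only [LinearMap.comp_apply, AlgHom.toLinearMap_apply, coder_proj_monomial gr hx, map_smul,
      weight_monomial gr hx, LinearMap.smul_apply, LinearMap.restrictScalars_apply,
      Polynomial.lcoeff_apply, Polynomial.coeff_monomial]
    split_ifs with hk <;> simp [hk]
  have h3 : (Polynomial.lcoeff (Sym gr) 0).restrictScalars ℂ ∘ₗ (weight gr).toLinearMap =
      Algebra.linearMap ℂ (Sym gr) ∘ₗ (counit gr).toLinearMap := by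
    refine ext_monomial gr fun k n x hx => ?_
    simp only [LinearMap.comp_apply, AlgHom.toLinearMap_apply,
      weight_monomial gr hx, LinearMap.restrictScalars_apply,
      Polynomial.lcoeff_apply, Polynomial.coeff_monomial]
    cases hx with
    | one => simp
    | cons hv hx => simp [counit_ι_mul, -map_mul]
  have h4 : weight gr y = 0 := by
    ext j
    rcases Nat.eq_zero_or_pos j with rfl | hj
    · have := LinearMap.congr_fun h3 y
      simpa [h0] using this
    · have := LinearMap.congr_fun (h2 j) y
      simp only [LinearMap.comp_apply, h, map_zero, LinearMap.smul_apply] at this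
      have h5 := (smul_eq_zero.1 this.symm).resolve_left (by exact_mod_cast hj.ne')
      simpa using h5
  have := LinearMap.congr_fun h1 y
  simpa [h4] using this.symm

/-- An even coderivation with zero corestriction vanishes. -/
theorem eq_zero_of_coderivation {X : Sym gr →ₗ[ℂ] Sym gr}
    (hX : ∀ x, comul gr (X x) = LinearMap.rTensor (Sym gr) X (comul gr x) +
      LinearMap.lTensor (Sym gr) X (comul gr x))
    (h0 : ∀ x, counit gr (X x) = 0) (hp : ∀ x, proj gr (X x) = 0) : X = 0 := by
  refine ext_monomial gr fun k => ?_
  induction k using Nat.strong_induction_on with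
  | _ k ih =>
    intro n x hx
    -- The Euler operator applied to X x is the sum of proj(y') y'' over Δ(X x). Terms with X on the
    -- left factor die because X has zero corestriction. Terms with X on the right factor die by
    -- induction, or because `proj` kills a left factor of weight 0.
    refine eq_zero_of_coder_proj gr ?_ (h0 x)
    have h := comul_monomial gr hx
    rw [coder, LinearMap.comp_apply, hX]
    generalize comul gr x = t at h
    induction h using Submodule.span_induction with
    | mem s hs =>
      obtain ⟨k₁, k₂, n₁, n₂, a, b, ha, hb, hk, -, rfl⟩ := hs
      rcases Nat.eq_zero_or_pos k₁ with h1 | h1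
      · subst h1
        simp [hp, proj_of_weight_zero gr ha]
      · have := ih k₂ (by omega) n₂ b hb
        simp [hp, this]
    | zero => simp
    | add a b _ _ ha hb =>
      simp only [map_add] at ha hb ⊢
      rw [← add_zero (0 : Sym gr)]; nth_rw 1 [← ha]; rw [← hb]; abel
    | smul c a _ ha =>
      simp only [map_smul, map_add] at ha ⊢
      rw [← smul_add, ha, smul_zero]

/-- A coderivation of degree `1` squares to zero if its corestriction kills its image. -/
theorem coder_coder {q : Sym gr →ₗ[ℂ] V} (hq : ∀ n, ∀ x ∈ deg gr n, q x ∈ gr (n + 1))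
    (h : ∀ x, q (coder gr q x) = 0) (x : Sym gr) : coder gr q (coder gr q x) = 0 := by
  have hodd := odd_of_degree gr hq
  have hs : ∀ x, coder gr q (sgn gr x) = -sgn gr (coder gr q x) := by
    intro x
    rw [coder, LinearMap.comp_apply, ← map_sgn_comul, LinearMap.comp_apply]
    generalize comul gr x = t
    induction t with
    | zero => simp
    | add a b ha hb => simp only [map_add, ha, hb, neg_add]
    | tmul a b =>
      have : ∀ v, sgn gr (ι gr v) = ι gr (parity gr v) := by intro v; simp [sgn]
      simp [hodd, this]
  -- The square of an odd coderivation is an even one: the two cross terms D ⊗ D cancel, because D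
  -- anticommutes with the parity automorphism.
  have := eq_zero_of_coderivation gr (X := coder gr q ∘ₗ coder gr q) (fun x => by
    simp only [LinearMap.comp_apply]
    rw [comul_coder gr hodd, comul_coder gr hodd, map_add, map_add]
    generalize comul gr x = t
    induction t with
    | zero => simp
    | add a b ha hb =>
      simp only [map_add] at ha hb ⊢
      linear_combination (norm := module) ha + hb
    | tmul a b => simp [hs, TensorProduct.neg_tmul, sgn_sgn])
    (fun x => counit_coder gr q _) (fun x => by simp [proj_coder, h])
  exact LinearMap.congr_fun this x

end Coderivations
end KoszulSym
end

noncomputable section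

theorem neg_one_zpow_congr {a b : ℤ} (h : Even (a - b)) : (-1 : ℂ) ^ a = (-1 : ℂ) ^ b := by
  have : a = (a - b) + b := by ring
  rw [this, zpow_add₀ (by norm_num), h.neg_one_zpow, one_mul]

theorem DGLieAlgebra.leibniz_parity {L : Type*} [AddCommGroup L] [Module ℂ L] (A : DGLieAlgebra L)
    (x y : L) : A.d (A.bracket x y) =
      A.bracket (A.d x) y + A.bracket (KoszulSym.parity A.gr x) (A.d y) := by
  induction x using DirectSum.Decomposition.inductionOn A.gr with
  | zero => simp
  | @homogeneous m x => rw [A.leibniz m x x.2, KoszulSym.parity_of_mem A.gr x.2]; simp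
  | add a b ha hb =>
    simp only [map_add, LinearMap.add_apply, ha, hb]
    abel

namespace KoszulSym

/-! ### Weight filtration and Koszul signs -/

section Filtration

variable {V : Type*} [AddCommGroup V] [Module ℂ V] (gr : ℤ → Submodule ℂ V)

/-- The span of the monomials of weight at most `N` and degree `n`. -/
def filt (N : ℕ) (n : ℤ) : Submodule ℂ (Sym gr) :=
  Submodule.span ℂ {x | ∃ k ≤ N, IsMonomial gr k n x}

theorem filt_mono {M N : ℕ} (h : M ≤ N) (n : ℤ) : filt gr M n ≤ filt gr N n :=
  Submodule.span_mono fun _ ⟨k, hk, hx⟩ => ⟨k, hk.trans h, hx⟩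

variable [DirectSum.Decomposition gr]

/-- A coderivation whose corestriction has degree `u` and vanishes on monomials of weight at most
`r` sends monomials of weight `k` to combinations of monomials of weight at most `k - r`. -/
theorem coder_monomial_mem_filt {q : Sym gr →ₗ[ℂ] V} {u : ℤ} {r : ℕ}
    (hq : ∀ k n x, IsMonomial gr k n x → q x ∈ gr (n + u))
    (hr : ∀ k n x, k ≤ r → IsMonomial gr k n x → q x = 0) {k n x} (hx : IsMonomial gr k n x) :
    coder gr q x ∈ filt gr (k - r) (n + u) := by
  have h := comul_monomial gr hx
  simp only [coder, LinearMap.comp_apply]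
  generalize comul gr x = t at h
  induction h using Submodule.span_induction with
  | mem t ht =>
    obtain ⟨k₁, k₂, n₁, n₂, a, b, ha, hb, hk, rfl, rfl⟩ := ht
    by_cases h1 : k₁ ≤ r
    · simp [hr k₁ n₁ a h1 ha]
    · have := IsMonomial.cons (hq k₁ n₁ a ha) hb
      rw [show n₁ + n₂ + u = n₁ + u + n₂ by ring]
      exact Submodule.subset_span ⟨k₂ + 1, by omega, by simpa using this⟩
  | zero => simp
  | add a b _ _ ha hb => rw [map_add]; exact add_mem ha hb
  | smul c a _ ha => rw [map_smul]; exact Submodule.smul_mem _ _ ha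

theorem coder_mem_filt {q : Sym gr →ₗ[ℂ] V} {u : ℤ}
    (hq : ∀ k n x, IsMonomial gr k n x → q x ∈ gr (n + u)) (h1 : q 1 = 0) {N : ℕ} {n : ℤ}
    {x : Sym gr} (hx : x ∈ filt gr N n) : coder gr q x ∈ filt gr N (n + u) := by
  induction hx using Submodule.span_induction with
  | mem x hx =>
    obtain ⟨k, hk, hx⟩ := hx
    refine filt_mono gr (by omega : k - 0 ≤ N) _
      (coder_monomial_mem_filt gr hq (r := 0) (fun k n x hk hx => ?_) hx)
    obtain rfl : k = 0 := by omega
    cases hx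
    exact h1
  | zero => simp
  | add a b _ _ ha hb => rw [map_add]; exact add_mem ha hb
  | smul c a _ ha => rw [map_smul]; exact Submodule.smul_mem _ _ ha

/-- The combination defining `koszul` has eigenvalue (1 + (-1)^m + (-1)^n - (-1)^(m+n)) / 2, which
is (-1)^(mn) in each of the four parity cases. -/
theorem koszul_monomial {k₁ k₂ : ℕ} {m n : ℤ} {a b : Sym gr} (ha : IsMonomial gr k₁ m a)
    (hb : IsMonomial gr k₂ n b) : koszul gr (a ⊗ₜ b) = (-1 : ℂ) ^ (m * n) • (a ⊗ₜ[ℂ] b) := by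
  rw [koszul_tmul, sgn_monomial gr ha, sgn_monomial gr hb]
  simp only [TensorProduct.tmul_smul, ← TensorProduct.smul_tmul']
  rcases Int.even_or_odd m with hm | hm <;> rcases Int.even_or_odd n with hn | hn
  · rw [hm.neg_one_zpow, hn.neg_one_zpow, (hm.mul_right n).neg_one_zpow]; module
  · rw [hm.neg_one_zpow, hn.neg_one_zpow, (hm.mul_right n).neg_one_zpow]; module
  · rw [hm.neg_one_zpow, hn.neg_one_zpow, (hn.mul_left m).neg_one_zpow]; module
  · rw [hm.neg_one_zpow, hn.neg_one_zpow, (hm.mul hn).neg_one_zpow]; module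

theorem ext_monomial₂ {M : Type*} [AddCommMonoid M] [Module ℂ M]
    {f g : Sym gr ⊗[ℂ] Sym gr →ₗ[ℂ] M}
    (h : ∀ k m x l n y, IsMonomial gr k m x → IsMonomial gr l n y →
      f (x ⊗ₜ y) = g (x ⊗ₜ y)) : f = g := by
  refine TensorProduct.ext (ext_monomial gr fun k m x hx => ext_monomial gr fun l n y hy => ?_)
  exact h _ _ _ _ _ _ hx hy

theorem ext_monomial₃ {M : Type*} [AddCommMonoid M] [Module ℂ M]
    {f g : Sym gr ⊗[ℂ] (Sym gr ⊗[ℂ] Sym gr) →ₗ[ℂ] M}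
    (h : ∀ k m x l n y j p z, IsMonomial gr k m x → IsMonomial gr l n y → IsMonomial gr j p z →
      f (x ⊗ₜ (y ⊗ₜ z)) = g (x ⊗ₜ (y ⊗ₜ z))) : f = g := by
  refine TensorProduct.ext (ext_monomial gr fun k m x hx =>
    ext_monomial₂ gr fun l n y j p z hy hz => ?_)
  exact h _ _ _ _ _ _ _ _ _ hx hy hz

/-- The power of the parity automorphism of `Sym V`. -/
def sgnPow (v : ℤ) : Sym gr →ₗ[ℂ] Sym gr := if Even v then LinearMap.id else (sgn gr).toLinearMap

theorem sgnPow_monomial (v : ℤ) {k n x} (hx : IsMonomial gr k n x) :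
    sgnPow gr v x = (-1 : ℂ) ^ (v * n) • x := by
  rw [sgnPow]
  split_ifs with hv
  · rw [(hv.mul_right n).neg_one_zpow, one_smul, LinearMap.id_apply]
  · rw [AlgHom.toLinearMap_apply, sgn_monomial gr hx]
    congr 1
    obtain ⟨c, rfl⟩ := Int.not_even_iff_odd.1 hv
    exact neg_one_zpow_congr ⟨-c * n, by ring⟩

theorem sgnPow_zero : sgnPow gr 0 = LinearMap.id := by simp [sgnPow]

theorem sgnPow_one : sgnPow gr 1 = (sgn gr).toLinearMap := by simp [sgnPow]

theorem map_sgnPow_comul (v : ℤ) (x : Sym gr) :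
    TensorProduct.map (sgnPow gr v) (sgnPow gr v) (comul gr x) = comul gr (sgnPow gr v x) := by
  rw [sgnPow]
  split_ifs
  · simp
  · exact map_sgn_comul gr x

end Filtration

/-! ### The convolution Lie bracket on linear maps from Sym V to a graded Lie algebra -/

section ConvolutionBracket

variable {V : Type*} [AddCommGroup V] [Module ℂ V] {gr : ℤ → Submodule ℂ V}
  [DirectSum.Decomposition gr] {L : Type*} [AddCommGroup L] [Module ℂ L] (A : DGLieAlgebra L)

/-- The linear map `x ↦ ∑ [f(x'), g(x'')]` where `Δ x = ∑ x' ⊗ x''`. -/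
def convBracket (f g : Sym gr →ₗ[ℂ] L) : Sym gr →ₗ[ℂ] L :=
  TensorProduct.lift A.bracket ∘ₗ TensorProduct.map f g ∘ₗ comul gr

/-- The graded bracket on the linear maps from `Sym V` to a Lie algebra, where `v` is the degree
of the second argument. -/
def gradedBracket (v : ℤ) (f g : Sym gr →ₗ[ℂ] L) : Sym gr →ₗ[ℂ] L :=
  convBracket A (f ∘ₗ sgnPow gr v) g

theorem gradedBracket_zero_left (f g : Sym gr →ₗ[ℂ] L) :
    gradedBracket A 0 f g = convBracket A f g := by
  rw [gradedBracket, sgnPow_zero, LinearMap.comp_id]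

variable {A}

theorem convBracket_add_left (f f' g : Sym gr →ₗ[ℂ] L) :
    convBracket A (f + f') g = convBracket A f g + convBracket A f' g := by
  simp only [convBracket, TensorProduct.map_add_left, LinearMap.add_comp, LinearMap.comp_add]

theorem convBracket_add_right (f g g' : Sym gr →ₗ[ℂ] L) :
    convBracket A f (g + g') = convBracket A f g + convBracket A f g' := by
  simp only [convBracket, TensorProduct.map_add_right, LinearMap.add_comp, LinearMap.comp_add]

theorem convBracket_smul_left (c : ℂ) (f g : Sym gr →ₗ[ℂ] L) :
    convBracket A (c • f) g = c • convBracket A f g := by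
  simp only [convBracket, TensorProduct.map_smul_left, LinearMap.smul_comp, LinearMap.comp_smul]

theorem convBracket_smul_right (c : ℂ) (f g : Sym gr →ₗ[ℂ] L) :
    convBracket A f (c • g) = c • convBracket A f g := by
  simp only [convBracket, TensorProduct.map_smul_right, LinearMap.smul_comp, LinearMap.comp_smul]

theorem convBracket_neg_left (f g : Sym gr →ₗ[ℂ] L) :
    convBracket A (-f) g = -convBracket A f g := by
  simpa using convBracket_smul_left (A := A) (-1) f g

theorem convBracket_comp_sgnPow (v : ℤ) (f g : Sym gr →ₗ[ℂ] L) :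
    convBracket A f g ∘ₗ sgnPow gr v = convBracket A (f ∘ₗ sgnPow gr v) (g ∘ₗ sgnPow gr v) := by
  ext x
  simp only [convBracket, LinearMap.comp_apply, TensorProduct.map_comp, map_sgnPow_comul]

theorem convBracket_congr {f f' g g' : Sym gr →ₗ[ℂ] L} {k n x} (hx : IsMonomial gr k n x)
    (h : ∀ k₁ k₂ n₁ n₂ a b, k₁ + k₂ = k → IsMonomial gr k₁ n₁ a → IsMonomial gr k₂ n₂ b →
      A.bracket (f a) (g b) = A.bracket (f' a) (g' b)) :
    convBracket A f g x = convBracket A f' g' x := by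
  have hs := comul_monomial gr hx
  simp only [convBracket, LinearMap.comp_apply]
  generalize comul gr x = t at hs
  induction hs using Submodule.span_induction with
  | mem t ht =>
    obtain ⟨k₁, k₂, n₁, n₂, a, b, ha, hb, hk, -, rfl⟩ := ht
    simpa using h k₁ k₂ n₁ n₂ a b hk ha hb
  | zero => simp
  | add a b _ _ ha hb => simp only [map_add, ha, hb]
  | smul c a _ ha => simp only [map_smul, ha]

theorem convBracket_eq_zero {f g : Sym gr →ₗ[ℂ] L} {k n x} (hx : IsMonomial gr k n x)
    (h : ∀ k₁ k₂ n₁ n₂ a b, k₁ + k₂ = k → IsMonomial gr k₁ n₁ a → IsMonomial gr k₂ n₂ b →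
      f a = 0 ∨ g b = 0) : convBracket A f g x = 0 := by
  have h0 : convBracket A (gr := gr) 0 0 x = 0 := by simp [convBracket]
  rw [← h0]
  refine convBracket_congr hx fun k₁ k₂ n₁ n₂ a b hk ha hb => ?_
  rcases h k₁ k₂ n₁ n₂ a b hk ha hb with h | h <;> simp [h]

variable (A) in
/-- A linear map from `Sym V` to a graded Lie algebra is homogeneous of degree `u`. -/
def HasDegree (u : ℤ) (f : Sym gr →ₗ[ℂ] L) : Prop :=
  ∀ k n x, IsMonomial gr k n x → f x ∈ A.gr (n + u)

theorem HasDegree.parity_comp {u : ℤ} {f : Sym gr →ₗ[ℂ] L} (hf : HasDegree A u f) :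
    parity A.gr ∘ₗ f = (-1 : ℂ) ^ u • (f ∘ₗ (sgn gr).toLinearMap) := by
  refine ext_monomial gr fun k n x hx => ?_
  simp only [LinearMap.comp_apply, LinearMap.smul_apply, AlgHom.toLinearMap_apply,
    sgn_monomial gr hx, parity_of_mem A.gr (hf k n x hx), map_smul, smul_smul]
  rw [add_comm, zpow_add₀ (by norm_num)]

theorem HasDegree.gradedBracket {u v : ℤ} {f g : Sym gr →ₗ[ℂ] L} (hf : HasDegree A u f)
    (hg : HasDegree A v g) : HasDegree A (u + v) (gradedBracket A v f g) := by
  intro k n x hx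
  have hs := comul_monomial gr hx
  simp only [KoszulSym.gradedBracket, convBracket, LinearMap.comp_apply]
  generalize comul gr x = t at hs
  induction hs using Submodule.span_induction with
  | mem t ht =>
    obtain ⟨k₁, k₂, n₁, n₂, a, b, ha, hb, -, rfl, rfl⟩ := ht
    have := A.bracket_mem _ _ _ (hf _ _ _ ha) _ (hg _ _ _ hb)
    rw [show n₁ + n₂ + (u + v) = n₁ + u + (n₂ + v) by ring]
    simpa [sgnPow_monomial gr v ha] using Submodule.smul_mem _ _ this
  | zero => simp
  | add a b _ _ ha hb => simp only [map_add]; exact add_mem ha hb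
  | smul c a _ ha => simp only [map_smul]; exact Submodule.smul_mem _ _ ha

/-- Skew-symmetry of the bracket of `A` passes to the convolution bracket because Δ is graded
cocommutative. -/
theorem gradedBracket_skew {u v : ℤ} {f g : Sym gr →ₗ[ℂ] L} (hf : HasDegree A u f)
    (hg : HasDegree A v g) :
    gradedBracket A v f g = -((-1 : ℂ) ^ (u * v) • gradedBracket A u g f) := by
  have key : TensorProduct.lift A.bracket ∘ₗ TensorProduct.map (f ∘ₗ sgnPow gr v) g =
      -((-1 : ℂ) ^ (u * v) • (TensorProduct.lift A.bracket ∘ₗ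
        TensorProduct.map (g ∘ₗ sgnPow gr u) f) ∘ₗ
        (TensorProduct.comm ℂ (Sym gr) (Sym gr)).toLinearMap ∘ₗ koszul gr) := by
    refine ext_monomial₂ gr fun k m a l n b ha hb => ?_
    simp only [LinearMap.comp_apply, LinearMap.smul_apply, LinearMap.neg_apply,
      koszul_monomial gr ha hb, map_smul, LinearEquiv.coe_coe, TensorProduct.comm_tmul,
      TensorProduct.map_tmul, TensorProduct.lift.tmul, sgnPow_monomial gr _ ha,
      sgnPow_monomial gr _ hb]
    rw [A.bracket_skew _ _ _ (hf _ _ _ ha) _ (hg _ _ _ hb)]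
    simp only [smul_neg, smul_smul, ← zpow_add₀ (show (-1 : ℂ) ≠ 0 by norm_num)]
    -- Only the parity of the exponent matters; the two exponents differ by 2vm.
    rw [neg_one_zpow_congr (b := u * v + (m * n + u * n)) ⟨v * m, by ring⟩]
  ext x
  have := LinearMap.congr_fun key (comul gr x)
  simp only [LinearMap.comp_apply, LinearMap.smul_apply, LinearMap.neg_apply, LinearEquiv.coe_coe,
    cocomm] at this
  simpa [gradedBracket, convBracket] using this

/-- Writing both nestings of the bracket on the same iterated comultiplication reduces the Jacobi
identity to a signed identity on Sym V ⊗ Sym V ⊗ Sym V. -/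
theorem convBracket_convBracket_right (f g h : Sym gr →ₗ[ℂ] L) (x : Sym gr) :
    convBracket A f (convBracket A g h) x = TensorProduct.lift A.bracket
      (TensorProduct.map f (TensorProduct.lift A.bracket ∘ₗ TensorProduct.map g h)
        (LinearMap.lTensor (Sym gr) (comul gr) (comul gr x))) := by
  rw [convBracket, LinearMap.comp_apply, LinearMap.comp_apply]
  generalize comul gr x = t
  induction t with
  | zero => simp
  | add a b ha hb => simp only [map_add, ha, hb]
  | tmul a b => simp [convBracket]

theorem convBracket_convBracket_left (f g h : Sym gr →ₗ[ℂ] L) (x : Sym gr) :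
    convBracket A (convBracket A f g) h x = TensorProduct.lift A.bracket
      (TensorProduct.map (TensorProduct.lift A.bracket ∘ₗ TensorProduct.map f g) h
        ((TensorProduct.assoc ℂ _ _ _).symm
          (LinearMap.lTensor (Sym gr) (comul gr) (comul gr x)))) := by
  rw [← coassoc, LinearEquiv.symm_apply_apply, convBracket, LinearMap.comp_apply,
    LinearMap.comp_apply]
  generalize comul gr x = t
  induction t with
  | zero => simp
  | add a b ha hb => simp only [map_add, ha, hb]
  | tmul a b => simp [convBracket]

variable (gr) in
/-- The signed exchange of the first two factors of `Sym V ⊗ Sym V ⊗ Sym V`. -/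
def swapLeft : Module.End ℂ (Sym gr ⊗[ℂ] (Sym gr ⊗[ℂ] Sym gr)) :=
  (TensorProduct.assoc ℂ _ _ _).toLinearMap ∘ₗ
    LinearMap.rTensor (Sym gr) ((TensorProduct.comm ℂ (Sym gr) (Sym gr)).toLinearMap ∘ₗ koszul gr) ∘ₗ
      (TensorProduct.assoc ℂ _ _ _).symm.toLinearMap

theorem swapLeft_comul (x : Sym gr) :
    swapLeft gr (LinearMap.lTensor (Sym gr) (comul gr) (comul gr x)) =
      LinearMap.lTensor (Sym gr) (comul gr) (comul gr x) := by
  rw [← coassoc]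
  simp only [swapLeft, LinearMap.comp_apply, LinearEquiv.coe_coe, LinearEquiv.symm_apply_apply]
  rw [← LinearMap.comp_apply, ← LinearMap.rTensor_comp]
  congr 3
  ext y
  exact cocomm gr y

/-- Coassociativity puts the three double brackets on one iterated coproduct. The term in which f
and g change places is handled by invariance of that coproduct under `swapLeft`, and the Jacobi
identity of `A` then applies factor by factor. -/
theorem gradedBracket_jacobi {u v w : ℤ} {f g h : Sym gr →ₗ[ℂ] L} (hf : HasDegree A u f)
    (hg : HasDegree A v g) :
    gradedBracket A (v + w) f (gradedBracket A w g h) =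
      gradedBracket A w (gradedBracket A v f g) h +
        (-1 : ℂ) ^ (u * v) • gradedBracket A (u + w) g (gradedBracket A w f h) := by
  have key : TensorProduct.lift A.bracket ∘ₗ TensorProduct.map (f ∘ₗ sgnPow gr (v + w))
        (TensorProduct.lift A.bracket ∘ₗ TensorProduct.map (g ∘ₗ sgnPow gr w) h) =
      TensorProduct.lift A.bracket ∘ₗ TensorProduct.map (TensorProduct.lift A.bracket ∘ₗ
        TensorProduct.map ((f ∘ₗ sgnPow gr v) ∘ₗ sgnPow gr w) (g ∘ₗ sgnPow gr w)) h ∘ₗ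
          (TensorProduct.assoc ℂ _ _ _).symm.toLinearMap +
      (-1 : ℂ) ^ (u * v) • (TensorProduct.lift A.bracket ∘ₗ
        TensorProduct.map (g ∘ₗ sgnPow gr (u + w))
        (TensorProduct.lift A.bracket ∘ₗ TensorProduct.map (f ∘ₗ sgnPow gr w) h)) ∘ₗ
          swapLeft gr := by
    refine ext_monomial₃ gr fun k m a l n b j p c ha hb hc => ?_
    simp only [LinearMap.comp_apply, LinearMap.add_apply, LinearMap.smul_apply, swapLeft,
      LinearEquiv.coe_coe, TensorProduct.assoc_symm_tmul, LinearMap.rTensor_tmul,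
      koszul_monomial gr ha hb, map_smul, TensorProduct.comm_tmul, ← TensorProduct.smul_tmul',
      TensorProduct.assoc_tmul, TensorProduct.map_tmul, TensorProduct.lift.tmul,
      sgnPow_monomial gr _ ha, sgnPow_monomial gr _ hb, LinearMap.smul_apply]
    rw [A.jacobi _ _ _ (hf _ _ _ ha) _ (hg _ _ _ hb)]
    simp only [smul_add, smul_smul, ← zpow_add₀ (show (-1 : ℂ) ≠ 0 by norm_num)]
    congr 1
    · congr 1
      exact neg_one_zpow_congr ⟨0, by ring⟩
    · congr 1
      exact neg_one_zpow_congr ⟨v * m, by ring⟩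
  ext x
  have := LinearMap.congr_fun key (LinearMap.lTensor (Sym gr) (comul gr) (comul gr x))
  simp only [LinearMap.comp_apply, LinearMap.add_apply, LinearMap.smul_apply, swapLeft_comul,
    LinearEquiv.coe_coe] at this
  rw [← convBracket_convBracket_right, ← convBracket_convBracket_right,
    ← convBracket_convBracket_left] at this
  simp only [gradedBracket, convBracket_comp_sgnPow]
  exact this

/-- The co-Leibniz rule for `coder gr q` dualizes to a Leibniz rule: precomposition with an odd
coderivation is an odd derivation of the convolution bracket. -/
theorem convBracket_comp_coder {q : Sym gr →ₗ[ℂ] V}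
    (hq : ∀ n, ∀ x ∈ deg gr n, q x ∈ gr (n + 1)) (f g : Sym gr →ₗ[ℂ] L) :
    convBracket A f g ∘ₗ coder gr q = convBracket A (f ∘ₗ coder gr q) g +
      convBracket A (f ∘ₗ (sgn gr).toLinearMap) (g ∘ₗ coder gr q) := by
  ext x
  simp only [convBracket, LinearMap.comp_apply, LinearMap.add_apply,
    comul_coder gr (odd_of_degree gr hq)]
  generalize comul gr x = t
  induction t with
  | zero => simp
  | add a b ha hb =>
    simp only [map_add] at ha hb ⊢
    linear_combination (norm := module) ha + hb
  | tmul a b => simp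

theorem d_comp_convBracket (f g : Sym gr →ₗ[ℂ] L) :
    A.d ∘ₗ convBracket A f g = convBracket A (A.d ∘ₗ f) g +
      convBracket A (parity A.gr ∘ₗ f) (A.d ∘ₗ g) := by
  ext x
  simp only [convBracket, LinearMap.comp_apply, LinearMap.add_apply]
  generalize comul gr x = t
  induction t with
  | zero => simp
  | add a b ha hb =>
    simp only [map_add] at ha hb ⊢
    linear_combination (norm := module) ha + hb
  | tmul a b => simp [A.leibniz_parity]

end ConvolutionBracket
end KoszulSym

-- With F(c) the Bernoulli series at cX, one has F(c) (e^(cX) - 1) = cX. Replacing each linear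
-- factor by this product, the left side becomes F(a) F(b) times F(a+b) (e^((a+b)X) - 1) - F(a)
-- (e^(aX) - 1) - F(b) (e^(bX) - 1). This bracket is (a + b)X - aX - bX = 0.
open PowerSeries in
theorem rescale_bernoulliPowerSeries_add {A : Type*} [CommRing A] [Algebra ℚ A] (a b : A) :
    C a * X * (C b * X) * rescale (a + b) (bernoulliPowerSeries A) +
      C a * X * rescale b (bernoulliPowerSeries A) *
        (rescale (a + b) (bernoulliPowerSeries A) - rescale a (bernoulliPowerSeries A)) +
      C b * X * rescale a (bernoulliPowerSeries A) *
        (rescale (a + b) (bernoulliPowerSeries A) - rescale b (bernoulliPowerSeries A)) = 0 := by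
  have h : ∀ c : A, rescale c (bernoulliPowerSeries A) * (rescale c (exp A) - 1) = C c * X := by
    intro c
    have := congrArg (rescale c) (bernoulliPowerSeries_mul_exp_sub_one A)
    simpa [rescale_X] using this
  have hs := h (a + b)
  rw [← exp_mul_exp_eq_exp_add, map_add, add_mul, ← h a, ← h b] at hs
  rw [← h a, ← h b]
  linear_combination (rescale a (bernoulliPowerSeries A) * rescale b (bernoulliPowerSeries A)) * hs
end

/-! ### The two components of the square of the Jacobi-Bernoulli differential -/

noncomputable section

namespace DGLiePair

open KoszulSym

variable {G H : Type*} [AddCommGroup G] [Module ℂ G] [AddCommGroup H] [Module ℂ H]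
  (P : DGLiePair G H)

theorem hasDegree_projG : HasDegree P.source 1 P.projG := fun _ _ _ hx => P.projG_mem hx

theorem hasDegree_iterBracket (t : ℕ) : HasDegree P.target 1 (P.iterBracket t) :=
  fun _ _ _ hx => P.iterBracket_mem t hx

theorem iterBracket_succ (t : ℕ) :
    P.iterBracket (t + 1) = convBracket P.target (P.iterBracket t) P.projH := rfl

/-- Since `projG` has degree 1, the parity of 𝔤 corresponds to minus the parity of Sym V. The sign
(-1)^(|a₁|+1) is therefore exactly the Koszul sign of the graded bracket. -/
theorem bracketPart_eq :
    P.bracketPart = (1 / 2 : ℂ) • gradedBracket P.source 1 P.projG P.projG := by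
  have hodd := P.hasDegree_projG.parity_comp
  rw [zpow_one] at hodd
  ext x
  simp only [bracketPart, gradedBracket, convBracket, sgnPow_one, LinearMap.comp_apply,
    LinearMap.smul_apply]
  congr 1
  generalize comul P.shiftGr x = t
  induction t with
  | zero => simp
  | add a b ha hb => simp only [map_add, ha, hb]
  | tmul a b =>
    have := LinearMap.congr_fun hodd a
    simp only [LinearMap.comp_apply, LinearMap.smul_apply, AlgHom.toLinearMap_apply] at this
    simp [this]

theorem projG_jacobiD : P.projG ∘ₗ P.jacobiD = -(P.source.d ∘ₗ P.projG) +
    (1 / 2 : ℂ) • gradedBracket P.source 1 P.projG P.projG := by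
  rw [← bracketPart_eq]
  ext x
  simp [projG, jacobiD, proj_coder, corestriction, linearPart]

theorem projH_jacobiD : P.projH ∘ₗ P.jacobiD = P.target.d ∘ₗ P.projH + P.bernoulliPart := by
  ext x
  simp [projH, jacobiD, proj_coder, corestriction, linearPart]

theorem jacobiD_sgn (x : P.JSym) :
    P.jacobiD (sgn P.shiftGr x) = -sgn P.shiftGr (P.jacobiD x) := by
  have : P.jacobiD ∘ₗ (sgn P.shiftGr).toLinearMap =
      -((sgn P.shiftGr).toLinearMap ∘ₗ P.jacobiD) := by
    refine ext_monomial P.shiftGr fun k n x hx => ?_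
    have hm := coder_mem P.shiftGr P.corestriction_mem
      (Submodule.subset_span ⟨k, hx⟩ : x ∈ deg P.shiftGr n)
    have h : ∀ y ∈ redDeg P.shiftGr (n + 1), sgn P.shiftGr y = (-1 : ℂ) ^ (n + 1) • y := by
      intro y hy
      induction hy using Submodule.span_induction with
      | mem y hy => obtain ⟨k, -, hy⟩ := hy; exact sgn_monomial _ hy
      | zero => simp
      | add a b _ _ ha hb => rw [map_add, ha, hb, smul_add]
      | smul c a _ ha => rw [map_smul, ha, smul_comm]
    simp only [LinearMap.comp_apply, AlgHom.toLinearMap_apply, LinearMap.neg_apply]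
    rw [sgn_monomial _ hx, map_smul, jacobiD, h _ hm, zpow_add_one₀ (by norm_num)]
    module
  exact LinearMap.congr_fun this x

/-- The odd element `projG` of the graded Lie algebra `Hom(J, 𝔤)` satisfies `[x, [x, x]] = 0`. -/
theorem convBracket_projG_projG_projG :
    convBracket P.source P.projG (gradedBracket P.source 1 P.projG P.projG) = 0 ∧
    convBracket P.source (gradedBracket P.source 1 P.projG P.projG ∘ₗ
      (sgn P.shiftGr).toLinearMap) P.projG = 0 := by
  have h1 := gradedBracket_jacobi (w := 1) (h := P.projG) P.hasDegree_projG P.hasDegree_projG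
  have h2 := gradedBracket_skew (P.hasDegree_projG.gradedBracket P.hasDegree_projG)
    P.hasDegree_projG
  have e1 : ∀ f g : P.JSym →ₗ[ℂ] G, gradedBracket P.source (1 + 1) f g =
      convBracket P.source f g := by
    intro f g
    rw [gradedBracket, sgnPow, if_pos (by decide), LinearMap.comp_id]
  have e2 : ∀ f g : P.JSym →ₗ[ℂ] G, gradedBracket P.source 1 f g =
      convBracket P.source (f ∘ₗ (sgn P.shiftGr).toLinearMap) g := by
    intro f g
    rw [gradedBracket, sgnPow_one]
  rw [e1] at h1 h2
  rw [e2 (gradedBracket _ _ _ _)] at h1 h2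
  norm_num at h1 h2
  rw [h2] at h1 ⊢
  -- For a = [γ, [γ, γ]], skew-symmetry turns the Jacobi identity into a = -a - a.
  have h3 : (3 : ℂ) • convBracket P.source P.projG (gradedBracket P.source 1 P.projG P.projG) = 0 := by
    linear_combination (norm := module) h1
  have h4 := (smul_eq_zero.1 h3).resolve_left (by norm_num)
  simp [h4]

/-- The map γ = `projG` satisfies the structure equation γ D = -dγ + ½[γ, γ]. Applying D once more
and using that d and D are derivations of the bracket, the mixed terms in dγ and γ cancel; what is
left contains d² = 0 or [γ, [γ, γ]] = 0. -/
theorem source_closed : P.projG ∘ₗ P.jacobiD ∘ₗ P.jacobiD = 0 := by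
  set γ := P.projG with hγ
  set D := P.jacobiD with hD
  set σ := (sgn P.shiftGr).toLinearMap with hσ
  have e1 : γ ∘ₗ D = -(P.source.d ∘ₗ γ) + (1 / 2 : ℂ) • convBracket P.source (γ ∘ₗ σ) γ := by
    have := P.projG_jacobiD
    rwa [gradedBracket, sgnPow_one] at this
  have e2 : D ∘ₗ σ = -(σ ∘ₗ D) := LinearMap.ext P.jacobiD_sgn
  have e3 : σ ∘ₗ D = -(D ∘ₗ σ) := by rw [e2, neg_neg]
  have e4 : parity P.source.gr ∘ₗ γ = -(γ ∘ₗ σ) := by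
    have := P.hasDegree_projG.parity_comp
    rw [this, zpow_one]; simp [hγ, hσ]
  have e5 : σ ∘ₗ σ = LinearMap.id := LinearMap.ext (sgn_sgn P.shiftGr)
  obtain ⟨e6, e7⟩ := P.convBracket_projG_projG_projG
  rw [gradedBracket, sgnPow_one, ← hγ, ← hσ] at e6 e7
  have e8 : convBracket P.source (γ ∘ₗ σ) γ ∘ₗ D =
      -convBracket P.source ((γ ∘ₗ D) ∘ₗ σ) γ + convBracket P.source γ (γ ∘ₗ D) := by
    rw [hD, jacobiD, convBracket_comp_coder P.corestriction_mem, ← jacobiD, ← hD, ← hσ,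
      LinearMap.comp_assoc, e3, LinearMap.comp_neg, convBracket_neg_left, LinearMap.comp_assoc, e5,
      LinearMap.comp_id, LinearMap.comp_assoc]
  have e9 : P.source.d ∘ₗ convBracket P.source (γ ∘ₗ σ) γ =
      convBracket P.source (P.source.d ∘ₗ γ ∘ₗ σ) γ -
        convBracket P.source γ (P.source.d ∘ₗ γ) := by
    rw [d_comp_convBracket, ← LinearMap.comp_assoc σ γ (parity _), e4, LinearMap.neg_comp, LinearMap.comp_assoc,
      e5, LinearMap.comp_id, convBracket_neg_left, sub_eq_add_neg]
  have hdd : P.source.d ∘ₗ P.source.d = 0 := LinearMap.ext P.source.d_d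
  rw [← LinearMap.comp_assoc, e1, LinearMap.add_comp, LinearMap.neg_comp, LinearMap.smul_comp, e8,
    LinearMap.comp_assoc, e1]
  simp only [LinearMap.comp_add, LinearMap.comp_neg, LinearMap.comp_smul, e9, LinearMap.add_comp,
    LinearMap.neg_comp, LinearMap.smul_comp, convBracket_add_left, convBracket_neg_left,
    convBracket_smul_left, convBracket_add_right, convBracket_smul_right, e6, e7, ← LinearMap.comp_assoc, hdd,
    LinearMap.zero_comp]
  have e10 : convBracket P.source γ (-(P.source.d ∘ₗ γ)) =
      -convBracket P.source γ (P.source.d ∘ₗ γ) := by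
    simpa using convBracket_smul_right (A := P.source) (-1) γ (P.source.d ∘ₗ γ)
  rw [e10]
  module

theorem projH_of_weight_ne {k n x} (hx : IsMonomial P.shiftGr k n x) (hk : k ≠ 1) :
    P.projH x = 0 := by
  rcases hx with _ | ⟨hv, hx⟩
  · simp [projH, proj_one]
  rcases hx with _ | ⟨hw, hx⟩
  · exact absurd rfl hk
  · simp [projH, proj_ι_mul_ι_mul, -map_mul]

theorem projG_of_weight_ne {k n x} (hx : IsMonomial P.shiftGr k n x) (hk : k ≠ 1) :
    P.projG x = 0 := by
  rcases hx with _ | ⟨hv, hx⟩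
  · simp [projG, proj_one]
  rcases hx with _ | ⟨hw, hx⟩
  · exact absurd rfl hk
  · simp [projG, proj_ι_mul_ι_mul, -map_mul]

/-- Of the k factors one is consumed by `projG` and one by each of the t copies of `projH`. -/
theorem iterBracket_of_weight_ne (t : ℕ) {k n x} (hx : IsMonomial P.shiftGr k n x)
    (hk : k ≠ t + 1) : P.iterBracket t x = 0 := by
  induction t generalizing k n x with
  | zero => simp [iterBracket, P.projG_of_weight_ne hx hk]
  | succ t ih =>
    rw [iterBracket_succ]
    refine convBracket_eq_zero hx fun k₁ k₂ n₁ n₂ a b h ha hb => ?_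
    by_cases h2 : k₂ = 1
    · exact .inl (ih ha (by omega))
    · exact .inr (P.projH_of_weight_ne hb h2)

/-- The normalized Bernoulli numbers `B_t / t!`. -/
def bernoulliCoeff (t : ℕ) : ℂ := ((bernoulli t / t.factorial : ℚ) : ℂ)

/-- The definition of `bernoulliPart` chooses its term by the weight of the argument. On bounded
weight it is one fixed finite sum, which can also be applied to D x, an element of mixed weight. -/
theorem bernoulliPart_of_mem_filt {N : ℕ} {n : ℤ} {x : P.JSym} (hx : x ∈ filt P.shiftGr N n) :
    P.bernoulliPart x = ∑ t ∈ Finset.range N, bernoulliCoeff t • P.iterBracket t x := by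
  induction hx using Submodule.span_induction with
  | mem x hx =>
    obtain ⟨k, hk, hx⟩ := hx
    simp only [bernoulliPart, LinearMap.comp_apply, AlgHom.toLinearMap_apply,
      weight_monomial P.shiftGr hx, Polynomial.lsum_apply]
    rw [Polynomial.sum_monomial_index _ _ (by simp)]
    cases k with
    | zero =>
      rw [Finset.sum_eq_zero fun t _ => by
        rw [P.iterBracket_of_weight_ne t hx (by omega), smul_zero]]
      rfl
    | succ k =>
      rw [Finset.sum_eq_single_of_mem k (Finset.mem_range.2 hk) fun t _ ht => by
        rw [P.iterBracket_of_weight_ne t hx (by omega), smul_zero]]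
      rfl
  | zero => simp
  | add a b _ _ ha hb => simp only [map_add, ha, hb, smul_add, Finset.sum_add_distrib]
  | smul c a _ ha => simp only [map_smul, ha, Finset.smul_sum, smul_comm c]

/-- The bracket `[A_s, A_t]` of the maps `A_t = iterBracket t`. -/
def iterPair (s t : ℕ) : P.JSym →ₗ[ℂ] H :=
  gradedBracket P.target 1 (P.iterBracket s) (P.iterBracket t)

/-- Both entries are odd, so graded skew-symmetry is symmetry. -/
theorem iterPair_comm (s t : ℕ) : P.iterPair s t = P.iterPair t s := by
  have := gradedBracket_skew (P.hasDegree_iterBracket s) (P.hasDegree_iterBracket t)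
  simpa [iterPair] using this

/-- Bracketing with the even map `projH` is a derivation by the Jacobi identity, and it raises the
index of A_s or of A_t by one. -/
theorem convBracket_iterPair (s t : ℕ) : convBracket P.target (P.iterPair s t) P.projH =
    P.iterPair (s + 1) t + P.iterPair s (t + 1) := by
  have := gradedBracket_jacobi (w := 0) (h := P.projH) (P.hasDegree_iterBracket s)
    (P.hasDegree_iterBracket t)
  simp only [gradedBracket_zero_left, ← iterBracket_succ, add_zero] at this
  rw [iterPair_comm P (s + 1) t, iterPair, iterPair, iterPair, this]
  simp

theorem iterPair_of_weight_ne (s t : ℕ) {k n x} (hx : IsMonomial P.shiftGr k n x)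
    (hk : k ≠ s + t + 2) : P.iterPair s t x = 0 := by
  refine convBracket_eq_zero hx fun k₁ k₂ n₁ n₂ a b h ha hb => ?_
  by_cases h2 : k₂ = t + 1
  · refine .inl ?_
    rw [LinearMap.comp_apply, sgnPow_monomial _ _ ha, map_smul,
      P.iterBracket_of_weight_ne s ha (by omega), smul_zero]
  · exact .inr (P.iterBracket_of_weight_ne t hb h2)

/-- The quadratic part of `A_t ∘ D`, where `A_t = iterBracket t`. -/
def iterQuad : ℕ → P.JSym →ₗ[ℂ] H
  | 0 => (1 / 2 : ℂ) • P.iterPair 0 0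
  | t + 1 => convBracket P.target (iterQuad t) P.projH +
      gradedBracket P.target 1 (P.iterBracket t) P.bernoulliPart

/-- For t = 0 this is the structure equation of `projG` pushed along `i`. In the induction D acts on
either entry of [A_t, `projH`]; the d-terms assemble to -d A_{t+1}, and the non-linear part of
`projH` ∘ D contributes the bracket of A_t with `bernoulliPart`. -/
theorem iterBracket_jacobiD (t : ℕ) :
    P.iterBracket t ∘ₗ P.jacobiD = -(P.target.d ∘ₗ P.iterBracket t) + P.iterQuad t := by
  induction t with
  | zero =>
    have h1 : P.i ∘ₗ gradedBracket P.source 1 P.projG P.projG =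
        gradedBracket P.target 1 (P.iterBracket 0) (P.iterBracket 0) := by
      ext x
      simp only [gradedBracket, convBracket, iterBracket, LinearMap.comp_apply]
      generalize comul P.shiftGr x = t
      induction t with
      | zero => simp
      | add a b ha hb => simp only [map_add, ha, hb]
      | tmul a b => simp [P.i_bracket]
    have h2 : P.i ∘ₗ P.source.d = P.target.d ∘ₗ P.i := LinearMap.ext P.i_d
    rw [iterQuad, iterPair, ← h1, iterBracket, LinearMap.comp_assoc, projG_jacobiD,
      LinearMap.comp_add, LinearMap.comp_neg, LinearMap.comp_smul, ← LinearMap.comp_assoc, h2,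
      LinearMap.comp_assoc]
  | succ t ih =>
    have e4 : parity P.target.gr ∘ₗ P.iterBracket t =
        -(P.iterBracket t ∘ₗ (sgn P.shiftGr).toLinearMap) := by
      rw [(P.hasDegree_iterBracket t).parity_comp, zpow_one]; simp
    rw [iterQuad, iterBracket_succ, jacobiD, convBracket_comp_coder P.corestriction_mem, ← jacobiD,
      ih, projH_jacobiD, d_comp_convBracket, e4, gradedBracket, sgnPow_one]
    simp only [convBracket_add_left, convBracket_add_right, convBracket_neg_left]
    module

/-- The linear map which sends the monomial `X^s Y^t` to the bracket of `A_s` and `A_t`. -/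
def pairEval : MvPolynomial (Fin 2) ℂ →ₗ[ℂ] P.JSym →ₗ[ℂ] H :=
  (MvPolynomial.basisMonomials (Fin 2) ℂ).constr ℂ fun m => P.iterPair (m 0) (m 1)

theorem pairEval_monomial (m : Fin 2 →₀ ℕ) :
    P.pairEval (MvPolynomial.monomial m 1) = P.iterPair (m 0) (m 1) := by
  have := (MvPolynomial.basisMonomials (Fin 2) ℂ).constr_basis ℂ
    (fun m => P.iterPair (m 0) (m 1)) m
  rwa [MvPolynomial.coe_basisMonomials] at this

theorem pairEval_X_pow_mul (s t : ℕ) :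
    P.pairEval (MvPolynomial.X 0 ^ s * MvPolynomial.X 1 ^ t) = P.iterPair s t := by
  have : (MvPolynomial.X 0 ^ s * MvPolynomial.X 1 ^ t : MvPolynomial (Fin 2) ℂ) =
      MvPolynomial.monomial (Finsupp.single 0 s + Finsupp.single 1 t) 1 := by
    rw [MvPolynomial.X_pow_eq_monomial, MvPolynomial.X_pow_eq_monomial, MvPolynomial.monomial_mul,
      mul_one]
  rw [this, pairEval_monomial]
  simp

theorem pairEval_induction {f g : MvPolynomial (Fin 2) ℂ →ₗ[ℂ] P.JSym →ₗ[ℂ] H}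
    (h : ∀ s t : ℕ, f (MvPolynomial.X 0 ^ s * MvPolynomial.X 1 ^ t) =
      g (MvPolynomial.X 0 ^ s * MvPolynomial.X 1 ^ t)) : f = g := by
  refine (MvPolynomial.basisMonomials (Fin 2) ℂ).ext fun m => ?_
  have : (MvPolynomial.X 0 ^ m 0 * MvPolynomial.X 1 ^ m 1 : MvPolynomial (Fin 2) ℂ) =
      MvPolynomial.monomial m 1 := by
    rw [MvPolynomial.monomial_eq, Finsupp.prod_fintype _ _ (by simp), Fin.prod_univ_two]
    simp
  rw [MvPolynomial.coe_basisMonomials]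
  beta_reduce
  rw [← this]
  exact h _ _

/-- In the encoding of [A_s, A_t] by monomials, the derivation rule `convBracket_iterPair` is
multiplication by the sum of the two variables. -/
theorem pairEval_add_mul (p : MvPolynomial (Fin 2) ℂ) :
    P.pairEval ((MvPolynomial.X 0 + MvPolynomial.X 1) * p) =
      convBracket P.target (P.pairEval p) P.projH := by
  let c : (P.JSym →ₗ[ℂ] H) →ₗ[ℂ] P.JSym →ₗ[ℂ] H :=
    { toFun := fun f => convBracket P.target f P.projH
      map_add' := fun f g => convBracket_add_left f g _
      map_smul' := fun r f => convBracket_smul_left r f _ }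
  have : P.pairEval ∘ₗ LinearMap.mulLeft ℂ (MvPolynomial.X 0 + MvPolynomial.X 1) =
      c ∘ₗ P.pairEval := by
    refine P.pairEval_induction fun s t => ?_
    simp only [LinearMap.comp_apply, LinearMap.mulLeft_apply, pairEval_X_pow_mul, c,
      LinearMap.coe_mk, AddHom.coe_mk, convBracket_iterPair]
    rw [← pairEval_X_pow_mul, ← pairEval_X_pow_mul, ← map_add]
    congr 1
    ring
  exact LinearMap.congr_fun this p

/-- Symmetry of [A_s, A_t]: only the symmetric part of a polynomial is seen by `pairEval`. -/
theorem pairEval_swap (p : MvPolynomial (Fin 2) ℂ) :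
    P.pairEval (MvPolynomial.rename (Equiv.swap 0 1) p) = P.pairEval p := by
  have : P.pairEval ∘ₗ (MvPolynomial.rename (Equiv.swap (0 : Fin 2) 1)).toLinearMap =
      P.pairEval := by
    refine P.pairEval_induction fun s t => ?_
    simp only [LinearMap.comp_apply, AlgHom.toLinearMap_apply, map_mul, map_pow,
      MvPolynomial.rename_X, Equiv.swap_apply_left, Equiv.swap_apply_right]
    rw [mul_comm, pairEval_X_pow_mul, pairEval_X_pow_mul, iterPair_comm]
  exact LinearMap.congr_fun this p

end DGLiePair
end

/-! ### Generating series, and the vanishing of the component in 𝔥 -/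

noncomputable section

namespace DGLiePair

open KoszulSym PowerSeries

variable {G H : Type*} [AddCommGroup G] [Module ℂ G] [AddCommGroup H] [Module ℂ H]
  (P : DGLiePair G H)

/-- The generating series of the polynomials representing `iterQuad t`, graded by weight. -/
def iterQuadSeries : ℕ → PowerSeries (MvPolynomial (Fin 2) ℂ)
  | 0 => C (MvPolynomial.C (1 / 2)) * X ^ 2
  | t + 1 => C (MvPolynomial.X 0 + MvPolynomial.X 1) * X * iterQuadSeries t +
      X ^ 2 * (C (MvPolynomial.X 0) * X) ^ t *
        rescale (MvPolynomial.X 1) (bernoulliPowerSeries (MvPolynomial (Fin 2) ℂ))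

theorem coeff_bernoulliPowerSeries (s : ℕ) :
    coeff s (bernoulliPowerSeries (MvPolynomial (Fin 2) ℂ)) =
      MvPolynomial.C (bernoulliCoeff s) := by
  rw [bernoulliPowerSeries, coeff_mk, IsScalarTower.algebraMap_apply ℚ ℂ, bernoulliCoeff]
  rfl

theorem gradedBracket_bernoulliPart (t : ℕ) {k n x} (hx : IsMonomial P.shiftGr k n x) :
    gradedBracket P.target 1 (P.iterBracket t) P.bernoulliPart x =
      ∑ s ∈ Finset.range k, bernoulliCoeff s • P.iterPair t s x := by
  have h1 : gradedBracket P.target 1 (P.iterBracket t) P.bernoulliPart x =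
      gradedBracket P.target 1 (P.iterBracket t)
        (∑ s ∈ Finset.range k, bernoulliCoeff s • P.iterBracket s) x := by
    refine convBracket_congr hx fun k₁ k₂ n₁ n₂ a b h ha hb => ?_
    rw [P.bernoulliPart_of_mem_filt (Submodule.subset_span ⟨k₂, (by omega : k₂ ≤ k), hb⟩)]
    simp
  rw [h1]
  generalize Finset.range k = S
  induction S using Finset.induction_on with
  | empty => simp [gradedBracket, convBracket]
  | insert s S hs ih =>
    rw [Finset.sum_insert hs, Finset.sum_insert hs, gradedBracket, convBracket_add_right,
      convBracket_smul_right, LinearMap.add_apply]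
    rw [gradedBracket] at ih
    rw [ih]
    rfl

/-- The two recursions match term by term. Bracketing with `projH` uses up one factor of weight. In
the expansion of `bernoulliPart` only s = k - t - 2 survives, since [A_t, A_s] lives in weight s + t
+ 2. -/
theorem iterQuad_apply (t : ℕ) {k n x} (hx : IsMonomial P.shiftGr k n x) :
    P.iterQuad t x = P.pairEval (coeff k (iterQuadSeries t)) x := by
  induction t generalizing k n x with
  | zero =>
    rw [iterQuad, iterQuadSeries, coeff_C_mul, coeff_X_pow]
    split_ifs with hk
    · have := P.pairEval_X_pow_mul 0 0
      rw [pow_zero, pow_zero, mul_one] at this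
      rw [← MvPolynomial.smul_eq_C_mul, map_smul, this]
    · rw [mul_zero, map_zero, LinearMap.smul_apply, P.iterPair_of_weight_ne 0 0 hx (by omega)]
      simp
  | succ t ih =>
    rw [iterQuad, iterQuadSeries, map_add, map_add, LinearMap.add_apply, LinearMap.add_apply]
    congr 1
    · cases k with
      | zero =>
        rw [mul_assoc, mul_comm X, ← mul_assoc, coeff_zero_mul_X, map_zero]
        refine convBracket_eq_zero hx fun k₁ k₂ n₁ n₂ a b h ha hb => ?_
        exact .inr (P.projH_of_weight_ne hb (by omega))
      | succ k =>
        rw [mul_assoc, coeff_C_mul, coeff_succ_X_mul, pairEval_add_mul]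
        refine convBracket_congr hx fun k₁ k₂ n₁ n₂ a b h ha hb => ?_
        by_cases h2 : k₂ = 1
        · obtain rfl : k₁ = k := by omega
          rw [ih ha]
        · rw [P.projH_of_weight_ne hb h2, map_zero, map_zero]
    · rw [P.gradedBracket_bernoulliPart t hx, mul_pow, mul_comm (C _ ^ t), ← mul_assoc, ← pow_add,
        mul_assoc, coeff_X_pow_mul', ← map_pow, coeff_C_mul, coeff_rescale,
        coeff_bernoulliPowerSeries]
      split_ifs with h
      · rw [mul_comm _ (MvPolynomial.C _), mul_left_comm, ← MvPolynomial.smul_eq_C_mul, map_smul,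
          pairEval_X_pow_mul]
        refine Finset.sum_eq_single_of_mem _ (Finset.mem_range.2 (by omega)) fun s _ hs => ?_
        rw [P.iterPair_of_weight_ne t s hx (by omega), smul_zero]
      · rw [map_zero]
        refine Finset.sum_eq_zero fun s _ => ?_
        rw [P.iterPair_of_weight_ne t s hx (by omega), smul_zero]

/-- Solving the recursion gives a geometric sum in x + y and x. Multiplying by y = (x + y) - x
telescopes it into a difference of powers, so no division is needed. -/
theorem X_mul_iterQuadSeries (t : ℕ) :
    C (MvPolynomial.X 1) * X * iterQuadSeries t = X ^ 2 * (C (MvPolynomial.C (1 / 2)) *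
      (C (MvPolynomial.X 1) * X) * (C (MvPolynomial.X 0 + MvPolynomial.X 1) * X) ^ t +
      rescale (MvPolynomial.X 1) (bernoulliPowerSeries (MvPolynomial (Fin 2) ℂ)) *
        ((C (MvPolynomial.X 0 + MvPolynomial.X 1) * X) ^ t -
          (C (MvPolynomial.X 0) * X) ^ t)) := by
  induction t with
  | zero => rw [iterQuadSeries]; ring
  | succ t ih =>
    have h1 : C (MvPolynomial.X 1) * X * iterQuadSeries (t + 1) =
      C (MvPolynomial.X 0 + MvPolynomial.X 1) * X * (C (MvPolynomial.X 1) * X * iterQuadSeries t) +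
        C (MvPolynomial.X 1) * X * (X ^ 2 * (C (MvPolynomial.X 0) * X) ^ t *
        rescale (MvPolynomial.X 1) (bernoulliPowerSeries (MvPolynomial (Fin 2) ℂ))) := by
      rw [iterQuadSeries]; ring
    rw [h1, ih, map_add]
    ring

theorem X_pow_dvd_sub (a : MvPolynomial (Fin 2) ℂ) (k : ℕ) :
    X ^ k ∣ rescale a (bernoulliPowerSeries (MvPolynomial (Fin 2) ℂ)) -
      ∑ t ∈ Finset.range k, C (MvPolynomial.C (bernoulliCoeff t)) * (C a * X) ^ t := by
  rw [X_pow_dvd_iff]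
  intro m hm
  rw [map_sub, map_sum, coeff_rescale, coeff_bernoulliPowerSeries,
    Finset.sum_eq_single_of_mem m (Finset.mem_range.2 hm)]
  · rw [mul_pow, coeff_C_mul, ← map_pow, coeff_C_mul, coeff_X_pow_self]
    ring
  · intro t _ ht
    rw [mul_pow, coeff_C_mul, ← map_pow, coeff_C_mul, coeff_X_pow, if_neg ht.symm]
    ring

/-- Write F(a) for the Bernoulli series at aX and p for the sum. Modulo X^(k+1) the closed form
reads x y p = ½ xX yX F(x+y) + xX F(y) (F(x+y) - F(x)). Adding the image under exchange of x and y
gives the left side of `rescale_bernoulliPowerSeries_add`, which is zero; then x y is cancelled. -/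
theorem sum_iterQuadSeries_symm (k : ℕ) :
    coeff k (∑ t ∈ Finset.range k, C (MvPolynomial.C (bernoulliCoeff t)) * iterQuadSeries t) +
    MvPolynomial.rename (Equiv.swap 0 1) (coeff k
      (∑ t ∈ Finset.range k, C (MvPolynomial.C (bernoulliCoeff t)) * iterQuadSeries t)) = 0 := by
  set x : MvPolynomial (Fin 2) ℂ := MvPolynomial.X 0 with hx
  set y : MvPolynomial (Fin 2) ℂ := MvPolynomial.X 1 with hy
  set p := ∑ t ∈ Finset.range k, C (MvPolynomial.C (bernoulliCoeff t)) * iterQuadSeries t with hp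
  set σ := (MvPolynomial.rename (R := ℂ) (Equiv.swap (0 : Fin 2) 1)).toRingHom with hσ
  have hσx : σ x = y := by simp [hσ, hx, hy]
  have hσy : σ y = x := by simp [hσ, hx, hy]
  have hσC : ∀ c, σ (MvPolynomial.C c) = MvPolynomial.C c := by intro c; simp [hσ]
  let F : MvPolynomial (Fin 2) ℂ → PowerSeries (MvPolynomial (Fin 2) ℂ) := fun a =>
    rescale a (bernoulliPowerSeries (MvPolynomial (Fin 2) ℂ))
  have hσF : ∀ a, PowerSeries.map σ (F a) = F (σ a) := by
    intro a
    ext1 j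
    simp only [F, coeff_map, coeff_rescale, map_mul, map_pow, coeff_bernoulliPowerSeries, hσC]
  have h1 : C y * X * p = X ^ 2 * (C (MvPolynomial.C (1 / 2)) * (C y * X) *
      (∑ t ∈ Finset.range k, C (MvPolynomial.C (bernoulliCoeff t)) * (C (x + y) * X) ^ t) +
      F y * ((∑ t ∈ Finset.range k, C (MvPolynomial.C (bernoulliCoeff t)) * (C (x + y) * X) ^ t) -
       (∑ t ∈ Finset.range k, C (MvPolynomial.C (bernoulliCoeff t)) * (C x * X) ^ t))) := by
    rw [hp, Finset.mul_sum, ← Finset.sum_sub_distrib, Finset.mul_sum, Finset.mul_sum,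
      ← Finset.sum_add_distrib, Finset.mul_sum]
    refine Finset.sum_congr rfl fun t _ => ?_
    rw [mul_left_comm, X_mul_iterQuadSeries]
    ring
  obtain ⟨r, hr⟩ := X_pow_dvd_sub (x + y) k
  obtain ⟨r', hr'⟩ := X_pow_dvd_sub x k
  set S := ∑ t ∈ Finset.range k, C (MvPolynomial.C (bernoulliCoeff t)) * (C (x + y) * X) ^ t
  set S' := ∑ t ∈ Finset.range k, C (MvPolynomial.C (bernoulliCoeff t)) * (C x * X) ^ t
  -- the weight `k` part of `p`, multiplied by `x y`
  have h2 : ∃ r'', C x * C y * p = C (MvPolynomial.C (1 / 2)) * (C x * X * (C y * X)) * F (x + y) +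
      C x * X * F y * (F (x + y) - F x) + X ^ (k + 1) * r'' := by
    have h3 : S = F (x + y) - X ^ k * r := by rw [← hr]; simp [F]
    have h4 : S' = F x - X ^ k * r' := by rw [← hr']; simp [F]
    -- Replacing the truncated sums by the full series costs multiples of X^k. The prefactor X²,
    -- after cancelling one X, raises this to X^(k+1), just beyond the coefficient of interest.
    have h5 : X * (C x * C y * p) = X * (C (MvPolynomial.C (1 / 2)) * (C x * X * (C y * X)) *
        F (x + y) + C x * X * F y * (F (x + y) - F x) + X ^ (k + 1) *
        (- C x * C (MvPolynomial.C (1 / 2)) * (C y * X) * r - C x * F y * (r - r'))) := by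
      rw [h3, h4] at h1
      linear_combination C x * h1
    exact ⟨_, X_mul_cancel h5⟩
  obtain ⟨r'', h2⟩ := h2
  have h6 := congrArg (PowerSeries.map σ) h2
  simp only [map_mul, map_add, map_sub, map_pow, PowerSeries.map_C, PowerSeries.map_X, hσF, hσC, hσx,
    hσy] at h6
  have h7 : C x * C y * (p + PowerSeries.map σ p) = X ^ (k + 1) *
      (r'' + PowerSeries.map σ r'') := by
    have h8 := rescale_bernoulliPowerSeries_add x y
    have h9 : C (MvPolynomial.C (1 / 2)) + C (MvPolynomial.C (1 / 2)) =
        (1 : PowerSeries (MvPolynomial (Fin 2) ℂ)) := by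
      rw [← map_add, ← map_add]; norm_num
    have h10 : y + x = x + y := add_comm y x
    rw [h10] at h6
    linear_combination h2 + h6 + h8 + (C x * X * (C y * X)) * F (x + y) * h9
  have h11 := congrArg (coeff k) h7
  rw [mul_assoc, coeff_C_mul, coeff_C_mul, coeff_X_pow_mul', if_neg (by omega), map_add,
    coeff_map] at h11
  have h12 := (mul_eq_zero.1 h11).resolve_left (MvPolynomial.X_ne_zero 0)
  exact (mul_eq_zero.1 h12).resolve_left (MvPolynomial.X_ne_zero 1)

/-- The polynomial representing the sum is antisymmetric under exchange of the variables, while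
`pairEval` is symmetric, so its value is its own negative. -/
theorem sum_iterQuad {k n x} (hx : IsMonomial P.shiftGr k n x) :
    ∑ t ∈ Finset.range k, bernoulliCoeff t • P.iterQuad t x = 0 := by
  set p := coeff k (∑ t ∈ Finset.range k, C (MvPolynomial.C (bernoulliCoeff t)) * iterQuadSeries t)
    with hp
  have h1 : ∑ t ∈ Finset.range k, bernoulliCoeff t • P.iterQuad t x = P.pairEval p x := by
    rw [hp, map_sum, map_sum, LinearMap.sum_apply]
    refine Finset.sum_congr rfl fun t _ => ?_
    rw [coeff_C_mul, ← MvPolynomial.smul_eq_C_mul, map_smul, LinearMap.smul_apply,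
      ← P.iterQuad_apply t hx]
  have h2 := congrArg P.pairEval (sum_iterQuadSeries_symm k)
  rw [map_add, pairEval_swap, map_zero, ← hp, ← two_smul ℂ, smul_eq_zero] at h2
  rw [h1, h2.resolve_left (by norm_num), LinearMap.zero_apply]

theorem jacobiD_monomial_mem {k n x} (hx : IsMonomial P.shiftGr k n x) :
    P.jacobiD x ∈ filt P.shiftGr k (n + 1) :=
  coder_mem_filt P.shiftGr (u := 1) (fun k n x hx => P.corestriction_mem n x
    (Submodule.subset_span ⟨k, hx⟩)) P.corestriction_one (Submodule.subset_span ⟨k, le_rfl, hx⟩)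

theorem target_closed : P.projH ∘ₗ P.jacobiD ∘ₗ P.jacobiD = 0 := by
  refine ext_monomial P.shiftGr fun k n x hx => ?_
  have h1 : ∀ y, P.projH (P.jacobiD y) = P.target.d (P.projH y) + P.bernoulliPart y :=
    fun y => LinearMap.congr_fun P.projH_jacobiD y
  have h2 : ∀ t y, P.iterBracket t (P.jacobiD y) =
      -P.target.d (P.iterBracket t y) + P.iterQuad t y :=
    fun t y => LinearMap.congr_fun (P.iterBracket_jacobiD t) y
  simp only [LinearMap.comp_apply, LinearMap.zero_apply]
  -- D does not raise the weight, so the Bernoulli sums for x and for D x can be truncated at the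
  -- same k. The terms in d then cancel, leaving the sum of `sum_iterQuad`.
  rw [h1, P.bernoulliPart_of_mem_filt (P.jacobiD_monomial_mem hx), h1,
    P.bernoulliPart_of_mem_filt (Submodule.subset_span ⟨k, le_rfl, hx⟩)]
  simp only [h2, smul_add, Finset.sum_add_distrib, P.sum_iterQuad hx, map_add, P.target.d_d,
    map_sum, map_smul, smul_neg, Finset.sum_neg_distrib]
  abel

/-- The Jacobi-Bernoulli differential squares to zero. -/
theorem jacobiD_jacobiD (x : P.JSym) : P.jacobiD (P.jacobiD x) = 0 := by
  refine coder_coder P.shiftGr P.corestriction_mem (fun x => ?_) x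
  rw [← jacobiD, ← proj_coder P.shiftGr, ← jacobiD]
  exact Prod.ext (LinearMap.congr_fun P.source_closed x) (LinearMap.congr_fun P.target_closed x)

end DGLiePair
end

noncomputable section

/-! ### Partial inverses and polynomials in an endomorphism -/

section LinearAlgebra

theorem LinearMap.exists_comp_eq_of_ker_le {K U V W : Type*} [Field K] [AddCommGroup U] [Module K U]
    [AddCommGroup V] [Module K V] [AddCommGroup W] [Module K W] (f : U →ₗ[K] V) (g : U →ₗ[K] W)
    (h : LinearMap.ker f ≤ LinearMap.ker g) : ∃ k : V →ₗ[K] W, ∀ u, k (f u) = g u := by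
  obtain ⟨k, hk⟩ := LinearMap.exists_extend
    (((LinearMap.ker f).liftQ g h) ∘ₗ f.quotKerEquivRange.symm.toLinearMap)
  refine ⟨k, fun u => ?_⟩
  have := LinearMap.congr_fun hk ⟨f u, u, rfl⟩
  simp only [LinearMap.comp_apply, Submodule.subtype_apply, LinearEquiv.coe_coe] at this
  rw [this]
  have h2 : f.quotKerEquivRange.symm ⟨f u, u, rfl⟩ = Submodule.Quotient.mk u := by
    rw [LinearEquiv.symm_apply_eq]
    rfl
  rw [h2]
  rfl

theorem Submodule.exists_projection {K V : Type*} [Field K] [AddCommGroup V] [Module K V]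
    (B : Submodule K V) : ∃ π : V →ₗ[K] V, (∀ v, π v ∈ B) ∧ ∀ b ∈ B, π b = b := by
  obtain ⟨r, hr⟩ := B.subtype.exists_leftInverse_of_injective B.ker_subtype
  refine ⟨B.subtype ∘ₗ r, fun v => (r v).2, fun b hb => ?_⟩
  have := LinearMap.congr_fun hr ⟨b, hb⟩
  simp only [LinearMap.comp_apply, Submodule.subtype_apply, LinearMap.id_apply] at this
  simp [this]

theorem Polynomial.aeval_end_mem {K V : Type*} [Field K] [AddCommGroup V] [Module K V]
    {E : Module.End K V} {W : Submodule K V} (h : ∀ v ∈ W, E v ∈ W) (R : Polynomial K) {v : V}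
    (hv : v ∈ W) : Polynomial.aeval E R v ∈ W := by
  induction R using Polynomial.induction_on' with
  | add p r hp hr => rw [map_add]; exact add_mem hp hr
  | monomial n c =>
    rw [Polynomial.aeval_monomial, Module.End.mul_apply, Module.algebraMap_end_apply]
    refine W.smul_mem c ?_
    induction n with
    | zero => simpa using hv
    | succ n ih => rw [pow_succ', Module.End.mul_apply]; exact h _ ih

theorem Polynomial.aeval_end_intertwine {K U V : Type*} [Field K] [AddCommGroup U] [Module K U]
    [AddCommGroup V] [Module K V] {A : Module.End K U} {B : Module.End K V} {f : U →ₗ[K] V}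
    (h : ∀ u, f (A u) = B (f u)) (R : Polynomial K) (u : U) :
    f (Polynomial.aeval A R u) = Polynomial.aeval B R (f u) := by
  induction R using Polynomial.induction_on' with
  | add p r hp hr => simp only [map_add, LinearMap.add_apply, hp, hr]
  | monomial n c =>
    simp only [Polynomial.aeval_monomial, Module.End.mul_apply, Module.algebraMap_end_apply, map_smul]
    congr 1
    induction n with
    | zero => simp
    | succ n ih => simp only [pow_succ', Module.End.mul_apply, h, ih]

end LinearAlgebra

namespace KoszulSym

/-! ### Monomials in eigenvectors of a projection -/

section EigenMonomials

variable {V : Type*} [AddCommGroup V] [Module ℂ V] (gr : ℤ → Submodule ℂ V)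

/-- `IsEigenMonomial gr E k j n x`: `x` is a product of `k` homogeneous vectors of total degree
`n`, of which `j` are fixed by `E` and the others are killed by `E`. -/
inductive IsEigenMonomial (E : V →ₗ[ℂ] V) : ℕ → ℕ → ℤ → Sym gr → Prop
  | one : IsEigenMonomial E 0 0 0 1
  | killed {k j : ℕ} {p n : ℤ} {v : V} {x : Sym gr} (hv : v ∈ gr p) (hE : E v = 0)
      (hx : IsEigenMonomial E k j n x) : IsEigenMonomial E (k + 1) j (p + n) (ι gr v * x)
  | fixed {k j : ℕ} {p n : ℤ} {v : V} {x : Sym gr} (hv : v ∈ gr p) (hE : E v = v)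
      (hx : IsEigenMonomial E k j n x) : IsEigenMonomial E (k + 1) (j + 1) (p + n) (ι gr v * x)

variable {gr} {E : V →ₗ[ℂ] V}

theorem IsEigenMonomial.isMonomial {k j n x} (hx : IsEigenMonomial gr E k j n x) :
    IsMonomial gr k n x := by
  induction hx with
  | one => exact .one
  | killed hv _ _ ih => exact .cons hv ih
  | fixed hv _ _ ih => exact .cons hv ih

theorem IsEigenMonomial.le {k j n x} (hx : IsEigenMonomial gr E k j n x) : j ≤ k := by
  induction hx <;> omega

/-- Negative total degree forces a factor of negative degree; it is both fixed and killed by E,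
hence zero. -/
theorem IsEigenMonomial.eq_zero (hE : ∀ p < 0, ∀ v ∈ gr p, E v = v) {k n x}
    (hx : IsEigenMonomial gr E k 0 n x) (hn : n < 0) : x = 0 := by
  generalize hj : 0 = j at hx
  induction hx with
  | one => omega
  | @killed k j p n v x hv hv0 hx ih =>
    by_cases hp : p < 0
    · rw [hE p hp v hv] at hv0; rw [hv0, map_zero, zero_mul]
    · rw [ih (by omega) hj, mul_zero]
  | fixed => omega

theorem IsMonomial.mem_span_eigen (hE : ∀ p, ∀ v ∈ gr p, E v ∈ gr p)
    (hEE : ∀ p, ∀ v ∈ gr p, E (E v) = E v) {k n x} (hx : IsMonomial gr k n x) :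
    x ∈ Submodule.span ℂ {x | ∃ j, IsEigenMonomial gr E k j n x} := by
  induction hx with
  | one => exact Submodule.subset_span ⟨0, .one⟩
  | @cons k p n v x hv hx ih =>
    clear hx
    induction ih using Submodule.span_induction with
    | mem x hx =>
      obtain ⟨j, hx⟩ := hx
      have : ι gr v * x = ι gr (E v) * x + ι gr (v - E v) * x := by
        rw [← add_mul, ← map_add, add_sub_cancel]
      rw [this]
      exact add_mem (Submodule.subset_span ⟨_, .fixed (hE p v hv) (hEE p v hv) hx⟩)
        (Submodule.subset_span ⟨_, .killed (sub_mem hv (hE p v hv))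
          (by rw [map_sub, hEE p v hv, sub_self]) hx⟩)
    | zero => simp
    | add a b _ _ ha hb => rw [mul_add]; exact add_mem ha hb
    | smul c a _ ha => rw [mul_smul_comm]; exact Submodule.smul_mem _ _ ha

theorem exists_mem_filt {n : ℤ} {x : Sym gr} (hx : x ∈ deg gr n) : ∃ N, x ∈ filt gr N n := by
  induction hx using Submodule.span_induction with
  | mem x hx => obtain ⟨k, hx⟩ := hx; exact ⟨k, Submodule.subset_span ⟨k, le_rfl, hx⟩⟩
  | zero => exact ⟨0, zero_mem _⟩
  | add a b _ _ ha hb =>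
    obtain ⟨M, ha⟩ := ha
    obtain ⟨N, hb⟩ := hb
    exact ⟨max M N, add_mem (filt_mono gr (le_max_left M N) n ha)
      (filt_mono gr (le_max_right M N) n hb)⟩
  | smul c a _ ha => obtain ⟨N, ha⟩ := ha; exact ⟨N, Submodule.smul_mem _ _ ha⟩

theorem IsMonomial.degree_eq_zero {n : ℤ} {x : Sym gr} (hx : IsMonomial gr 0 n x) : n = 0 := by
  cases hx
  rfl

end EigenMonomials

/-! ### Contracting homotopies and their extension to Sym V -/

section Homotopy

variable {V : Type*} [AddCommGroup V] [Module ℂ V] (gr : ℤ → Submodule ℂ V)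
  [DirectSum.Decomposition gr]

theorem exists_linearMap_of_homogeneous {W : Type*} [AddCommGroup W] [Module ℂ W]
    (s : ℤ → V →ₗ[ℂ] W) : ∃ t : V →ₗ[ℂ] W, ∀ p, ∀ v ∈ gr p, t v = s p v := by
  refine ⟨(DirectSum.toModule ℂ ℤ W fun p => s p ∘ₗ (gr p).subtype) ∘ₗ
    (DirectSum.decomposeLinearEquiv gr).toLinearMap, fun p v hv => ?_⟩
  simp only [LinearMap.comp_apply, LinearEquiv.coe_coe, DirectSum.decomposeLinearEquiv_apply,
    DirectSum.decompose_of_mem gr hv]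
  erw [DirectSum.toModule_lof]
  rfl

/-- A contracting homotopy for a complex which is acyclic in negative degrees. -/
theorem exists_homotopy {d : V →ₗ[ℂ] V} (hd : ∀ p, ∀ v ∈ gr p, d v ∈ gr (p + 1))
    (hdd : ∀ v, d (d v) = 0)
    (hacyclic : ∀ p < 0, ∀ v ∈ gr p, d v = 0 → ∃ u ∈ gr (p - 1), d u = v) :
    ∃ s : V →ₗ[ℂ] V, (∀ p, ∀ v ∈ gr p, s v ∈ gr (p - 1)) ∧
      (∀ p, ∀ v ∈ gr p, (d ∘ₗ s + s ∘ₗ d) ((d ∘ₗ s + s ∘ₗ d) v) = (d ∘ₗ s + s ∘ₗ d) v) ∧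
      ∀ p < 0, ∀ v ∈ gr p, (d ∘ₗ s + s ∘ₗ d) v = v := by
  choose π hπ hπ' using fun p => ((gr (p - 1)).map d).exists_projection
  have hB : ∀ p, ∀ v, π p v ∈ gr p := by
    intro p v
    obtain ⟨u, hu, h⟩ := hπ p v
    rw [← h]
    simpa using hd _ u hu
  have hdπ : ∀ p v, d (π p v) = 0 := by
    intro p v
    obtain ⟨u, hu, h⟩ := hπ p v
    rw [← h, hdd]
  have hσ : ∀ p : ℤ, ∃ σ : V →ₗ[ℂ] V, p < 0 → ∀ v ∈ gr p, σ (d v) = v - π p v := by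
    intro p
    by_cases hp : p < 0
    · obtain ⟨σ, h⟩ := LinearMap.exists_comp_eq_of_ker_le (d ∘ₗ (gr p).subtype)
        ((LinearMap.id - π p) ∘ₗ (gr p).subtype) (by
          rintro ⟨v, hv⟩ h
          obtain ⟨u, hu, rfl⟩ := hacyclic p hp v hv h
          simp [hπ' p (d u) ⟨u, hu, rfl⟩])
      exact ⟨σ, fun _ v hv => h ⟨v, hv⟩⟩
    · exact ⟨0, fun h => absurd h hp⟩
  choose σ hσ using hσ
  -- In degrees p ≤ 0, s projects to the coboundaries and inverts d there; above it is cut off,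
  -- acyclicity being known only in negative degrees. Hence ds + sd is 1 in negative degrees, the
  -- projection to coboundaries in degree 0, and 0 above: idempotent everywhere.
  obtain ⟨s, hs⟩ := exists_linearMap_of_homogeneous gr
    fun p => if p ≤ 0 then σ (p - 1) ∘ₗ π p else 0
  have hds : ∀ p ≤ 0, ∀ v ∈ gr p, s v ∈ gr (p - 1) ∧ d (s v) = π p v := by
    intro p hp v hv
    rw [hs p v hv, if_pos hp, LinearMap.comp_apply]
    obtain ⟨u, hu, h⟩ := hπ p v
    rw [← h, hσ _ (by omega) u hu, map_sub, hdπ, sub_zero]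
    exact ⟨sub_mem hu (hB _ _), rfl⟩
  have hE0 : ∀ p < 0, ∀ v ∈ gr p, (d ∘ₗ s + s ∘ₗ d) v = v := by
    intro p hp v hv
    rw [LinearMap.add_apply, LinearMap.comp_apply, LinearMap.comp_apply, (hds p hp.le v hv).2,
      hs (p + 1) (d v) (hd p v hv), if_pos (by omega), LinearMap.comp_apply,
      hπ' (p + 1) (d v) ⟨v, by simpa using hv, rfl⟩, add_sub_cancel_right, hσ p hp v hv]
    abel
  have hE1 : ∀ p, 0 < p → ∀ v ∈ gr p, s v = 0 := by
    intro p hp v hv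
    rw [hs p v hv, if_neg (by omega), LinearMap.zero_apply]
  refine ⟨s, fun p v hv => ?_, fun p v hv => ?_, hE0⟩
  · by_cases hp : p ≤ 0
    · exact (hds p hp v hv).1
    · rw [hE1 p (by omega) v hv]; exact zero_mem _
  · rcases lt_trichotomy p 0 with hp | rfl | hp
    · rw [hE0 p hp v hv, hE0 p hp v hv]
    · have h : ∀ v ∈ gr 0, (d ∘ₗ s + s ∘ₗ d) v = π 0 v := by
        intro v hv
        rw [LinearMap.add_apply, LinearMap.comp_apply, LinearMap.comp_apply, (hds 0 le_rfl v hv).2,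
          hE1 (0 + 1) (by omega) _ (hd 0 v hv), add_zero]
      rw [h v hv, h _ (hB 0 v), hπ' 0 _ (hπ 0 v)]
    · have h : (d ∘ₗ s + s ∘ₗ d) v = 0 := by
        rw [LinearMap.add_apply, LinearMap.comp_apply, LinearMap.comp_apply, hE1 p hp v hv,
          hE1 (p + 1) (by omega) _ (hd p v hv), map_zero, add_zero]
      rw [h, map_zero]

variable {gr} {E : V →ₗ[ℂ] V}

theorem parity_of_degree {ξ : V →ₗ[ℂ] V} {u : ℤ} (hu : Odd u) (hξ : ∀ p, ∀ v ∈ gr p, ξ v ∈ gr (p + u))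
    (v : V) : ξ (parity gr v) = (-1 : ℂ) • parity gr (ξ v) := by
  induction v using DirectSum.Decomposition.inductionOn gr with
  | zero => simp
  | @homogeneous p v =>
    rw [parity_of_mem gr v.2, parity_of_mem gr (hξ p v v.2), map_smul,
      zpow_add₀ (by norm_num), hu.neg_one_zpow]
    module
  | add v w hv hw => simp only [map_add, hv, hw, smul_add]

/-- The anticommutator of two odd derivations of `Sym V` acts on a product of eigenvectors of the
anticommutator on `V` by the sum of the eigenvalues. -/
theorem coder_anticomm_eigen {d s : V →ₗ[ℂ] V} (hd : ∀ p, ∀ v ∈ gr p, d v ∈ gr (p + 1))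
    (hs : ∀ p, ∀ v ∈ gr p, s v ∈ gr (p - 1)) {k j n x}
    (hx : IsEigenMonomial gr (d ∘ₗ s + s ∘ₗ d) k j n x) :
    coder gr (d ∘ₗ proj gr) (coder gr (s ∘ₗ proj gr) x) +
      coder gr (s ∘ₗ proj gr) (coder gr (d ∘ₗ proj gr) x) = (j : ℂ) • x := by
  have hd' := parity_of_degree (gr := gr) (by decide : Odd (1 : ℤ)) hd
  have hs' := parity_of_degree (gr := gr) (by decide : Odd (-1 : ℤ)) hs
  -- The anticommutator of two odd derivations is an even derivation, so it obeys the Leibniz rule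
  -- without signs.
  have key : ∀ {p : ℤ} {v : V} (x : Sym gr), v ∈ gr p →
      coder gr (d ∘ₗ proj gr) (coder gr (s ∘ₗ proj gr) (ι gr v * x)) +
      coder gr (s ∘ₗ proj gr) (coder gr (d ∘ₗ proj gr) (ι gr v * x)) =
      ι gr ((d ∘ₗ s + s ∘ₗ d) v) * x + ι gr v *
        (coder gr (d ∘ₗ proj gr) (coder gr (s ∘ₗ proj gr) x) +
      coder gr (s ∘ₗ proj gr) (coder gr (d ∘ₗ proj gr) x)) := by
    intro p v x hv
    simp only [coder_comp_proj_ι_mul gr hd' hv, coder_comp_proj_ι_mul gr hs' hv, map_add, map_smul,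
      coder_comp_proj_ι_mul gr hd' (hs p v hv), coder_comp_proj_ι_mul gr hs' (hd p v hv)]
    have h1 : ι gr ((d ∘ₗ s + s ∘ₗ d) v) = ι gr (d (s v)) + ι gr (s (d v)) := by
      rw [← map_add]; rfl
    rw [h1]
    rcases Int.even_or_odd p with hp | hp
    · have h2 : ¬ Even (p - 1) := Int.not_even_iff_odd.2 (hp.sub_odd odd_one)
      have h3 : ¬ Even (p + 1) := Int.not_even_iff_odd.2 (hp.add_odd odd_one)
      simp only [hp, h2, h3, if_true, if_false, mul_add, add_mul]
      module
    · have h2 : Even (p - 1) := hp.sub_odd odd_one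
      have h3 : Even (p + 1) := hp.add_odd odd_one
      simp only [Int.not_even_iff_odd.2 hp, h2, h3, if_true, if_false, mul_add, add_mul]
      module
  induction hx with
  | one => simp [coder_one, proj_one]
  | killed hv hE _ ih => rw [key _ hv, ih, hE]; simp
  | fixed hv hE _ ih => rw [key _ hv, ih, hE, mul_smul_comm]; push_cast; module

end Homotopy

/-! ### Injectivity of the map from the cohomology of the linear part -/

section Injectivity

variable {V : Type*} [AddCommGroup V] [Module ℂ V] {gr : ℤ → Submodule ℂ V}
  [DirectSum.Decomposition gr] {q : Sym gr →ₗ[ℂ] V}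

theorem coder_ι (h1 : q 1 = 0) (v : V) : coder gr q (ι gr v) = ι gr (q (ι gr v)) := by
  have : ι gr v = ι gr v * 1 := (mul_one _).symm
  rw [this, coder, LinearMap.comp_apply, comul_ι_mul, comul_one, mulPrim_tmul]
  simp [h1]

/-- If a differential on the symmetric coalgebra has a linear part which is acyclic in negative
degrees, then a vector of degree `0` which is a coboundary in the coalgebra is a coboundary for the
linear part. -/
theorem exists_of_coder_eq_ι (hq : ∀ n, ∀ x ∈ deg gr n, q x ∈ gr (n + 1)) (h1 : q 1 = 0)
    (hqq : ∀ x, coder gr q (coder gr q x) = 0)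
    (hacyclic : ∀ p < 0, ∀ v ∈ gr p, q (ι gr v) = 0 → ∃ u ∈ gr (p - 1), q (ι gr u) = v)
    {v : V} (hv : v ∈ gr 0) {x : Sym gr} (hx : x ∈ deg gr (-1)) (h : coder gr q x = ι gr v) :
    ∃ u ∈ gr (-1), q (ι gr u) = v := by
  set d : V →ₗ[ℂ] V := q ∘ₗ ι gr with hd_def
  have hι : ∀ {p : ℤ} {v : V}, v ∈ gr p → IsMonomial gr 1 p (ι gr v) := by
    intro p v hv
    simpa using IsMonomial.cons hv IsMonomial.one
  have hd : ∀ p, ∀ v ∈ gr p, d v ∈ gr (p + 1) := fun p v hv =>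
    hq p _ (Submodule.subset_span ⟨1, hι hv⟩)
  have hdd : ∀ v, d (d v) = 0 := by
    intro v
    have := congrArg (proj gr) (hqq (ι gr v))
    rwa [coder_ι h1, proj_coder, map_zero] at this
  obtain ⟨s, hs, hEE, hE0⟩ := exists_homotopy gr hd hdd hacyclic
  set E := d ∘ₗ s + s ∘ₗ d with hE_def
  have hE : ∀ p, ∀ v ∈ gr p, E v ∈ gr p := by
    intro p v hv
    refine add_mem ?_ ?_
    · simpa using hd _ _ (hs p v hv)
    · simpa using hs _ _ (hd p v hv)
  set D := coder gr q with hD_def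
  set S := coder gr (s ∘ₗ proj gr) with hS_def
  set X : Module.End ℂ (Sym gr) := D ∘ₗ S + S ∘ₗ D with hX_def
  have hDf : ∀ {N n} {x : Sym gr}, x ∈ filt gr N n → D x ∈ filt gr N (n + 1) := fun hx =>
    coder_mem_filt gr (fun k n x hx => hq n x (Submodule.subset_span ⟨k, hx⟩)) h1 hx
  have hSf : ∀ {N n} {x : Sym gr}, x ∈ filt gr N n → S x ∈ filt gr N (n + -1) := fun hx =>
    coder_mem_filt gr (fun k n x hx => hs n _ (proj_monomial gr hx)) (by simp [proj_one]) hx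
  have hXf : ∀ {N n} {x : Sym gr}, x ∈ filt gr N n → X x ∈ filt gr N n := by
    intro N n x hx
    refine add_mem ?_ ?_
    · simpa using hDf (hSf hx)
    · simpa using hSf (hDf hx)
  -- the part of `D` which lowers the weight
  set ρ := coder gr (q - d ∘ₗ proj gr) with hρ_def
  have hDρ : D = coder gr (d ∘ₗ proj gr) + ρ := by
    have : q = d ∘ₗ proj gr + (q - d ∘ₗ proj gr) := by abel
    rw [hD_def, hρ_def]
    conv_lhs => rw [this]
    ext x
    simp only [coder, LinearMap.comp_apply, LinearMap.add_apply]
    generalize comul gr x = t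
    induction t with
    | zero => simp
    | add a b ha hb =>
      simp only [map_add] at ha hb ⊢
      linear_combination (norm := module) ha + hb
    | tmul a b => simp
  have hρf : ∀ {N n} {x : Sym gr}, x ∈ filt gr N n → ρ x ∈ filt gr (N - 1) (n + 1) := by
    intro N n x hx
    induction hx using Submodule.span_induction with
    | mem x hx =>
      obtain ⟨k, hk, hx⟩ := hx
      refine filt_mono gr (by omega : k - 1 ≤ N - 1) _
        (coder_monomial_mem_filt gr (r := 1) (fun k n x hx => ?_) (fun k n x hk hx => ?_) hx)
      · exact sub_mem (hq n x (Submodule.subset_span ⟨k, hx⟩)) (hd n _ (proj_monomial gr hx))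
      · rcases hx with _ | ⟨hv, hx⟩
        · simp [h1, proj_one]
        rcases hx with _ | ⟨hw, hx⟩
        · simp [d, proj_ι]
        · omega
    | zero => simp
    | add a b _ _ ha hb => rw [map_add]; exact add_mem ha hb
    | smul c a _ ha => rw [map_smul]; exact Submodule.smul_mem _ _ ha
  -- Modulo lower weight X is the anticommutator of the linear parts, whose eigenvalue on an
  -- eigenmonomial is its number j of fixed factors.
  have hXe : ∀ {k j n} {x : Sym gr}, IsEigenMonomial gr E k j n x →
      X x - (j : ℂ) • x ∈ filt gr (k - 1) n := by
    intro k j n x hx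
    have hxf : x ∈ filt gr k n := Submodule.subset_span ⟨k, le_rfl, hx.isMonomial⟩
    have h2 : X x - (j : ℂ) • x = ρ (S x) + S (ρ x) := by
      rw [← coder_anticomm_eigen hd hs hx, hX_def, LinearMap.add_apply, LinearMap.comp_apply,
        LinearMap.comp_apply, hDρ, LinearMap.add_apply, LinearMap.add_apply, map_add, ← hS_def]
      abel
    rw [h2]
    refine add_mem ?_ ?_
    · simpa using hρf (hSf hxf)
    · simpa using hSf (hρf hxf)
  -- a polynomial in `X` which kills the elements of degree `-1` and bounded weight
  have hpoly : ∀ N, ∃ R : Polynomial ℂ, R.eval 0 ≠ 0 ∧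
      ∀ y ∈ filt gr N (-1), Polynomial.aeval X R y = 0 := by
    intro N
    induction N with
    | zero =>
      refine ⟨1, by simp, fun y hy => ?_⟩
      induction hy using Submodule.span_induction with
      | mem y hy =>
        obtain ⟨k, hk, hy⟩ := hy
        obtain rfl : k = 0 := by omega
        exact absurd hy.degree_eq_zero (by decide)
      | zero => simp
      | add a b _ _ ha hb => rw [map_add, ha, hb, add_zero]
      | smul c a _ ha => rw [map_smul, ha, smul_zero]
    | succ N ih =>
      obtain ⟨R, hR0, hR⟩ := ih
      -- On an eigenmonomial with j fixed factors, X - j lowers the weight. The root j = 0 can be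
      -- left out, since an eigenmonomial of degree -1 with j = 0 is zero; this keeps the constant
      -- term of the polynomial non-zero.
      refine ⟨R * ∏ j ∈ Finset.Icc 1 (N + 1), (Polynomial.X - Polynomial.C (j : ℂ)), ?_,
        fun y hy => ?_⟩
      · rw [Polynomial.eval_mul, Polynomial.eval_prod]
        refine mul_ne_zero hR0 (Finset.prod_ne_zero_iff.2 fun j hj => ?_)
        have := (Finset.mem_Icc.1 hj).1
        simp only [Polynomial.eval_sub, Polynomial.eval_X, Polynomial.eval_C, zero_sub, ne_eq,
          neg_eq_zero, Nat.cast_eq_zero]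
        omega
      · rw [map_mul, Module.End.mul_apply]
        apply hR
        induction hy using Submodule.span_induction with
        | mem y hy =>
          obtain ⟨k, hk, hy⟩ := hy
          replace hy := hy.mem_span_eigen hE hEE
          induction hy using Submodule.span_induction with
          | mem y hy =>
            obtain ⟨j, hy⟩ := hy
            rcases Nat.eq_zero_or_pos j with rfl | hj
            · rw [hy.eq_zero hE0 (by omega), map_zero]; exact zero_mem _
            · have hj' : j ∈ Finset.Icc 1 (N + 1) := by
                have := hy.le
                exact Finset.mem_Icc.2 ⟨hj, by omega⟩
              rw [← Finset.prod_erase_mul _ _ hj', map_mul, Module.End.mul_apply]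
              refine Polynomial.aeval_end_mem (fun v hv => hXf hv) _ ?_
              have := filt_mono gr (by omega : k - 1 ≤ N) _ (hXe hy)
              rwa [map_sub, Polynomial.aeval_X, Polynomial.aeval_C, LinearMap.sub_apply,
                Module.algebraMap_end_apply]
          | zero => simp
          | add a b _ _ ha hb => rw [map_add]; exact add_mem ha hb
          | smul c a _ ha => rw [map_smul]; exact Submodule.smul_mem _ _ ha
        | zero => simp
        | add a b _ _ ha hb => rw [map_add]; exact add_mem ha hb
        | smul c a _ ha => rw [map_smul]; exact Submodule.smul_mem _ _ ha
  obtain ⟨N, hN⟩ := exists_mem_filt hx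
  obtain ⟨R, hR0, hR⟩ := hpoly N
  have h2 := hR x hN
  -- Write R = X R₁ + c with c ≠ 0. Applying D to R(X) x = 0, and using D X = D S D with D x = v,
  -- gives D S R₁(X) v + c v = 0. On V itself X is E, so this reads d s R₁(E) v = -c v, an equation
  -- in V that exhibits v as a coboundary.
  rw [← Polynomial.divX_mul_X_add R, mul_comm, map_add, map_mul, Polynomial.aeval_X,
    Polynomial.aeval_C, LinearMap.add_apply, Module.End.mul_apply, Module.algebraMap_end_apply,
    Polynomial.coeff_zero_eq_eval_zero] at h2
  set c := R.eval 0
  have hDX : ∀ y, D (X y) = X (D y) := by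
    intro y
    simp [X, D, hqq]
  have hDX' : ∀ y, D (X y) = D (S (D y)) := by
    intro y
    simp [X, D, hqq]
  have hXι : ∀ u, ι gr (E u) = X (ι gr u) := by
    intro u
    have hS1 : S (ι gr u) = ι gr (s u) := by
      rw [hS_def, coder_ι (by simp [proj_one])]; simp [proj_ι]
    have hS2 : S (ι gr (d u)) = ι gr (s (d u)) := by
      rw [hS_def, coder_ι (by simp [proj_one])]; simp [proj_ι]
    simp only [hX_def, LinearMap.add_apply, LinearMap.comp_apply, hS1, hE_def, map_add]
    rw [hD_def, coder_ι h1, coder_ι h1, ← hS2]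
    rfl
  have h3 := congrArg D h2
  rw [map_add, hDX', map_smul, map_zero, Polynomial.aeval_end_intertwine hDX, h,
    ← Polynomial.aeval_end_intertwine hXι] at h3
  set w := Polynomial.aeval E R.divX v with hw
  have hw0 : w ∈ gr 0 := Polynomial.aeval_end_mem (hE 0) _ hv
  have hS1 : S (ι gr w) = ι gr (s w) := by
    rw [hS_def, coder_ι (by simp [proj_one])]; simp [proj_ι]
  rw [hS1, hD_def, coder_ι h1] at h3
  have h4 := congrArg (proj gr) h3
  rw [map_add, map_smul, proj_ι, proj_ι, map_zero] at h4
  refine ⟨-c⁻¹ • s w, Submodule.smul_mem _ _ (by simpa using hs 0 w hw0), ?_⟩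
  rw [map_smul, map_smul, eq_neg_of_add_eq_zero_left h4, smul_neg, neg_smul, neg_neg,
    inv_smul_smul₀ hR0]

end Injectivity
end KoszulSym
end

noncomputable section

/-! ### Reindexing of iterated sums over antidiagonals -/

section Antidiagonal



theorem Finset.sum_antidiagonal_assoc {A M : Type*} [AddCommMonoid A] [Finset.HasAntidiagonal A]
    [AddCommMonoid M] (m : A) (f : A → A → A → M) :
    ∑ p ∈ Finset.HasAntidiagonal.antidiagonal m, ∑ r ∈ Finset.HasAntidiagonal.antidiagonal p.2, f p.1 r.1 r.2 =
      ∑ p ∈ Finset.HasAntidiagonal.antidiagonal m, ∑ r ∈ Finset.HasAntidiagonal.antidiagonal p.1, f r.1 r.2 p.2 := by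
  rw [Finset.sum_sigma', Finset.sum_sigma']
  refine Finset.sum_nbij' (fun x => ⟨(x.1.1 + x.2.1, x.2.2), (x.1.1, x.2.1)⟩)
    (fun x => ⟨(x.2.1, x.2.2 + x.1.2), (x.2.2, x.1.2)⟩) ?_ ?_ ?_ ?_ ?_ <;>
    rintro ⟨⟨a, b⟩, ⟨c, d⟩⟩ h <;>
    simp only [Finset.mem_sigma, Finset.HasAntidiagonal.mem_antidiagonal] at h ⊢ <;>
    obtain ⟨rfl, rfl⟩ := h <;> simp [add_assoc]

theorem Finset.sum_antidiagonal_left_comm {A M : Type*} [AddCommMonoid A] [Finset.HasAntidiagonal A]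
    [AddCommMonoid M] (m : A) (f : A → A → A → M) :
    ∑ p ∈ Finset.HasAntidiagonal.antidiagonal m, ∑ r ∈ Finset.HasAntidiagonal.antidiagonal p.2, f p.1 r.1 r.2 =
      ∑ p ∈ Finset.HasAntidiagonal.antidiagonal m, ∑ r ∈ Finset.HasAntidiagonal.antidiagonal p.2, f r.1 p.1 r.2 := by
  rw [Finset.sum_sigma', Finset.sum_sigma']
  refine Finset.sum_nbij' (fun x => ⟨(x.2.1, x.1.1 + x.2.2), (x.1.1, x.2.2)⟩)
    (fun x => ⟨(x.2.1, x.1.1 + x.2.2), (x.1.1, x.2.2)⟩) ?_ ?_ ?_ ?_ ?_ <;>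
    rintro ⟨⟨a, b⟩, ⟨c, d⟩⟩ h <;>
    simp only [Finset.mem_sigma, Finset.HasAntidiagonal.mem_antidiagonal] at h ⊢ <;>
    obtain ⟨rfl, rfl⟩ := h <;> simp [add_left_comm]

end Antidiagonal

namespace KoszulSym

/-! ### Exponentials of formal families -/

section Families

open Finset



variable {V : Type*} [AddCommGroup V] [Module ℂ V] {gr : ℤ → Submodule ℂ V}

theorem ι_mul_mem_deg {p n : ℤ} {v : V} {x : Sym gr} (hv : v ∈ gr p) (hx : x ∈ deg gr n) :
    ι gr v * x ∈ deg gr (p + n) := by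
  induction hx using Submodule.span_induction with
  | mem x hx => obtain ⟨k, hx⟩ := hx; exact Submodule.subset_span ⟨_, .cons hv hx⟩
  | zero => simp
  | add a b _ _ ha hb => rw [mul_add]; exact add_mem ha hb
  | smul c a _ ha => rw [mul_smul_comm]; exact Submodule.smul_mem _ _ ha

variable {n : ℕ}

/-- The coefficients `φ m` of a formal family in `V` and the coefficients `z m` of its exponential
in `Sym V`. -/
structure ExpFamily (gr : ℤ → Submodule ℂ V) (n : ℕ) where
  φ : (Fin n →₀ ℕ) → V
  z : (Fin n →₀ ℕ) → Sym gr
  z_zero : z 0 = 1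
  euler : ∀ m, (m.degree : ℂ) • z m = ∑ p ∈ antidiagonal m, (p.1.degree : ℂ) • (ι gr (φ p.1) * z p.2)

/-- There is a family with given first order part such that the higher order parts of `φ` are
obtained by applying a given function to the higher order parts of the exponential. -/
theorem exists_expFamily (e : Fin n → V) (ψ : Sym gr → V) :
    ∃ F : ExpFamily gr n, (∀ i, F.φ (Finsupp.single i 1) = e i) ∧
      (∀ m : Fin n →₀ ℕ, 2 ≤ m.degree → F.φ m = ψ (F.z m - ι gr (F.φ m))) ∧
      ∀ m : Fin n →₀ ℕ, m ≠ 0 → F.z m - ι gr (F.φ m) = (m.degree : ℂ)⁻¹ •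
        ∑ p ∈ (antidiagonal m).filter (fun p => p.1.degree < m.degree ∧ p.2.degree < m.degree),
          (p.1.degree : ℂ) • (ι gr (F.φ p.1) * F.z p.2) := by
  classical
  -- T is z_m without its linear term φ_m. Only exponents of strictly smaller degree enter it, so
  -- φ_m may be defined from T, and z_m = T + φ_m, by recursion on the degree.
  let T : (m : Fin n →₀ ℕ) → ((m' : Fin n →₀ ℕ) → m'.degree < m.degree → V × Sym gr) → Sym gr :=
    fun m rec => (m.degree : ℂ)⁻¹ • ∑ p ∈ antidiagonal m,
      if h : p.1.degree < m.degree ∧ p.2.degree < m.degree then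
        (p.1.degree : ℂ) • (ι gr (rec p.1 h.1).1 * (rec p.2 h.2).2) else 0
  let Φ : (m : Fin n →₀ ℕ) → ((m' : Fin n →₀ ℕ) → m'.degree < m.degree → V × Sym gr) → V :=
    fun m rec => if 2 ≤ m.degree then ψ (T m rec) else ∑ i, (m i : ℂ) • e i
  let Γ : (m : Fin n →₀ ℕ) → ((m' : Fin n →₀ ℕ) → m'.degree < m.degree → V × Sym gr) → V × Sym gr :=
    fun m rec => if m = 0 then (0, 1) else (Φ m rec, T m rec + ι gr (Φ m rec))
  let wf := (measure (fun m : Fin n →₀ ℕ => m.degree)).wf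
  let F : (Fin n →₀ ℕ) → V × Sym gr := wf.fix Γ
  have hF : ∀ m, F m = Γ m fun m' _ => F m' := fun m => wf.fix_eq Γ m
  have hF0 : F 0 = (0, 1) := by rw [hF]; simp [Γ]
  have hT : ∀ m, T m (fun m' _ => F m') = (m.degree : ℂ)⁻¹ •
      ∑ p ∈ (antidiagonal m).filter (fun p => p.1.degree < m.degree ∧ p.2.degree < m.degree),
        (p.1.degree : ℂ) • (ι gr (F p.1).1 * (F p.2).2) := by
    intro m
    simp only [T, dite_eq_ite, Finset.sum_filter]
  have hφ : ∀ m, m ≠ 0 → (F m).1 = Φ m fun m' _ => F m' := by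
    intro m hm; rw [hF m]; simp only [Γ, if_neg hm]
  have hz : ∀ m, m ≠ 0 → (F m).2 = T m (fun m' _ => F m') + ι gr (F m).1 := by
    intro m hm; rw [hφ m hm, hF m]; simp only [Γ, if_neg hm]
  have hz' : ∀ m, m ≠ 0 → (F m).2 - ι gr (F m).1 = T m (fun m' _ => F m') := by
    intro m hm; rw [hz m hm, add_sub_cancel_right]
  refine ⟨⟨fun m => (F m).1, fun m => (F m).2, by rw [hF0], fun m => ?_⟩, fun i => ?_,
    fun m hm => ?_, fun m hm => ?_⟩
  · by_cases hm : m = 0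
    · subst hm; simp
    have hd : (m.degree : ℂ) ≠ 0 := by
      rw [Nat.cast_ne_zero]; exact fun h => hm ((Finsupp.degree_eq_zero_iff m).1 h)
    rw [hz m hm, hT, smul_add, smul_inv_smul₀ hd, Finset.sum_filter]
    have h1 : (m.degree : ℂ) • ι gr (F m).1 = ∑ p ∈ antidiagonal m,
        if p = (m, 0) then (m.degree : ℂ) • ι gr (F m).1 else 0 := by
      rw [Finset.sum_ite_eq' (antidiagonal m) (m, 0), if_pos (by simp)]
    rw [h1, ← Finset.sum_add_distrib]
    refine Finset.sum_congr rfl fun p hp => ?_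
    obtain ⟨a, b⟩ := p
    have hab := mem_antidiagonal.1 hp
    simp only at hab ⊢
    have hdeg : a.degree + b.degree = m.degree := by rw [← map_add, hab]
    by_cases hb : b = 0
    · subst hb
      obtain rfl : a = m := by simpa using hab
      simp [hF0]
    by_cases ha : a = 0
    · subst ha
      obtain rfl : b = m := by simpa using hab
      simp [hb]
    have ha' : a.degree ≠ 0 := fun h => ha ((Finsupp.degree_eq_zero_iff a).1 h)
    have hb' : b.degree ≠ 0 := fun h => hb ((Finsupp.degree_eq_zero_iff b).1 h)
    rw [if_pos ⟨by omega, by omega⟩, if_neg (by simp [hb]), add_zero]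
  · have h0 : Finsupp.single i 1 ≠ (0 : Fin n →₀ ℕ) := by simp
    simp only
    rw [hφ _ h0]
    simp only [Φ, Finsupp.degree_single]
    rw [if_neg (by omega), Finset.sum_eq_single_of_mem i (Finset.mem_univ i)]
    · simp
    · intro j _ hj
      rw [Finsupp.single_eq_of_ne hj]; simp
  · have h0 : m ≠ 0 := by rintro rfl; simp at hm
    simp only
    rw [hz' m h0, hφ m h0]
    simp only [Φ, if_pos hm]
  · simp only
    rw [hz' m hm, hT]

namespace ExpFamily

variable (F : ExpFamily gr n)

theorem z_single (i : Fin n) : F.z (Finsupp.single i 1) = ι gr (F.φ (Finsupp.single i 1)) := by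
  have h := F.euler (Finsupp.single i 1)
  rw [Finsupp.degree_single, Nat.cast_one, one_smul,
    Finset.sum_eq_single_of_mem (Finsupp.single i 1, 0) (by simp)] at h
  · rw [h]; simp [F.z_zero]
  · rintro ⟨a, b⟩ hp hne
    have hab := mem_antidiagonal.1 hp
    simp only at hab ⊢
    have hdeg : a.degree + b.degree = 1 := by rw [← map_add, hab, Finsupp.degree_single]
    have hb : b.degree ≠ 0 := by
      intro h
      have hb := (Finsupp.degree_eq_zero_iff b).1 h
      subst hb
      rw [add_zero] at hab
      exact hne (by rw [hab])
    have ha : a.degree = 0 := by omega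
    rw [ha]; simp

variable [DirectSum.Decomposition gr]

/-- The exponential of an even primitive element is group-like. The equation `euler` expresses |m|
z_m through lower terms, and |m| can be divided out. The vector φ 0 is unconstrained, as it always
occurs with coefficient 0. -/
theorem comul_z (hφ : ∀ m, F.φ m ∈ gr 0 ∨ m = 0) (m : Fin n →₀ ℕ) :
    comul gr (F.z m) = ∑ p ∈ antidiagonal m, F.z p.1 ⊗ₜ[ℂ] F.z p.2 := by
  induction hd : m.degree using Nat.strong_induction_on generalizing m with
  | _ N ih =>
    by_cases hm : m = 0
    · subst hm
      simp [F.z_zero, comul_one]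
    have hd0 : (m.degree : ℂ) ≠ 0 := by
      rw [Nat.cast_ne_zero]; exact fun h => hm ((Finsupp.degree_eq_zero_iff m).1 h)
    have h1 : (m.degree : ℂ) • comul gr (F.z m) =
        (m.degree : ℂ) • ∑ p ∈ antidiagonal m, F.z p.1 ⊗ₜ[ℂ] F.z p.2 := by
      rw [← map_smul, F.euler, map_sum]
      have h2 : ∀ p ∈ antidiagonal m,
          comul gr ((p.1.degree : ℂ) • (ι gr (F.φ p.1) * F.z p.2)) =
          ∑ r ∈ antidiagonal p.2, ((p.1.degree : ℂ) • (ι gr (F.φ p.1) * F.z r.1) ⊗ₜ[ℂ] F.z r.2 +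
            F.z r.1 ⊗ₜ[ℂ] ((p.1.degree : ℂ) • (ι gr (F.φ p.1) * F.z r.2))) := by
        rintro ⟨a, b⟩ hp
        have hab := mem_antidiagonal.1 hp
        simp only at hab ⊢
        by_cases ha : a = 0
        · subst ha; simp
        have hdeg : a.degree + b.degree = m.degree := by rw [← map_add, hab]
        have ha' : a.degree ≠ 0 := fun h => ha ((Finsupp.degree_eq_zero_iff a).1 h)
        have hφa := (hφ a).resolve_right ha
        rw [map_smul, comul_ι_mul, ih b.degree (by omega) b rfl, map_sum, Finset.smul_sum]
        refine Finset.sum_congr rfl fun r _ => ?_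
        rw [mulPrim_tmul, evenPart_of_mem gr hφa, oddPart_of_mem gr hφa]
        simp [TensorProduct.tmul_smul]
      rw [Finset.sum_congr rfl h2]
      simp only [Finset.sum_add_distrib]
      rw [Finset.sum_antidiagonal_assoc m fun a b c =>
          ((a.degree : ℂ) • (ι gr (F.φ a) * F.z b) ⊗ₜ[ℂ] F.z c),
        Finset.sum_antidiagonal_left_comm m fun a b c =>
          (F.z b ⊗ₜ[ℂ] ((a.degree : ℂ) • (ι gr (F.φ a) * F.z c))), Finset.smul_sum,
        ← Finset.sum_add_distrib]
      refine Finset.sum_congr rfl fun p hp => ?_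
      have hab := mem_antidiagonal.1 hp
      have hdeg : p.1.degree + p.2.degree = m.degree := by rw [← map_add, hab]
      simp only [TensorProduct.smul_tmul', ← TensorProduct.sum_tmul, ← TensorProduct.tmul_sum,
        ← F.euler, ← hdeg]
      simp only [TensorProduct.tmul_smul, ← TensorProduct.smul_tmul']
      push_cast
      module
    exact smul_right_injective _ hd0 h1

theorem coder_z (hφ : ∀ m, F.φ m ∈ gr 0 ∨ m = 0) (q : Sym gr →ₗ[ℂ] V) (m : Fin n →₀ ℕ) :
    coder gr q (F.z m) = ∑ p ∈ antidiagonal m, ι gr (q (F.z p.1)) * F.z p.2 := by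
  rw [coder, LinearMap.comp_apply, F.comul_z hφ, map_sum]
  rfl

end ExpFamily
end Families
end KoszulSym
end

noncomputable section

namespace KoszulSym

/-! ### The formal Kuranishi family -/

section Kuranishi

open Finset

theorem exists_eq_single_of_degree_eq_one {n : ℕ} {m : Fin n →₀ ℕ} (h : m.degree = 1) :
    ∃ i, m = Finsupp.single i 1 := by
  have hm : m ≠ 0 := by rintro rfl; simp at h
  obtain ⟨i, hi⟩ := Finsupp.ne_iff.1 hm
  have hi' : 1 ≤ m i := Nat.one_le_iff_ne_zero.2 hi
  have hle : Finsupp.single i 1 ≤ m := Finsupp.single_le_iff.2 hi'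
  obtain ⟨r, hr⟩ := exists_add_of_le hle
  have hd : r.degree = 0 := by
    rw [hr, map_add, Finsupp.degree_single] at h
    omega
  rw [(Finsupp.degree_eq_zero_iff r).1 hd, add_zero] at hr
  exact ⟨i, hr⟩

/-- A linear recursion for families in `V` indexed by exponents. -/
theorem exists_recursion {n : ℕ} {V : Type*} [AddCommGroup V] [Module ℂ V]
    (v : V) (T : (Fin n →₀ ℕ) → V →ₗ[ℂ] V) (hT : T 0 = 0) :
    ∃ u : (Fin n →₀ ℕ) → V, ∀ m, u m = (if m = 0 then v else 0) +
      ∑ p ∈ antidiagonal m, T p.2 (u p.1) := by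
  classical
  let Γ : (m : Fin n →₀ ℕ) → ((m' : Fin n →₀ ℕ) → m'.degree < m.degree → V) → V :=
    fun m rec => (if m = 0 then v else 0) + ∑ p ∈ antidiagonal m,
      if h : p.1.degree < m.degree then T p.2 (rec p.1 h) else 0
  let wf := (measure (fun m : Fin n →₀ ℕ => m.degree)).wf
  refine ⟨wf.fix Γ, fun m => ?_⟩
  have h : wf.fix Γ m = Γ m fun m' _ => wf.fix Γ m' := wf.fix_eq Γ m
  rw [h]
  simp only [Γ, dite_eq_ite]
  congr 1
  refine Finset.sum_congr rfl fun p hp => ?_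
  obtain ⟨a, b⟩ := p
  have hab := mem_antidiagonal.1 hp
  simp only at hab ⊢
  have hdeg : a.degree + b.degree = m.degree := by rw [← map_add, hab]
  split_ifs with hlt
  · rfl
  · have hb : b.degree = 0 := by omega
    rw [(Finsupp.degree_eq_zero_iff b).1 hb, hT, LinearMap.zero_apply]

/-- The u_j are the fundamental solutions of a linear recursion, so the solution with inhomogeneous
term ∑ c_j e'_j is the convolution of the c_j with the u_j. As T 0 = 0, the recursion strictly
lowers the degree and determines its solution. -/
theorem eq_sum_of_recursion {n r : ℕ} {V : Type*} [AddCommGroup V] [Module ℂ V]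
    (e' : Fin r → V) (T : (Fin n →₀ ℕ) → V →ₗ[ℂ] V) (hT : T 0 = 0)
    (u : Fin r → (Fin n →₀ ℕ) → V) (c : Fin r → (Fin n →₀ ℕ) → ℂ) (w : (Fin n →₀ ℕ) → V)
    (hu : ∀ j m, u j m = (if m = 0 then e' j else 0) + ∑ p ∈ antidiagonal m, T p.2 (u j p.1))
    (hw : ∀ m, w m = ∑ j, c j m • e' j + ∑ p ∈ antidiagonal m, T p.2 (w p.1)) (m : Fin n →₀ ℕ) :
    w m = ∑ p ∈ antidiagonal m, ∑ j, c j p.1 • u j p.2 := by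
  classical
  induction hd : m.degree using Nat.strong_induction_on generalizing m with
  | _ N ih =>
    have h1 : ∀ p ∈ antidiagonal m, ∑ j, c j p.1 • u j p.2 =
        (if p = (m, 0) then ∑ j, c j m • e' j else 0) +
          ∑ r ∈ antidiagonal p.2, T r.2 (∑ j, c j p.1 • u j r.1) := by
      rintro ⟨a, b⟩ hp
      have hab := mem_antidiagonal.1 hp
      simp only at hab ⊢
      simp only [hu _ b, smul_add, Finset.sum_add_distrib]
      congr 1
      · by_cases hb : b = 0
        · subst hb
          obtain rfl : a = m := by simpa using hab
          simp
        · rw [if_neg (by simp [hb])]; simp [hb]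
      · simp only [map_sum, map_smul, Finset.smul_sum]
        rw [Finset.sum_comm]
    rw [Finset.sum_congr rfl h1, Finset.sum_add_distrib,
      Finset.sum_ite_eq' (antidiagonal m) (m, 0), if_pos (by simp),
      Finset.sum_antidiagonal_assoc m fun a b d => T d (∑ j, c j a • u j b), hw m]
    congr 1
    refine Finset.sum_congr rfl fun p hp => ?_
    obtain ⟨a, b⟩ := p
    have hab := mem_antidiagonal.1 hp
    simp only at hab ⊢
    by_cases hb : b = 0
    · subst hb; simp [hT]
    have hdeg : a.degree + b.degree = m.degree := by rw [← map_add, hab]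
    have hb' : b.degree ≠ 0 := fun h => hb ((Finsupp.degree_eq_zero_iff b).1 h)
    rw [ih a.degree (by omega) a rfl, map_sum]

/-- The power series `∑ f(z_m) X^m` attached to a functional `f` and a family `z`. -/
def familySeries {n : ℕ} {W : Type*} [AddCommGroup W] [Module ℂ W] (z : (Fin n →₀ ℕ) → W) :
    (W →ₗ[ℂ] ℂ) →ₗ[ℂ] MvPowerSeries (Fin n) ℂ where
  toFun f m := f (z m)
  map_add' _ _ := rfl
  map_smul' _ _ := rfl

@[simp] theorem coeff_familySeries {n : ℕ} {W : Type*} [AddCommGroup W] [Module ℂ W]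
    (z : (Fin n →₀ ℕ) → W) (f : W →ₗ[ℂ] ℂ) (m : Fin n →₀ ℕ) :
    MvPowerSeries.coeff m (familySeries z f) = f (z m) := rfl

variable {V : Type*} [AddCommGroup V] [Module ℂ V] {gr : ℤ → Submodule ℂ V}
  [DirectSum.Decomposition gr] {q : Sym gr →ₗ[ℂ] V} {n r : ℕ}

/-- **The formal Kuranishi family.** Let `q` be the corestriction of a differential `coder gr q` on
the symmetric coalgebra, with linear part `d = q ∘ ι`. Given cocycles `e i` of degree `0` and a
decomposition `w = k (d w) + d (h w) + ∑ λ_j(w) e'_j` of the vectors of degree `1`, there is a family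
of group-like elements `∑ z_m X^m` which starts with `1 + ∑ e_i X_i`, and which is a cocycle modulo
the ideal generated by `r` power series without terms of degree `≤ 1`. -/
theorem exists_kuranishi_family (hq : ∀ n, ∀ x ∈ deg gr n, q x ∈ gr (n + 1)) (h1 : q 1 = 0)
    (hqq : ∀ x, coder gr q (coder gr q x) = 0)
    (e : Fin n → V) (he : ∀ i, e i ∈ gr 0) (hde : ∀ i, q (ι gr (e i)) = 0)
    (e' : Fin r → V) (h k : V →ₗ[ℂ] V) (l : Fin r → V →ₗ[ℂ] ℂ) (hh : ∀ w ∈ gr 1, h w ∈ gr 0)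
    (hdec : ∀ w ∈ gr 1,
      w = k (q (ι gr w)) + q (ι gr (h w)) + ∑ j, l j w • e' j) :
    ∃ (z : (Fin n →₀ ℕ) → Sym gr) (c : Fin r → MvPowerSeries (Fin n) ℂ),
      z 0 = 1 ∧ (∀ i, z (Finsupp.single i 1) = ι gr (e i)) ∧ (∀ m, z m ∈ deg gr 0) ∧
      (∀ m, comul gr (z m) = ∑ p ∈ antidiagonal m, z p.1 ⊗ₜ[ℂ] z p.2) ∧
      (∀ j m, m.degree ≤ 1 → MvPowerSeries.coeff m (c j) = 0) ∧
      ∀ f : Sym gr →ₗ[ℂ] ℂ, familySeries z (f ∘ₗ coder gr q) ∈ Ideal.span (Set.range c) := by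
  classical
  -- The correction -h(q t) makes d φ_m cancel the exact part of q applied to the non-linear part t
  -- of z_m.
  obtain ⟨F, hF1, hF2, hF3⟩ := exists_expFamily (gr := gr) e fun t => -h (q t)
  have hι : ∀ {p : ℤ} {v : V}, v ∈ gr p → ι gr v ∈ deg gr p := by
    intro p v hv
    exact Submodule.subset_span ⟨1, by simpa using IsMonomial.cons hv IsMonomial.one⟩
  have hz : ∀ m, F.z m ∈ deg gr 0 ∧ (F.φ m ∈ gr 0 ∨ m = 0) ∧
      (m ≠ 0 → F.z m - ι gr (F.φ m) ∈ deg gr 0) := by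
    intro m
    induction hd : m.degree using Nat.strong_induction_on generalizing m with
    | _ N ih =>
      by_cases hm : m = 0
      · subst hm
        refine ⟨?_, Or.inr rfl, fun h => absurd rfl h⟩
        rw [F.z_zero]; exact Submodule.subset_span ⟨0, .one⟩
      have hm0 : m.degree ≠ 0 := fun h => hm ((Finsupp.degree_eq_zero_iff m).1 h)
      have ht : F.z m - ι gr (F.φ m) ∈ deg gr 0 := by
        rw [hF3 m hm]
        refine Submodule.smul_mem _ _ (Submodule.sum_mem _ fun p hp => Submodule.smul_mem _ _ ?_)
        obtain ⟨hp, h1, h2⟩ := Finset.mem_filter.1 hp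
        have hab := mem_antidiagonal.1 hp
        have hdeg : p.1.degree + p.2.degree = m.degree := by rw [← map_add, hab]
        have h3 : p.1 ≠ 0 := by
          intro h; rw [h, map_zero] at hdeg; omega
        have := ι_mul_mem_deg ((ih _ (by omega) p.1 rfl).2.1.resolve_right h3)
          (ih _ (by omega) p.2 rfl).1
        simpa using this
      have hφ : F.φ m ∈ gr 0 := by
        by_cases hm1 : m.degree = 1
        · obtain ⟨i, rfl⟩ := exists_eq_single_of_degree_eq_one hm1
          rw [hF1]; exact he i
        · rw [hF2 m (by omega)]
          exact neg_mem (hh _ (by simpa using hq 0 _ ht))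
      refine ⟨?_, Or.inl hφ, fun _ => ht⟩
      rw [← sub_add_cancel (F.z m) (ι gr (F.φ m))]
      exact add_mem ht (hι hφ)
  have hφ : ∀ m, F.φ m ∈ gr 0 ∨ m = 0 := fun m => (hz m).2.1
  set w : (Fin n →₀ ℕ) → V := fun m => q (F.z m) with hw
  have hdd : ∀ v, q (ι gr (q (ι gr v))) = 0 := by
    intro v
    have := congrArg (proj gr) (hqq (ι gr v))
    rwa [coder_ι h1, proj_coder, map_zero] at this
  -- The obstruction coefficients. In degree at most 1 they may be set to 0, because w vanishes
  -- there: q 1 = 0 and the e_i are cocycles.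
  let c : Fin r → (Fin n →₀ ℕ) → ℂ := fun j m =>
    if m.degree ≤ 1 then 0 else l j (q (F.z m - ι gr (F.φ m)))
  let T : (Fin n →₀ ℕ) → V →ₗ[ℂ] V := fun b => if b = 0 then 0 else
    -(k ∘ₗ q ∘ₗ LinearMap.mulRight ℂ (F.z b) ∘ₗ ι gr)
  have hT0 : T 0 = 0 := by simp [T]
  have hT : ∀ b ≠ 0, ∀ v, T b v = -k (q (ι gr v * F.z b)) := by
    intro b hb v
    simp [T, hb]
  have hw1 : ∀ m, w m = k (q (ι gr (w m))) + ∑ j, c j m • e' j := by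
    intro m
    by_cases hm : m.degree ≤ 1
    · have hw0 : w m = 0 := by
        rcases Nat.le_one_iff_eq_zero_or_eq_one.1 hm with h0 | h0
        · rw [(Finsupp.degree_eq_zero_iff m).1 h0, hw]
          simp only [F.z_zero, h1]
        · obtain ⟨i, rfl⟩ := exists_eq_single_of_degree_eq_one h0
          simp only [hw, F.z_single, hF1, hde]
      simp [hw0, c, hm]
    · have hm0 : m ≠ 0 := by rintro rfl; simp at hm
      have h2 : w m = q (ι gr (F.φ m)) + q (F.z m - ι gr (F.φ m)) := by
        rw [← map_add, add_sub_cancel]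
      have h3 := hdec _ (by have := hq 0 _ ((hz m).2.2 hm0); rwa [zero_add] at this)
      have h4 : q (ι gr (F.φ m)) = -q (ι gr (h (q (F.z m - ι gr (F.φ m))))) := by
        conv_lhs => rw [hF2 m (by omega)]
        simp
      have h5 : q (ι gr (w m)) = q (ι gr (q (F.z m - ι gr (F.φ m)))) := by
        rw [h2, map_add, map_add, hdd, zero_add]
      rw [h5, h2, h4]
      simp only [c, if_neg hm]
      rw [neg_add_eq_iff_eq_add]
      exact h3.trans (by abel)
  -- The Bianchi identity, obtained by projecting D(D z_m) = 0 to V. Its term with p.2 = 0 is d w_m,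
  -- so k(d w_m) becomes a linear expression in lower w and `hw1` turns into a recursion for w.
  have hbianchi : ∀ m, ∑ p ∈ antidiagonal m, q (ι gr (w p.1) * F.z p.2) = 0 := by
    intro m
    have := congrArg (proj gr) (hqq (F.z m))
    rw [proj_coder, F.coder_z hφ, map_sum, map_zero] at this
    exact this
  have hw2 : ∀ m, w m = ∑ j, c j m • e' j + ∑ p ∈ antidiagonal m, T p.2 (w p.1) := by
    intro m
    have h2 : ∀ p ∈ antidiagonal m, T p.2 (w p.1) =
        (if p = (m, 0) then k (q (ι gr (w m))) else 0) - k (q (ι gr (w p.1) * F.z p.2)) := by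
      rintro ⟨a, b⟩ hp
      have hab := mem_antidiagonal.1 hp
      simp only at hab ⊢
      by_cases hb : b = 0
      · subst hb
        obtain rfl : a = m := by simpa using hab
        simp [hT0, F.z_zero]
      · rw [hT b hb, if_neg (by simp [hb]), zero_sub]
    rw [Finset.sum_congr rfl h2, Finset.sum_sub_distrib, ← map_sum, hbianchi, map_zero, sub_zero,
      Finset.sum_ite_eq' (antidiagonal m) (m, 0), if_pos (by simp), add_comm]
    exact hw1 m
  choose u hu using fun j => exists_recursion (e' j) T hT0
  have hw3 := eq_sum_of_recursion e' T hT0 u c w hu hw2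
  let C : Fin r → MvPowerSeries (Fin n) ℂ := c
  refine ⟨F.z, C, F.z_zero, fun i => by rw [F.z_single, hF1], fun m => (hz m).1, F.comul_z hφ,
    fun j m hm => ?_, fun f => ?_⟩
  · change c j m = 0
    simp [c, hm]
  -- As z is group-like, D z is the product of w with z. Substituting w = ∑ c_j u_j exhibits f(D z)
  -- as ∑ g_j c_j.
  · let g : Fin r → MvPowerSeries (Fin n) ℂ := fun j m =>
      ∑ p ∈ antidiagonal m, f (ι gr (u j p.1) * F.z p.2)
    have h2 : familySeries F.z (f ∘ₗ coder gr q) = ∑ j, g j * C j := by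
      refine MvPowerSeries.ext fun m => ?_
      have h3 : ∀ j, MvPowerSeries.coeff m (g j * C j) =
          ∑ p ∈ antidiagonal m, ∑ r ∈ antidiagonal p.1, c j r.1 * f (ι gr (u j r.2) * F.z p.2) := by
        intro j
        rw [mul_comm, MvPowerSeries.coeff_mul,
          ← Finset.sum_antidiagonal_assoc m fun a b d => c j a * f (ι gr (u j b) * F.z d)]
        refine Finset.sum_congr rfl fun p _ => ?_
        rw [← Finset.mul_sum]
        rfl
      rw [map_sum, Finset.sum_congr rfl fun j _ => h3 j]
      change f (coder gr q (F.z m)) = _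
      rw [F.coder_z hφ, map_sum, Finset.sum_comm]
      refine Finset.sum_congr rfl fun p _ => ?_
      change f (ι gr (w p.1) * _) = _
      rw [hw3, Finset.sum_comm]
      simp only [map_sum, map_smul, Finset.sum_mul, smul_mul_assoc, smul_eq_mul]
    rw [h2]
    exact Ideal.sum_mem _ fun j _ => Ideal.mul_mem_left _ _ (Ideal.subset_span ⟨j, rfl⟩)

end Kuranishi
end KoszulSym
end

noncomputable section

/-! ### Splittings and representatives of cohomology classes -/

section Splitting

theorem LinearMap.exists_rightInverse_on_range {K U V : Type*} [Field K] [AddCommGroup U]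
    [Module K U] [AddCommGroup V] [Module K V] (f : U →ₗ[K] V) :
    ∃ s : V →ₗ[K] U, ∀ v ∈ LinearMap.range f, f (s v) = v := by
  obtain ⟨ρ, hρ⟩ := f.rangeRestrict.exists_rightInverse_of_surjective f.range_rangeRestrict
  obtain ⟨s, hs⟩ := LinearMap.exists_extend ρ
  refine ⟨s, fun v hv => ?_⟩
  have h1 := LinearMap.congr_fun hs ⟨v, hv⟩
  have h2 := congrArg Subtype.val (LinearMap.congr_fun hρ ⟨v, hv⟩)
  simp only [LinearMap.comp_apply, Submodule.subtype_apply, LinearMap.id_apply,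
    LinearMap.codRestrict_apply] at h1 h2
  rw [h1]
  exact h2

/-- Vectors which span the cohomology of `d` at `W` give rise to a splitting. -/
theorem exists_splitting {K M : Type*} [Field K] [AddCommGroup M] [Module K M] (d : M →ₗ[K] M)
    (U W : Submodule K M) {r : ℕ} (e : Fin r → M)
    (hspan : ∀ w ∈ W, d w = 0 → ∃ u ∈ U, ∃ c : Fin r → K, w = d u + ∑ j, c j • e j) :
    ∃ (h k : M →ₗ[K] M) (l : Fin r → M →ₗ[K] K), (∀ w, h w ∈ U) ∧
      ∀ w ∈ W, w = k (d w) + d (h w) + ∑ j, l j w • e j := by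
  -- Split w into w - π w and the cocycle π w. The first part depends only on d w, which defines k;
  -- the second is exact plus a combination of the e_j, which defines h and l.
  obtain ⟨π, hπ, hπ'⟩ := (LinearMap.ker d ⊓ W).exists_projection
  obtain ⟨k, hk⟩ := LinearMap.exists_comp_eq_of_ker_le (d ∘ₗ W.subtype)
    ((LinearMap.id - π) ∘ₗ W.subtype) (by
      rintro ⟨w, hw⟩ h
      have := hπ' w ⟨h, hw⟩
      simp [this])
  let F : U × (Fin r → K) →ₗ[K] M :=
    (d ∘ₗ U.subtype).coprod (Fintype.linearCombination K e)
  obtain ⟨s, hs⟩ := LinearMap.exists_rightInverse_on_range F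
  have hF : ∀ p, F p = d p.1 + ∑ j, p.2 j • e j := by
    intro p
    simp [F, Fintype.linearCombination_apply]
  refine ⟨U.subtype ∘ₗ LinearMap.fst K U (Fin r → K) ∘ₗ s ∘ₗ π, k,
    fun j => LinearMap.proj j ∘ₗ LinearMap.snd K U (Fin r → K) ∘ₗ s ∘ₗ π, fun w => (s (π w)).1.2,
    fun w hw => ?_⟩
  have h1 := hk ⟨w, hw⟩
  simp only [LinearMap.comp_apply, Submodule.subtype_apply, LinearMap.sub_apply,
    LinearMap.id_apply] at h1
  have h2 : π w ∈ LinearMap.range F := by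
    obtain ⟨u, hu, c, hc⟩ := hspan (π w) (hπ w).2 (hπ w).1
    exact ⟨(⟨u, hu⟩, c), by rw [hF]; exact hc.symm⟩
  have h3 := hs _ h2
  rw [hF] at h3
  rw [h1, add_assoc]
  simp only [LinearMap.comp_apply, Submodule.subtype_apply, LinearMap.fst_apply,
    LinearMap.snd_apply, LinearMap.proj_apply]
  rw [h3]
  abel

end Splitting

namespace KoszulSym

/-- Representatives of a basis of the cohomology. -/
theorem exists_cohomology_basis {M : Type*} [AddCommGroup M] [Module ℂ M] (gr : ℤ → Submodule ℂ M)
    (d : M →ₗ[ℂ] M) (n : ℤ) (hfin : Module.Finite ℂ (Cohomology gr d n))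
    {r : ℕ} (hr : Module.finrank ℂ (Cohomology gr d n) = r) :
    ∃ e : Fin r → M, (∀ i, e i ∈ gr n) ∧ (∀ i, d (e i) = 0) ∧
      (∀ c : Fin r → ℂ, ∀ x ∈ gr (n - 1),
        ∑ i, c i • e i = d x → c = 0) ∧
      ∀ z ∈ gr n, d z = 0 → ∃ x ∈ gr (n - 1),
        ∃ c : Fin r → ℂ, z = d x + ∑ i, c i • e i := by
  let b := Module.finBasisOfFinrankEq ℂ (Cohomology gr d n) hr
  choose e he using fun i => Submodule.Quotient.mk_surjective _ (b i)
  have hmk : ∀ c : Fin r → ℂ,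
      (Submodule.Quotient.mk (∑ i, c i • e i) : Cohomology gr d n) = ∑ i, c i • b i := by
    intro c
    rw [← Submodule.mkQ_apply, map_sum]
    simp only [map_smul, Submodule.mkQ_apply, he]
  refine ⟨fun i => e i, fun i => (e i).2.2, fun i => (e i).2.1, fun c x hx h => ?_,
    fun z hz hdz => ?_⟩
  · have h0 : (Submodule.Quotient.mk (∑ i, c i • e i) : Cohomology gr d n) = 0 := by
      rw [Submodule.Quotient.mk_eq_zero]
      refine ⟨x, hx, ?_⟩
      rw [← h]
      simp
    rw [hmk] at h0
    funext i
    exact Fintype.linearIndependent_iff.1 b.linearIndependent c h0 i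
  · let c := b.repr (Submodule.Quotient.mk ⟨z, hdz, hz⟩)
    have h0 : (Submodule.Quotient.mk (⟨z, hdz, hz⟩ - ∑ i, c i • e i) : Cohomology gr d n) = 0 := by
      rw [Submodule.Quotient.mk_sub, hmk, b.sum_repr, sub_self]
    rw [Submodule.Quotient.mk_eq_zero] at h0
    obtain ⟨x, hx, h⟩ := h0
    refine ⟨x, hx, c, ?_⟩
    rw [h]
    simp

end KoszulSym

/-! ### The linear part of the Jacobi-Bernoulli differential and the total complex -/

namespace DGLiePair

open KoszulSym

variable {G H : Type*} [AddCommGroup G] [Module ℂ G] [AddCommGroup H] [Module ℂ H]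
  (P : DGLiePair G H)

/-- In weight 1 only the internal differentials and the t = 0 Bernoulli term survive, the latter
with coefficient B_0 = 1. -/
theorem corestriction_ι (v : G × H) :
    P.corestriction (ι P.shiftGr v) = (-P.source.d v.1, P.target.d v.2 + P.i v.1) := by
  have h0 : comul P.shiftGr (ι P.shiftGr v) = mulPrim P.shiftGr v (1 ⊗ₜ 1) := by
    rw [← comul_one, ← comul_ι_mul, mul_one]
  have hb : P.bracketPart (ι P.shiftGr v) = 0 := by
    simp [bracketPart, h0, mulPrim_tmul, projG, proj_one]
  have hw : weight P.shiftGr (ι P.shiftGr v) = Polynomial.monomial 1 (ι P.shiftGr v) := by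
    have := weight_ι_mul P.shiftGr v 1
    rwa [mul_one, map_one, mul_one] at this
  have hB : P.bernoulliPart (ι P.shiftGr v) = P.i v.1 := by
    simp only [bernoulliPart, LinearMap.comp_apply, AlgHom.toLinearMap_apply, hw,
      Polynomial.lsum_apply]
    rw [Polynomial.sum_monomial_index _ _ (by simp)]
    simp [iterBracket, projG, proj_ι]
  simp [corestriction, hb, hB, proj_ι, linearPart]

/-- The sign change on `𝔥` which identifies the linear part of the Jacobi-Bernoulli differential
with the differential of the total complex of the pair, up to a sign. -/
def flip : G × H →ₗ[ℂ] G × H := LinearMap.prodMap LinearMap.id (-LinearMap.id)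

theorem flip_flip (v : G × H) : flip (flip v) = v := by simp [flip]

theorem corestriction_ι_flip (v : G × H) :
    P.corestriction (ι P.shiftGr (flip v)) = -flip (P.atomD v) := by
  rw [corestriction_ι]
  simp [flip, atomD, sub_eq_add_neg, add_comm]

theorem flip_mem {p : ℤ} {v : G × H} : flip v ∈ P.shiftGr p ↔ v ∈ P.atomGr (p + 1) := by
  simp [flip, shiftGr, atomGr, Submodule.mem_prod]

theorem exists_corestriction_ι_eq (n : ℤ) (h : Subsingleton (P.AtomCohomology (n + 1)))
    {v : G × H} (hv : v ∈ P.shiftGr n) (hd : P.corestriction (ι P.shiftGr v) = 0) :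
    ∃ u ∈ P.shiftGr (n - 1), P.corestriction (ι P.shiftGr u) = v := by
  rw [← flip_flip v] at hv hd
  rw [flip_mem] at hv
  rw [corestriction_ι_flip, neg_eq_zero] at hd
  have hd' : P.atomD (flip v) = 0 := by
    rw [← flip_flip (P.atomD (flip v)), hd, map_zero]
  have h0 : (Submodule.Quotient.mk ⟨flip v, hd', hv⟩ : P.AtomCohomology (n + 1)) = 0 :=
    Subsingleton.elim _ _
  rw [Submodule.Quotient.mk_eq_zero] at h0
  obtain ⟨x, hx, hxv⟩ := h0
  refine ⟨flip (-x), P.flip_mem.2 (neg_mem ?_), ?_⟩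
  · rwa [show n + 1 - 1 = n - 1 + 1 by ring] at hx
  · rw [corestriction_ι_flip, map_neg, map_neg, neg_neg, hxv]
    exact flip_flip v

/-- Representatives of a basis of `ℍⁿ⁺¹(𝔤^♯)`, in `𝔤[1] ⊕ 𝔥`. -/
theorem exists_basis (n : ℤ) {N : ℤ} (hN : N = n + 1)
    (hfin : Module.Finite ℂ (P.AtomCohomology N)) {r : ℕ}
    (hr : Module.finrank ℂ (P.AtomCohomology N) = r) :
    ∃ e : Fin r → G × H,
      (∀ i, e i ∈ P.shiftGr n) ∧ (∀ i, P.corestriction (ι P.shiftGr (e i)) = 0) ∧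
      (∀ c : Fin r → ℂ, ∀ x ∈ P.shiftGr (n - 1),
        P.corestriction (ι P.shiftGr x) = ∑ i, c i • e i → c = 0) ∧
      ∀ z ∈ P.shiftGr n, P.corestriction (ι P.shiftGr z) = 0 → ∃ x ∈ P.shiftGr (n - 1),
        ∃ c : Fin r → ℂ,
          z = P.corestriction (ι P.shiftGr x) + ∑ i, c i • e i := by
  subst hN
  obtain ⟨e, he, hde, hind, hspan⟩ := exists_cohomology_basis P.atomGr P.atomD (n + 1) hfin hr
  have hgr : n + 1 - 1 = n - 1 + 1 := by ring
  simp only [hgr] at hind hspan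
  refine ⟨fun i => flip (e i), fun i => P.flip_mem.2 (he i), fun i => ?_, fun c x hx h => ?_,
    fun z hz hdz => ?_⟩
  · rw [corestriction_ι_flip, hde, map_zero, neg_zero]
  · rw [← flip_flip x, flip_mem] at hx
    rw [← flip_flip x, corestriction_ι_flip] at h
    refine hind c (-flip x) (neg_mem hx) ?_
    have := congrArg flip h
    rw [map_neg, flip_flip, map_sum] at this
    rw [map_neg, this]
    simp only [map_smul, flip_flip]
  · rw [← flip_flip z, flip_mem] at hz
    rw [← flip_flip z, corestriction_ι_flip, neg_eq_zero] at hdz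
    obtain ⟨x, hx, c, hxc⟩ := hspan (flip z) hz (by
      rw [← flip_flip (P.atomD (flip z)), hdz, map_zero])
    refine ⟨flip (-x), P.flip_mem.2 (neg_mem hx), c, ?_⟩
    rw [corestriction_ι_flip, map_neg, map_neg, neg_neg, ← flip_flip z, hxc, map_add, map_sum]
    simp only [map_smul]

end DGLiePair
end

noncomputable section

/-! ### Complete rings and surjections from a completion -/

section AdicRings

/-- A quotient of an adically complete Noetherian local ring is adically complete. -/
theorem IsAdicComplete.quotient {S : Type*} [CommRing S] [IsNoetherianRing S] [IsLocalRing S]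
    (m I : Ideal S) (hm : m ≠ ⊤) [IsAdicComplete m S] :
    IsAdicComplete (m.map (Ideal.Quotient.mk I)) (S ⧸ I) := by
  by_cases hI : I = ⊤
  · subst hI
    have : Subsingleton (S ⧸ (⊤ : Ideal S)) := Ideal.Quotient.subsingleton_iff.2 rfl
    infer_instance
  have : Nontrivial (S ⧸ I) := Ideal.Quotient.nontrivial_iff.2 hI
  have : IsLocalRing (S ⧸ I) := IsLocalRing.of_surjective' _ Ideal.Quotient.mk_surjective
  have hle : m.map (Ideal.Quotient.mk I) ≤ IsLocalRing.maximalIdeal (S ⧸ I) := by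
    rw [Ideal.map_le_iff_le_comap]
    refine (IsLocalRing.le_maximalIdeal hm).trans (IsLocalRing.eq_maximalIdeal ?_).ge
    exact Ideal.comap_isMaximal_of_surjective _ Ideal.Quotient.mk_surjective
  have hH : IsHausdorff (m.map (Ideal.Quotient.mk I)) (S ⧸ I) :=
    IsHausdorff.of_isLocalRing _ _ fun h => by
      rw [h, top_le_iff] at hle
      exact Ideal.IsPrime.ne_top inferInstance hle
  refine { hH with prec' := fun f hf => ?_ }
  -- Precompleteness: the successive differences lift into the powers of m, and the series of these
  -- lifts converges in S. Separatedness above is Krull's intersection theorem.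
  have hf' : ∀ n, ∃ d ∈ m ^ n, Ideal.Quotient.mk I d = f (n + 1) - f n := by
    intro n
    have h := (hf (Nat.le_succ n)).symm
    rw [SModEq.sub_mem, smul_eq_mul, Ideal.mul_top, ← Ideal.map_pow,
      Ideal.mem_map_iff_of_surjective _ Ideal.Quotient.mk_surjective] at h
    exact h
  choose d hd hdf using hf'
  obtain ⟨s0, hs0⟩ := Ideal.Quotient.mk_surjective (I := I) (f 0)
  have hs : ∀ n, Ideal.Quotient.mk I (s0 + ∑ k ∈ Finset.range n, d k) = f n := by
    intro n
    rw [map_add, map_sum, Finset.sum_congr rfl fun k _ => hdf k, Finset.sum_range_sub, hs0]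
    abel
  obtain ⟨L, hL⟩ := IsPrecomplete.prec (I := m) (M := S) inferInstance
    (f := fun n => s0 + ∑ k ∈ Finset.range n, d k) (by
      intro a b hab
      rw [SModEq.sub_mem, smul_eq_mul, Ideal.mul_top, ← Finset.sum_range_add_sum_Ico _ hab]
      have : ∑ k ∈ Finset.Ico a b, d k ∈ m ^ a := Ideal.sum_mem _ fun k hk =>
        Ideal.pow_le_pow_right (Finset.mem_Ico.1 hk).1 (hd k)
      convert neg_mem this using 1
      abel)
  refine ⟨Ideal.Quotient.mk I L, fun n => ?_⟩
  have h := hL n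
  rw [SModEq.sub_mem, smul_eq_mul, Ideal.mul_top] at h ⊢
  rw [← hs n, ← map_sub, ← Ideal.map_pow]
  exact Ideal.mem_map_of_mem _ h

variable {R T : Type*} [CommRing R] [CommRing T]

/-- Generators of m that are hit modulo m² give surjectivity of J onto m/m². Products of
approximations then give surjectivity on every m^e/m^(e+1). -/
theorem exists_approx_of_generators {J : Ideal R} {m : Ideal T} {g : R →+* T}
    (hg : ∀ a ∈ J, g a ∈ m) (h0 : ∀ t, ∃ r, t - g r ∈ m) {ι : Type*} [Fintype ι] (x : ι → T)
    (hx : m = Ideal.span (Set.range x)) (θ : ι → R) (hθ : ∀ i, θ i ∈ J)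
    (hxθ : ∀ i, x i - g (θ i) ∈ m ^ 2) (e : ℕ) :
    ∀ t ∈ m ^ e, ∃ r ∈ J ^ e, t - g r ∈ m ^ (e + 1) := by
  have hxm : ∀ i, x i ∈ m := fun i => hx ▸ Ideal.subset_span ⟨i, rfl⟩
  have h1 : ∀ t ∈ m, ∃ r ∈ J, t - g r ∈ m ^ 2 := by
    intro t ht
    rw [hx] at ht
    obtain ⟨c, rfl⟩ := (Submodule.mem_span_range_iff_exists_fun T).1 ht
    choose r hr using fun i => h0 (c i)
    refine ⟨∑ i, r i * θ i, Ideal.sum_mem _ fun i _ => J.mul_mem_left _ (hθ i), ?_⟩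
    rw [map_sum, ← Finset.sum_sub_distrib]
    refine Ideal.sum_mem _ fun i _ => ?_
    have h : c i • x i - g (r i * θ i) = (c i - g (r i)) * x i + g (r i) * (x i - g (θ i)) := by
      rw [map_mul, smul_eq_mul]; ring
    rw [h]
    refine add_mem ?_ (Ideal.mul_mem_left _ _ (hxθ i))
    rw [pow_two]
    exact Ideal.mul_mem_mul (hr i) (hxm i)
  induction e with
  | zero =>
    intro t _
    obtain ⟨r, hr⟩ := h0 t
    exact ⟨r, by simp, by simpa using hr⟩
  | succ e ih =>
    intro t ht
    rw [pow_succ'] at ht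
    induction ht using Submodule.mul_induction_on' with
    | mem_mul_mem a ha b hb =>
      obtain ⟨r, hr, har⟩ := h1 a ha
      obtain ⟨s, hs, hbs⟩ := ih b hb
      refine ⟨r * s, by rw [pow_succ']; exact Ideal.mul_mem_mul hr hs, ?_⟩
      have h : a * b - g (r * s) = (a - g r) * b + g r * (b - g s) := by rw [map_mul]; ring
      rw [h]
      refine add_mem ?_ ?_
      · rw [show e + 1 + 1 = 2 + e by ring, pow_add]
        exact Ideal.mul_mem_mul har hb
      · rw [pow_succ' m (e + 1)]
        exact Ideal.mul_mem_mul (hg r hr) hbs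
    | add a _ b _ ha hb =>
      obtain ⟨r, hr, har⟩ := ha
      obtain ⟨s, hs, hbs⟩ := hb
      refine ⟨r + s, add_mem hr hs, ?_⟩
      rw [map_add, add_sub_add_comm]
      exact add_mem har hbs

/-- A ring homomorphism to an adically complete ring which is surjective on the associated graded
rings induces a surjection from the completion. -/
theorem AdicCompletion.exists_surjective {J : Ideal R} {m : Ideal T} [IsAdicComplete m T]
    (g : R →+* T) (hg : ∀ a ∈ J, g a ∈ m)
    (happrox : ∀ e, ∀ t ∈ m ^ e, ∃ r ∈ J ^ e, t - g r ∈ m ^ (e + 1)) :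
    ∃ f : AdicCompletion J R →+* T, Function.Surjective f := by
  have hle : ∀ n, J ^ n ≤ (m ^ n).comap g := fun n =>
    (Ideal.pow_right_mono (fun a ha => hg a ha) n).trans (Ideal.le_comap_pow g n)
  let F : (n : ℕ) → AdicCompletion J R →+* T ⧸ m ^ n := fun n =>
    (Ideal.quotientMap (m ^ n) g (hle n)).comp (AdicCompletion.evalₐ J n).toRingHom
  have hF : ∀ {a b : ℕ} (hab : a ≤ b), (Ideal.Quotient.factorPow m hab).comp (F b) = F a := by
    intro a b hab
    ext x
    obtain ⟨s, rfl⟩ := AdicCompletion.mk_surjective J R x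
    simp only [F, RingHom.comp_apply, AlgHom.toRingHom_eq_coe, RingHom.coe_coe,
      AdicCompletion.evalₐ_mk, Ideal.quotientMap_mk]
    change Ideal.Quotient.mk (m ^ a) (g (s b)) = Ideal.Quotient.mk (m ^ a) (g (s a))
    rw [Ideal.Quotient.eq, ← map_sub]
    exact hle a (Ideal.Quotient.eq.1 (AdicCompletion.Ideal.mk_eq_mk _ hab s))
  refine ⟨IsAdicComplete.liftRingHom m F hF, fun t => ?_⟩
  choose! ρ hρJ hρ using happrox
  -- Successive approximation: each step corrects the current error by an element of J^n, so the
  -- partial sums are Cauchy and their limit maps to t.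
  let A : ℕ → R := fun n => Nat.rec 0 (fun n a => a + ρ n (t - g a)) n
  have hA : ∀ n, A (n + 1) = A n + ρ n (t - g (A n)) := fun n => rfl
  have hAt : ∀ n, t - g (A n) ∈ m ^ n := by
    intro n
    induction n with
    | zero => simp
    | succ n ih =>
      rw [hA, map_add, ← sub_sub]
      exact hρ n _ ih
  let s : AdicCompletion.AdicCauchySequence J R := AdicCompletion.AdicCauchySequence.mk J R A (by
    intro n
    rw [SModEq.sub_mem, smul_eq_mul, Ideal.mul_top, hA, sub_add_cancel_left]
    exact neg_mem (hρJ n _ (hAt n)))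
  refine ⟨AdicCompletion.mk J R s, ?_⟩
  rw [← sub_eq_zero]
  refine IsHausdorff.haus (I := m) (M := T) inferInstance _ fun n => ?_
  rw [SModEq.sub_mem, sub_zero, smul_eq_mul, Ideal.mul_top, ← Ideal.Quotient.eq,
    IsAdicComplete.mk_liftRingHom]
  simp only [F, RingHom.comp_apply, AlgHom.toRingHom_eq_coe, RingHom.coe_coe,
    AdicCompletion.evalₐ_mk, Ideal.quotientMap_mk]
  rw [Ideal.Quotient.eq, ← neg_mem_iff, neg_sub]
  exact hAt n

end AdicRings

/-! ### Dimension of power series rings and their quotients -/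

namespace MvPowerSeries

/-- Each further power series variable raises the Krull dimension by at least one. -/
theorem natCast_le_ringKrullDim {K : Type*} [Field K] (n : ℕ) :
    (n : WithBot ℕ∞) ≤ ringKrullDim (MvPowerSeries (Fin n) K) := by
  induction n with
  | zero => exact ringKrullDim_nonneg_of_nontrivial
  | succ n ih =>
    rw [ringKrullDim_eq_of_ringEquiv (finSuccEquiv K n).toRingEquiv]
    refine le_trans ?_ ringKrullDim_succ_le_ringKrullDim_powerseries
    rw [Nat.cast_add, Nat.cast_one]
    gcongr

variable {K : Type*} [Field K] {n : ℕ}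

/-- A power series without terms of degree less than `k` lies in the `k`-th power of the ideal
generated by the variables. -/
theorem mem_span_X_pow {k : ℕ} {f : MvPowerSeries (Fin n) K}
    (hf : ∀ m : Fin n →₀ ℕ, m.degree < k → coeff m f = 0) :
    f ∈ (Ideal.span (Set.range X) : Ideal (MvPowerSeries (Fin n) K)) ^ k := by
  classical
  induction k generalizing f with
  | zero => simp
  | succ k ih =>
    rcases isEmpty_or_nonempty (Fin n) with hn | hn
    · have h0 : f = 0 := by
        ext m
        rw [Subsingleton.elim m 0]
        exact hf 0 (by simp)
      rw [h0]; exact zero_mem _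
    -- Assigning to each monomial one variable dividing it splits f into a sum of multiples of the
    -- variables.
    have hpick : ∀ m : Fin n →₀ ℕ, m ≠ 0 → ∃ i, m i ≠ 0 := fun m hm => by
      simpa using Finsupp.ne_iff.1 hm
    choose! pick hpick using hpick
    let F : Fin n → MvPowerSeries (Fin n) K := fun i m => if pick m = i then coeff m f else 0
    have hF : ∀ i m, coeff m (F i) = if pick m = i then coeff m f else 0 := fun _ _ => rfl
    have hsum : f = ∑ i, F i := by
      ext m
      rw [map_sum]
      simp only [hF]
      rw [Finset.sum_ite_eq Finset.univ (pick m), if_pos (Finset.mem_univ _)]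
    have hdvd : ∀ i, X i ∣ F i := by
      intro i
      rw [X_dvd_iff]
      intro m hm
      rw [hF]
      split_ifs with h
      · refine hf m ?_
        by_cases hm0 : m = 0
        · rw [hm0]; simp
        · exact absurd (h ▸ hm) (hpick m hm0)
      · rfl
    rw [hsum]
    refine Ideal.sum_mem _ fun i _ => ?_
    obtain ⟨g, hg⟩ := hdvd i
    rw [hg, pow_succ']
    refine Ideal.mul_mem_mul (Ideal.subset_span ⟨i, rfl⟩) (ih fun m hm => ?_)
    have h := coeff_add_monomial_mul (Finsupp.single i 1) m g (1 : K)
    rw [one_mul] at h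
    rw [← h, ← X_def, ← hg, hF]
    split_ifs
    · refine hf _ ?_
      rw [map_add, Finsupp.degree_single]
      omega
    · rfl

theorem span_X_ne_top : (Ideal.span (Set.range X) : Ideal (MvPowerSeries (Fin n) K)) ≠ ⊤ := by
  have h : (Ideal.span (Set.range X) : Ideal (MvPowerSeries (Fin n) K)) ≤
      RingHom.ker (constantCoeff (σ := Fin n) (R := K)) := by
    rw [Ideal.span_le]
    rintro _ ⟨i, rfl⟩
    simp
  intro h1
  rw [h1, top_le_iff] at h
  exact RingHom.ker_ne_top _ h

/-- The dimension of a quotient of a power series ring by an ideal with `r` generators. -/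
theorem natCast_le_ringKrullDim_quotient_add {r : ℕ} (c : Fin r → MvPowerSeries (Fin n) K)
    (hc : ∀ j, constantCoeff (c j) = 0) :
    (n : WithBot ℕ∞) ≤
      ringKrullDim (MvPowerSeries (Fin n) K ⧸ Ideal.span (Set.range c)) + r := by
  classical
  -- Dividing by one element of the maximal ideal lowers the dimension by at most one. Coinciding
  -- c_j only reduce the count, so r remains a bound.
  have h := ringKrullDim_le_ringKrullDim_quotient_add_card (Finset.univ.image c) (by
    rw [IsLocalRing.ringJacobson_eq_maximalIdeal]
    intro x hx
    obtain ⟨j, -, rfl⟩ := Finset.mem_image.1 (Finset.mem_coe.1 hx)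
    rw [SetLike.mem_coe, IsLocalRing.mem_maximalIdeal, mem_nonunits_iff, isUnit_iff_constantCoeff,
      hc j]
    simp)
  rw [Finset.coe_image, Finset.coe_univ, Set.image_univ] at h
  refine (natCast_le_ringKrullDim n).trans (h.trans ?_)
  gcongr
  exact_mod_cast Finset.card_image_le.trans (by simp)

end MvPowerSeries
end

noncomputable section

/-! ### Evaluation of the deformation ring on a formal family -/

namespace KoszulSym

/-- Evaluation on a group-like family is multiplicative: the coproduct of z_m is the Cauchy product
of the family with itself. -/
theorem familySeries_conv {V : Type*} [AddCommGroup V] [Module ℂ V] {gr : ℤ → Submodule ℂ V}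
    [DirectSum.Decomposition gr] {n : ℕ} {z : (Fin n →₀ ℕ) → Sym gr}
    (hz : ∀ m, comul gr (z m) = ∑ p ∈ Finset.HasAntidiagonal.antidiagonal m, z p.1 ⊗ₜ[ℂ] z p.2)
    (θ η : Sym gr →ₗ[ℂ] ℂ) :
    familySeries z (conv gr θ η) = familySeries z θ * familySeries z η := by
  classical
  ext m
  rw [MvPowerSeries.coeff_mul, coeff_familySeries, conv, LinearMap.comp_apply, LinearMap.comp_apply,
    hz, map_sum, map_sum]
  simp

end KoszulSym

namespace DGLiePair

open KoszulSym

variable {G H : Type*} [AddCommGroup G] [Module ℂ G] [AddCommGroup H] [Module ℂ H]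
  (P : DGLiePair G H)

/-- The ring homomorphism from the deformation ring to the base of a formal family of group-like
elements which is a cocycle modulo the ideal `I`. -/
def familyHom {n : ℕ} (z : (Fin n →₀ ℕ) → P.JSym)
    (hz : ∀ m, comul P.shiftGr (z m) = ∑ p ∈ Finset.HasAntidiagonal.antidiagonal m, z p.1 ⊗ₜ[ℂ] z p.2)
    (I : Ideal (MvPowerSeries (Fin n) ℂ))
    (hI : ∀ f : P.JSym →ₗ[ℂ] ℂ, familySeries z (f ∘ₗ P.jacobiD) ∈ I) :
    P.DeformationRing →ₐ[ℂ] MvPowerSeries (Fin n) ℂ ⧸ I :=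
  Unitization.lift
    { toFun := fun φ => Ideal.Quotient.mk I (familySeries z (P.pull φ))
      map_smul' := fun c φ => by
        rw [map_smul, map_smul]
        rfl
      map_zero' := by rw [map_zero, map_zero, map_zero]
      map_add' := fun φ ψ => by rw [map_add, map_add, map_add]
      map_mul' := fun φ ψ => by
        -- The chosen cochain for φψ and the convolution of the cochains for φ and ψ agree only on
        -- cocycles. Their difference is a functional of the form f ∘ D, whose series lies in I.
        obtain ⟨f, hf⟩ := ((isCocycle_pull (φ * ψ)).sub
          ((isCocycle_pull φ).conv P.corestriction_mem (isCocycle_pull ψ))).eq_comp_coder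
          P.corestriction_mem P.corestriction_one (fun w hw => by
            rw [LinearMap.sub_apply, pull_mul φ ψ w hw, sub_self])
        rw [← map_mul, ← familySeries_conv hz, Ideal.Quotient.eq, ← map_sub, hf]
        exact hI f }

theorem familyHom_inr {n : ℕ} (z : (Fin n →₀ ℕ) → P.JSym)
    (hz : ∀ m, comul P.shiftGr (z m) = ∑ p ∈ Finset.HasAntidiagonal.antidiagonal m, z p.1 ⊗ₜ[ℂ] z p.2)
    (I : Ideal (MvPowerSeries (Fin n) ℂ))
    (hI : ∀ f : P.JSym →ₗ[ℂ] ℂ, familySeries z (f ∘ₗ P.jacobiD) ∈ I) (φ : P.CohomologyDual) :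
    P.familyHom z hz I hI (φ : P.DeformationRing) =
      Ideal.Quotient.mk I (familySeries z (P.pull φ)) := by
  simp [familyHom]

/-- Functionals on `ℍ⁰(J^♯)` dual to vectors which are independent in `ℍ¹(𝔤^♯)`. -/
theorem exists_dual_family (hacyclic : ∀ n : ℤ, n ≤ 0 → Subsingleton (P.AtomCohomology n)) {n : ℕ}
    (e : Fin n → G × H) (he : ∀ i, e i ∈ P.shiftGr 0)
    (hde : ∀ i, P.corestriction (ι P.shiftGr (e i)) = 0)
    (hind : ∀ c : Fin n → ℂ, ∀ x ∈ P.shiftGr (0 - 1),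
      P.corestriction (ι P.shiftGr x) = ∑ i, c i • e i → c = 0) :
    ∃ θ : Fin n → P.CohomologyDual,
      ∀ i j, P.pull (θ i) (ι P.shiftGr (e j)) = if i = j then 1 else 0 := by
  let F : (Fin n → ℂ) →ₗ[ℂ] P.JCohomology 0 :=
    P.classMap ∘ₗ ι P.shiftGr ∘ₗ Fintype.linearCombination ℂ e
  have hF : LinearMap.ker F = ⊥ := by
    rw [LinearMap.ker_eq_bot']
    intro c hc
    set v := ∑ i, c i • e i with hv
    have hFc : F c = P.classMap (ι P.shiftGr v) := by
      simp [F, Fintype.linearCombination_apply, hv]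
    have hv0 : v ∈ P.shiftGr 0 := Submodule.sum_mem _ fun i _ => Submodule.smul_mem _ _ (he i)
    have hdv : P.jacobiD (ι P.shiftGr v) = 0 := by
      rw [jacobiD, coder_ι P.corestriction_one, hv, map_sum, map_sum]
      simp [hde]
    have hmem : ι P.shiftGr v ∈ LinearMap.ker P.jacobiD ⊓ redDeg P.shiftGr 0 :=
      ⟨hdv, Submodule.subset_span ⟨1, one_pos, by simpa using IsMonomial.cons hv0 IsMonomial.one⟩⟩
    have h0 := P.classMap_spec.2.2.2 ⟨_, hmem⟩
    rw [← hFc, hc, eq_comm, Submodule.Quotient.mk_eq_zero] at h0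
    obtain ⟨x, hx, hxv⟩ := h0
    -- A combination of the e_i that is a coboundary in Sym V is already one in V, and there the e_i
    -- are independent.
    obtain ⟨u, hu, huv⟩ := exists_of_coder_eq_ι P.corestriction_mem P.corestriction_one
      P.jacobiD_jacobiD
      (fun p hp w hw h => P.exists_corestriction_ι_eq p (hacyclic _ (by omega)) hw h) hv0
      (by simpa using redDeg_le_deg _ _ hx) hxv
    exact hind c u (by simpa using hu) huv
  -- Since F embeds ℂⁿ in ℍ⁰(J^♯), the coordinate functionals extend along F to all of ℍ⁰(J^♯).
  choose θ hθ using fun i => LinearMap.exists_comp_eq_of_ker_le F (LinearMap.proj (R := ℂ) i)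
    (hF ▸ bot_le)
  refine ⟨fun i => P.toDual.symm (θ i), fun i j => ?_⟩
  rw [pull_apply, LinearEquiv.apply_symm_apply]
  have h := hθ i (Pi.single j 1)
  simp only [F, LinearMap.comp_apply, Fintype.linearCombination_apply_single, one_smul,
    LinearMap.proj_apply] at h
  rw [h, Pi.single_apply]

end DGLiePair
end

/-! ### The dimension estimate -/

theorem corollary1p2p3 {G H : Type*} [AddCommGroup G] [Module ℂ G] [AddCommGroup H] [Module ℂ H]
    (P : DGLiePair G H)
    (hacyclic : ∀ n : ℤ, n ≤ 0 → Subsingleton (P.AtomCohomology n))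
    (hfin₁ : Module.Finite ℂ (P.AtomCohomology 1))
    (hfin₂ : Module.Finite ℂ (P.AtomCohomology 2)) :
    (Module.finrank ℂ (P.AtomCohomology 1) : WithBot ℕ∞) ≤
      ringKrullDim P.CompletedDeformationRing +
        (Module.finrank ℂ (P.AtomCohomology 2) : WithBot ℕ∞) := by
  generalize hn : Module.finrank ℂ (P.AtomCohomology 1) = n
  generalize hr : Module.finrank ℂ (P.AtomCohomology 2) = r
  -- For ℍ¹ it is independence of the representatives that matters, giving the dual functionals; for
  -- ℍ² it is spanning, giving the splitting of degree 1.
  obtain ⟨e, he, hde, hind, -⟩ := P.exists_basis 0 (by norm_num) hfin₁ hn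
  obtain ⟨e', -, -, -, hspan⟩ := P.exists_basis 1 (by norm_num) hfin₂ hr
  obtain ⟨h, k, l, hh, hdec⟩ := exists_splitting (P.corestriction ∘ₗ KoszulSym.ι P.shiftGr)
    (P.shiftGr 0) (P.shiftGr 1) e' (by
      simpa only [sub_self, LinearMap.comp_apply] using hspan)
  obtain ⟨z, c, hz0, hz1, -, hΔ, hc, hI⟩ := KoszulSym.exists_kuranishi_family P.corestriction_mem
    P.corestriction_one P.jacobiD_jacobiD e he hde e' h k l (fun w _ => hh w) hdec
  obtain ⟨θ, hθ⟩ := P.exists_dual_family hacyclic e he hde hind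
  set I := Ideal.span (Set.range c) with hI_def
  set M : Ideal (MvPowerSeries (Fin n) ℂ) := Ideal.span (Set.range MvPowerSeries.X) with hM
  let g := P.familyHom z hΔ I hI
  have hcomplete : IsAdicComplete (M.map (Ideal.Quotient.mk I)) (MvPowerSeries (Fin n) ℂ ⧸ I) :=
    IsAdicComplete.quotient M I MvPowerSeries.span_X_ne_top
  have hpull0 : ∀ φ, P.pull φ (z 0) = 0 := by
    intro φ
    rw [hz0, P.pull_apply, P.classMap_spec.1, map_zero]
  have hM1 : ∀ f : MvPowerSeries (Fin n) ℂ, MvPowerSeries.constantCoeff f = 0 → f ∈ M := by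
    intro f hf
    rw [← pow_one M]
    refine MvPowerSeries.mem_span_X_pow fun m hm => ?_
    rw [(Finsupp.degree_eq_zero_iff m).1 (by omega)]
    exact hf
  have hg : ∀ a ∈ P.maximalIdeal, (g : P.DeformationRing →+* _) a ∈
      M.map (Ideal.Quotient.mk I) := by
    intro a ha
    have ha0 : a.fst = 0 := ha
    rw [← Unitization.inl_fst_add_inr_snd_eq a, ha0, Unitization.inl_zero, zero_add]
    change g _ ∈ _
    rw [P.familyHom_inr z hΔ I hI]
    exact Ideal.mem_map_of_mem _ (hM1 _ (hpull0 _))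
  obtain ⟨f, hf⟩ := AdicCompletion.exists_surjective (g : P.DeformationRing →+* _) hg
    (exists_approx_of_generators hg (fun t => by
      obtain ⟨s, rfl⟩ := Ideal.Quotient.mk_surjective t
      refine ⟨algebraMap ℂ _ (MvPowerSeries.constantCoeff s), ?_⟩
      change _ - g _ ∈ _
      rw [AlgHom.commutes]
      change Ideal.Quotient.mk I s - Ideal.Quotient.mk I (MvPowerSeries.C _) ∈ _
      rw [← map_sub]
      exact Ideal.mem_map_of_mem _ (hM1 _ (by simp)))
      (fun i => Ideal.Quotient.mk I (MvPowerSeries.X i))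
      (by rw [hM, Ideal.map_span, ← Set.range_comp]; rfl)
      (fun i => (θ i : P.DeformationRing)) (fun i => Unitization.fst_inr ℂ (θ i)) (fun i => by
      change _ - g _ ∈ _
      rw [P.familyHom_inr z hΔ I hI, ← map_sub, ← Ideal.map_pow]
      -- The series of θ_i has constant term θ_i(1) = 0 and linear coefficients θ_i(e_j) = δ_ij, so
      -- it agrees with X_i up to order two.
      refine Ideal.mem_map_of_mem _ (MvPowerSeries.mem_span_X_pow fun m hm => ?_)
      rw [map_sub, KoszulSym.coeff_familySeries]
      rcases Nat.le_one_iff_eq_zero_or_eq_one.1 (Nat.le_of_lt_succ hm) with h0 | h1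
      · rw [(Finsupp.degree_eq_zero_iff m).1 h0, hpull0]
        simp
      · obtain ⟨j, rfl⟩ := KoszulSym.exists_eq_single_of_degree_eq_one h1
        rw [hz1, hθ, MvPowerSeries.coeff_X]
        simp [Finsupp.single_left_inj, eq_comm]))
  refine (MvPowerSeries.natCast_le_ringKrullDim_quotient_add c fun j => hc j 0 (by simp)).trans ?_
  gcongr
  exact ringKrullDim_le_of_surjective f hf
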